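/- Computations are on the unit-cost real RAM with floor function: memory cells hold exact real numbers, programs are finite and use integer constants only, and each arithmetic operation ($+,-,\times,/$), floor, comparison and memory access (including indirect addressing) takes one time unit. For a set $C\subset\mathbb{R}^2$, its discrete hull is $C^0=\mathrm{conv}(C\cap\mathbb{Z}^2)$. A convex $n$-gon ($n\ge 3$) is the convex hull of $n$ points in strictly convex position; it is given by $n$ and the real coordinates of its vertices in counterclockwise order, and $\delta(P)$ denotes its Euclidean diameter. **Corollary.** There are a single program and an absolute constant $c$ such that, for every $n\ge 3$ and every convex $n$-gon $P$, the program on input $P$ halts after at most $$c\, n\,\log n\,\log^2\bigl(2+\delta(P)\bigr)$$ time units and outputs the discrete hull $P^0$, that is, the number of vertices of $P^0$ and the list of these vertices, each exactly once, in counterclockwise order (the empty list if $P$ contains no lattice point). In particular, the discrete hull of a convex $n$-gon $P$ with $\delta(P)\ge 2$ can be computed in $O(n\log n\log^2\delta(P))$ time. -/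

import Mathlib

namespace DiscreteHull

/-! ### Plane geometry -/

/-- The Euclidean plane. -/
abbrev Plane : Type := EuclideanSpace ℝ (Fin 2)

/-- Twice the signed area of the triangle `p q r`; it is positive exactly when `p, q, r` make a
strict left turn. -/
def orient (p q r : Plane) : ℝ :=
  (q 0 - p 0) * (r 1 - p 1) - (q 1 - p 1) * (r 0 - p 0)

/-- `w 0, …, w (m - 1)` are distinct points in strictly convex position, listed in
counterclockwise order: every triple of increasing indices makes a strict left turn.
(For `m ≤ 2` this says only that the points are distinct.) -/
def IsConvexCCW {m : ℕ} (w : Fin m → Plane) : Prop :=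
  Function.Injective w ∧ ∀ i j k : Fin m, i < j → j < k → 0 < orient (w i) (w j) (w k)

/-- The closed polygonal region with the given vertices in convex position. -/
def polygon {n : ℕ} (v : Fin n → Plane) : Set Plane :=
  convexHull ℝ (Set.range v)

/-- The integer lattice `ℤ × ℤ` in the plane. -/
def lattice : Set Plane :=
  {p | ∀ i, ∃ z : ℤ, p i = z}

/-- The discrete hull of `C`: the convex hull of the lattice points in `C`. -/
def discreteHull (C : Set Plane) : Set Plane :=
  convexHull ℝ (C ∩ lattice)

/-- The list `w` is the boundary description of `H`: it lists all the vertices (extreme points)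
of `H`, each exactly once, in counterclockwise order. The empty list describes the empty set. -/
def IsVertexList (H : Set Plane) {m : ℕ} (w : Fin m → Plane) : Prop :=
  Set.range w = Set.extremePoints ℝ H ∧ IsConvexCCW w

/-! ### The real RAM with floor function

Programs are finite texts that use integer constants only. Memory consists of scalar registers and
of arrays, both numbered by `ℕ`; every cell holds one exact real number. Each arithmetic operation
`+ - * /`, the floor function, each comparison, and each memory access takes unit time. -/

/-- The memory of the machine: register `x` holds `reg x`, and cell `i` of array `a` holds
`arr a i`. -/
structure Memory where
  reg : ℕ → ℝ
  arr : ℕ → ℕ → ℝ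

/-- Arithmetic expressions. -/
inductive Expr : Type
  | const (z : ℤ)
  | var (x : ℕ)
  | load (a : ℕ) (i : Expr)
  | add (e f : Expr)
  | sub (e f : Expr)
  | mul (e f : Expr)
  | div (e f : Expr)
  | floor (e : Expr)

/-- The value of an expression. An array index is rounded down to a natural number, and a quotient
with denominator `0` is `0`. -/
noncomputable def Expr.eval (s : Memory) : Expr → ℝ
  | .const z => (z : ℝ)
  | .var x => s.reg x
  | .load a i => s.arr a ⌊i.eval s⌋₊
  | .add e f => e.eval s + f.eval s
  | .sub e f => e.eval s - f.eval s
  | .mul e f => e.eval s * f.eval s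
  | .div e f => e.eval s / f.eval s
  | .floor e => ((⌊e.eval s⌋ : ℤ) : ℝ)

/-- The time for evaluating an expression: one unit for each operation, constant or access. -/
def Expr.cost : Expr → ℕ
  | .const _ => 1
  | .var _ => 1
  | .load _ i => i.cost + 1
  | .add e f => e.cost + f.cost + 1
  | .sub e f => e.cost + f.cost + 1
  | .mul e f => e.cost + f.cost + 1
  | .div e f => e.cost + f.cost + 1
  | .floor e => e.cost + 1

/-- Boolean tests. -/
inductive Test : Type
  | le (e f : Expr)
  | not (b : Test)
  | and (b c : Test)

/-- The truth value of a test. -/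
def Test.Holds (s : Memory) : Test → Prop
  | .le e f => e.eval s ≤ f.eval s
  | .not b => ¬ b.Holds s
  | .and b c => b.Holds s ∧ c.Holds s

/-- The time for evaluating a test. -/
def Test.cost : Test → ℕ
  | .le e f => e.cost + f.cost + 1
  | .not b => b.cost + 1
  | .and b c => b.cost + c.cost + 1

/-- Programs. -/
inductive Program : Type
  | skip
  | assign (x : ℕ) (e : Expr)
  | store (a : ℕ) (i e : Expr)
  | seq (P Q : Program)
  | branch (b : Test) (P Q : Program)
  | loop (b : Test) (P : Program)

/-- `Runs P s s' t`: the program `P`, started with memory `s`, halts after exactly `t` time units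
with memory `s'`. Here `loop b P` is "while `b` do `P`". -/
inductive Runs : Program → Memory → Memory → ℕ → Prop
  | skip (s : Memory) : Runs .skip s s 1
  | assign (x : ℕ) (e : Expr) (s : Memory) :
      Runs (.assign x e) s
        { reg := Function.update s.reg x (e.eval s), arr := s.arr }
        (e.cost + 1)
  | store (a : ℕ) (i e : Expr) (s : Memory) :
      Runs (.store a i e) s
        { reg := s.reg
          arr := Function.update s.arr a (Function.update (s.arr a) ⌊i.eval s⌋₊ (e.eval s)) }
        (i.cost + e.cost + 1)
  | seq {P Q : Program} {s s₁ s₂ : Memory} {t₁ t₂ : ℕ}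
      (hP : Runs P s s₁ t₁) (hQ : Runs Q s₁ s₂ t₂) :
      Runs (.seq P Q) s s₂ (t₁ + t₂)
  | branch_true {b : Test} {P Q : Program} {s s₁ : Memory} {t : ℕ}
      (hb : b.Holds s) (hP : Runs P s s₁ t) :
      Runs (.branch b P Q) s s₁ (b.cost + 1 + t)
  | branch_false {b : Test} {P Q : Program} {s s₁ : Memory} {t : ℕ}
      (hb : ¬ b.Holds s) (hQ : Runs Q s s₁ t) :
      Runs (.branch b P Q) s s₁ (b.cost + 1 + t)
  | loop_true {b : Test} {P : Program} {s s₁ s₂ : Memory} {t₁ t₂ : ℕ}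
      (hb : b.Holds s) (hP : Runs P s s₁ t₁) (hrest : Runs (.loop b P) s₁ s₂ t₂) :
      Runs (.loop b P) s s₂ (b.cost + 1 + t₁ + t₂)
  | loop_false {b : Test} {P : Program} {s : Memory}
      (hb : ¬ b.Holds s) :
      Runs (.loop b P) s s (b.cost + 1)

/-- The machine is deterministic: the final memory and the running time are determined by the
program and the initial memory. -/
theorem Runs.deterministic {P : Program} {s s₁ s₂ : Memory} {t₁ t₂ : ℕ}
    (h₁ : Runs P s s₁ t₁) (h₂ : Runs P s s₂ t₂) : s₁ = s₂ ∧ t₁ = t₂ := by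
  induction h₁ generalizing s₂ t₂ with
  | skip s => cases h₂; exact ⟨rfl, rfl⟩
  | assign x e s => cases h₂; exact ⟨rfl, rfl⟩
  | store a i e s => cases h₂; exact ⟨rfl, rfl⟩
  | seq hP hQ ihP ihQ =>
    cases h₂ with
    | seq hP' hQ' =>
      obtain ⟨rfl, rfl⟩ := ihP hP'
      obtain ⟨rfl, rfl⟩ := ihQ hQ'
      exact ⟨rfl, rfl⟩
  | branch_true hb hP ih =>
    cases h₂ with
    | branch_true hb' hP' =>
      obtain ⟨rfl, rfl⟩ := ih hP'
      exact ⟨rfl, rfl⟩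
    | branch_false hb' hQ' => exact absurd hb hb'
  | branch_false hb hQ ih =>
    cases h₂ with
    | branch_true hb' hP' => exact absurd hb' hb
    | branch_false hb' hQ' =>
      obtain ⟨rfl, rfl⟩ := ih hQ'
      exact ⟨rfl, rfl⟩
  | loop_true hb hP hrest ihP ihrest =>
    cases h₂ with
    | loop_true hb' hP' hrest' =>
      obtain ⟨rfl, rfl⟩ := ihP hP'
      obtain ⟨rfl, rfl⟩ := ihrest hrest'
      exact ⟨rfl, rfl⟩
    | loop_false hb' => exact absurd hb hb'
  | loop_false hb =>
    cases h₂ with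
    | loop_true hb' hP' hrest' => exact absurd hb' hb
    | loop_false hb' => exact ⟨rfl, rfl⟩

/-- The initial memory for the input `v`: register `0` holds the number of points, arrays `0` and
`1` hold the x-coordinates and the y-coordinates, and every other cell holds `0`. -/
noncomputable def inputMemory {n : ℕ} (v : Fin n → Plane) : Memory where
  reg := fun x => if x = 0 then (n : ℝ) else 0
  arr := fun a i =>
    if h : i < n then
      if a = 0 then v ⟨i, h⟩ 0 else if a = 1 then v ⟨i, h⟩ 1 else 0
    else 0

/-- The memory `s` holds the list of points `w` as its output: register `0` holds the number of
points, and arrays `0` and `1` hold the x-coordinates and the y-coordinates. -/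
def HasOutput (s : Memory) {m : ℕ} (w : Fin m → Plane) : Prop :=
  s.reg 0 = (m : ℝ) ∧ ∀ i : Fin m, s.arr 0 i = w i 0 ∧ s.arr 1 i = w i 1

end DiscreteHull

namespace DiscreteHull

/-! ### Execution of loop-free programs and a calculus of time bounds -/

/-! Fix `m` with `δ(P) < 2 ^ m`, so that `m` can be taken of order `log (2 + δ(P))`. The program
runs in time `O(n * (m + 1) ^ 2)`; since `log n ≥ 1` for `n ≥ 3`, this is stronger than the bound
claimed.

A vertical line sweeps the polygon and cuts it into at most `n` slabs, each bounded by one lower and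
one upper edge. In a slab the lattice points of the lower hull are found one after another. The
successor of a point `p` is the farthest lattice point in the lowest direction seen from `p`, inside
a region bounded by two lines and a vertical line. Two logarithmic bounds carry the proof. (1) One
successor is found by a continued-fraction search: a unimodular basis whose cone encloses the wanted
direction is refined from both sides, and each completed round at least doubles the abscissa of its
first vector, which never exceeds the width while the search is on (`Wedge.Cone.step_left`,
`Wedge.Cone.step_right`, `roundProg_spec`, `nextProg_spec`). (2) A chain of successors is short: at
each inner edge either the distance from the left end doubles or the distance to the right end
halves, since otherwise a point of the chain reflected in its neighbour would be a lattice point of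
the region violating the choice of the chain (`Wedge.IsChain.double`, `Wedge.IsChain.length_le`). So
a slab costs `O((m + 1) ^ 2)` and contributes `O(m + 1)` candidates (`slabProg_spec`).

The candidates of all slabs come sorted by abscissa and dominate all lattice points of the polygon
from below (`Cov`, `Candidates`). A Graham scan, linear in their number, reduces them to the lower
hull (`scanProg_spec`). The upper hull is the lower hull of the polygon reflected in the origin,
found by a second pass with all coordinates negated. At most the two end points are common to both
hulls (`LowerHull.common`). After their duplicates are removed, the concatenation is in
counterclockwise strictly convex position and consists of all extreme points of the discrete hull
(`isVertexList`). -/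

instance : Add Expr := ⟨Expr.add⟩
instance : Sub Expr := ⟨Expr.sub⟩
instance : Mul Expr := ⟨Expr.mul⟩
instance : Div Expr := ⟨Expr.div⟩
instance (k : ℕ) : OfNat Expr k := ⟨Expr.const k⟩

infix:50 " ≼ " => Test.le
infix:30 " ≔ " => Program.assign
infixr:20 " ;; " => Program.seq

/-- The least integer above an expression. -/
def Expr.ceil (e : Expr) : Expr := 0 - Expr.floor (0 - e)

section Eval
variable (s : Memory) (e f : Expr)

@[simp] theorem eval_add : (e + f).eval s = e.eval s + f.eval s := rfl
@[simp] theorem eval_sub : (e - f).eval s = e.eval s - f.eval s := rfl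
@[simp] theorem eval_mul : (e * f).eval s = e.eval s * f.eval s := rfl
@[simp] theorem eval_div : (e / f).eval s = e.eval s / f.eval s := rfl
@[simp] theorem eval_ofNat (k : ℕ) : Expr.eval s ofNat(k) = (k : ℝ) := by
  change ((k : ℤ) : ℝ) = k
  simp
@[simp] theorem eval_var (x : ℕ) : (Expr.var x).eval s = s.reg x := rfl
@[simp] theorem eval_load (a : ℕ) : (Expr.load a e).eval s = s.arr a ⌊e.eval s⌋₊ := rfl
@[simp] theorem eval_floor : e.floor.eval s = (⌊e.eval s⌋ : ℤ) := rfl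
@[simp] theorem eval_ceil : e.ceil.eval s = (⌈e.eval s⌉ : ℤ) := by
  simp [Expr.ceil, Int.floor_neg]
@[simp] theorem holds_le : (e ≼ f).Holds s ↔ e.eval s ≤ f.eval s := Iff.rfl
@[simp] theorem holds_not (b : Test) : b.not.Holds s ↔ ¬ b.Holds s := Iff.rfl
@[simp] theorem holds_and (b c : Test) : (b.and c).Holds s ↔ b.Holds s ∧ c.Holds s := Iff.rfl

end Eval

/-- The memory after writing `r` to register `x`. -/
noncomputable def Memory.set (s : Memory) (x : ℕ) (r : ℝ) : Memory where
  reg := Function.update s.reg x r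
  arr := s.arr

/-- The memory after writing `r` to cell `i` of array `a`. -/
noncomputable def Memory.put (s : Memory) (a i : ℕ) (r : ℝ) : Memory where
  reg := s.reg
  arr := Function.update s.arr a (Function.update (s.arr a) i r)

@[simp] theorem Memory.set_reg (s : Memory) (x y : ℕ) (r : ℝ) :
    (s.set x r).reg y = if y = x then r else s.reg y := by
  simp [Memory.set, Function.update_apply]
@[simp] theorem Memory.set_arr (s : Memory) (x : ℕ) (r : ℝ) : (s.set x r).arr = s.arr := rfl
@[simp] theorem Memory.put_reg (s : Memory) (a i : ℕ) (r : ℝ) : (s.put a i r).reg = s.reg := rfl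
@[simp] theorem Memory.put_arr (s : Memory) (a b i j : ℕ) (r : ℝ) :
    (s.put a i r).arr b j = if b = a ∧ j = i then r else s.arr b j := by
  by_cases hb : b = a
  · subst hb
    by_cases hj : j = i
    · subst hj; simp [Memory.put]
    · simp [Memory.put, hj]
  · simp [Memory.put, hb]

open Classical in
/-- The effect of a loop-free program. -/
noncomputable def exec : Program → Memory → Memory
  | .skip, s => s
  | .assign x e, s => s.set x (e.eval s)
  | .store a i e, s => s.put a ⌊i.eval s⌋₊ (e.eval s)
  | .seq P Q, s => exec Q (exec P s)
  | .branch b P Q, s => if b.Holds s then exec P s else exec Q s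
  | .loop _ _, s => s

/-- The program contains no loop. -/
def LoopFree : Program → Bool
  | .skip => true
  | .assign _ _ => true
  | .store _ _ _ => true
  | .seq P Q => LoopFree P && LoopFree Q
  | .branch _ P Q => LoopFree P && LoopFree Q
  | .loop _ _ => false

/-- A time bound for a loop-free program. -/
def timeBound : Program → ℕ
  | .skip => 1
  | .assign _ e => e.cost + 1
  | .store _ i e => i.cost + e.cost + 1
  | .seq P Q => timeBound P + timeBound Q
  | .branch b P Q => b.cost + 1 + (timeBound P + timeBound Q)
  | .loop _ _ => 0

section Exec
variable (s : Memory)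
theorem exec_skip : exec .skip s = s := rfl
theorem exec_assign (x : ℕ) (e : Expr) : exec (x ≔ e) s = s.set x (e.eval s) := rfl
theorem exec_store (a : ℕ) (i e : Expr) :
    exec (.store a i e) s = s.put a ⌊i.eval s⌋₊ (e.eval s) := rfl
theorem exec_seq (P Q : Program) : exec (P ;; Q) s = exec Q (exec P s) := rfl
theorem exec_branch_pos {b : Test} {P Q : Program} (h : b.Holds s) :
    exec (.branch b P Q) s = exec P s := if_pos h
theorem exec_branch_neg {b : Test} {P Q : Program} (h : ¬ b.Holds s) :
    exec (.branch b P Q) s = exec Q s := if_neg h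
end Exec

theorem runs_exec (P : Program) (s : Memory) (h : LoopFree P = true) :
    ∃ t, Runs P s (exec P s) t ∧ t ≤ timeBound P := by
  induction P generalizing s with
  | skip => exact ⟨_, .skip s, le_rfl⟩
  | assign x e => exact ⟨_, .assign x e s, le_rfl⟩
  | store a i e => exact ⟨_, .store a i e s, le_rfl⟩
  | seq P Q ihP ihQ =>
    simp only [LoopFree, Bool.and_eq_true] at h
    obtain ⟨t₁, r₁, h₁⟩ := ihP s h.1
    obtain ⟨t₂, r₂, h₂⟩ := ihQ (exec P s) h.2
    exact ⟨_, .seq r₁ r₂, by simp only [timeBound]; omega⟩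
  | branch b P Q ihP ihQ =>
    simp only [LoopFree, Bool.and_eq_true] at h
    by_cases hb : b.Holds s
    · obtain ⟨t, r, ht⟩ := ihP s h.1
      rw [exec_branch_pos s hb]
      exact ⟨_, .branch_true hb r, by simp only [timeBound]; omega⟩
    · obtain ⟨t, r, ht⟩ := ihQ s h.2
      rw [exec_branch_neg s hb]
      exact ⟨_, .branch_false hb r, by simp only [timeBound]; omega⟩
  | loop b P => simp [LoopFree] at h

/-- Started with memory `s`, the program `P` halts within `B` time units with a memory
satisfying `Q`. -/
def Ends (P : Program) (s : Memory) (B : ℕ) (Q : Memory → Prop) : Prop :=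
  ∃ s' t, Runs P s s' t ∧ t ≤ B ∧ Q s'

/-! ### Proof rules for termination within a time bound -/

namespace Ends
variable {P P' : Program} {s : Memory} {B B' : ℕ} {Q Q' : Memory → Prop}

theorem mono (h : Ends P s B Q) (hB : B ≤ B') (hQ : ∀ s', Q s' → Q' s') : Ends P s B' Q' := by
  obtain ⟨s', t, r, ht, hq⟩ := h
  exact ⟨s', t, r, ht.trans hB, hQ _ hq⟩

theorem seq (h : Ends P s B Q) (h' : ∀ s', Q s' → Ends P' s' B' Q') :
    Ends (P ;; P') s (B + B') Q' := by
  obtain ⟨s₁, t₁, r₁, ht₁, hq⟩ := h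
  obtain ⟨s₂, t₂, r₂, ht₂, hq'⟩ := h' _ hq
  exact ⟨s₂, _, .seq r₁ r₂, by omega, hq'⟩

theorem of_exec (hP : LoopFree P = true) (h : Q (exec P s)) : Ends P s (timeBound P) Q := by
  obtain ⟨t, r, ht⟩ := runs_exec P s hP
  exact ⟨_, t, r, ht, h⟩

theorem branch {b : Test} (h : b.Holds s → Ends P s B Q) (h' : ¬ b.Holds s → Ends P' s B Q) :
    Ends (.branch b P P') s (b.cost + 1 + B) Q := by
  by_cases hb : b.Holds s
  · obtain ⟨s', t, r, ht, hq⟩ := h hb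
    exact ⟨s', _, .branch_true hb r, by omega, hq⟩
  · obtain ⟨s', t, r, ht, hq⟩ := h' hb
    exact ⟨s', _, .branch_false hb r, by omega, hq⟩

/-- The rule for loops: an invariant `I k` for the situation after `k` rounds, which bounds the
number of rounds by `K`. -/
theorem loop {b : Test} {K C : ℕ} (I : ℕ → Memory → Prop) (h0 : I 0 s)
    (step : ∀ k s', I k s' → b.Holds s' → k < K ∧ Ends P s' C (I (k + 1))) :
    Ends (.loop b P) s ((K + 1) * (b.cost + 1 + C)) (fun s' => ∃ k, I k s' ∧ ¬ b.Holds s') := by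
  -- Induction on the number `r` of rounds still allowed. At `r = 0` the test must fail, because a
  -- round that starts forces `k < K`.
  suffices H : ∀ (r k : ℕ) (s : Memory), K ≤ k + r → I k s →
      Ends (.loop b P) s ((r + 1) * (b.cost + 1 + C)) (fun s' => ∃ k, I k s' ∧ ¬ b.Holds s') from
    H K 0 s (by omega) h0
  intro r
  induction r with
  | zero =>
    intro k s hk hI
    by_cases hb : b.Holds s
    · have := (step k s hI hb).1
      omega
    · exact ⟨s, _, .loop_false hb, by omega, k, hI, hb⟩
  | succ r ih =>
    intro k s hk hI
    by_cases hb : b.Holds s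
    · obtain ⟨s₁, t₁, r₁, ht₁, hI₁⟩ := (step k s hI hb).2
      obtain ⟨s₂, t₂, r₂, ht₂, hq⟩ := ih (k + 1) s₁ (by omega) hI₁
      refine ⟨s₂, _, .loop_true hb r₁ r₂, ?_, hq⟩
      rw [add_mul (r + 1) 1]
      omega
    · refine ⟨s, _, .loop_false hb, ?_, k, hI, hb⟩
      rw [add_mul (r + 1) 1]
      omega

end Ends

end DiscreteHull

namespace DiscreteHull

/-! ### The lowest lattice direction in a region bounded by three lines -/

/-- The data of the region `{(x, y) | x ≤ M, lam x - S ≤ y ≤ mu x + R}`. -/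
structure Wedge where
  lam : ℝ
  mu : ℝ
  S : ℝ
  R : ℝ
  M : ℝ

namespace Wedge

/-- Membership in the region. -/
def Mem (T : Wedge) (x y : ℝ) : Prop :=
  x ≤ T.M ∧ 0 ≤ T.S + y - T.lam * x ∧ 0 ≤ T.R - y + T.mu * x

/-- The region contains the origin. -/
structure Pointed (T : Wedge) : Prop where
  hS : 0 ≤ T.S
  hR : 0 ≤ T.R
  hM : 0 ≤ T.M

variable {T : Wedge}

theorem Mem.combo {x y x' y' a b : ℝ} (h : T.Mem x y) (h' : T.Mem x' y') (ha : 0 ≤ a)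
    (hb : 0 ≤ b) (hab : a + b = 1) : T.Mem (a * x + b * x') (a * y + b * y') := by
  obtain ⟨h1, h2, h3⟩ := h
  obtain ⟨h1', h2', h3'⟩ := h'
  have hb' : b = 1 - a := by linarith
  subst hb'
  refine ⟨?_, ?_, ?_⟩
  · nlinarith [mul_le_mul_of_nonneg_left h1 ha, mul_le_mul_of_nonneg_left h1' hb]
  · nlinarith [mul_nonneg ha h2, mul_nonneg hb h2']
  · nlinarith [mul_nonneg ha h3, mul_nonneg hb h3']

theorem Pointed.mem_zero (hT : T.Pointed) : T.Mem 0 0 := by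
  have := hT.hS
  have := hT.hR
  exact ⟨hT.hM, by simpa, by simpa⟩

/-- A convex region containing the origin is star-shaped about it. This is how a lattice point of
the region is shrunk onto a clipped ray below. -/
theorem Mem.scale (hT : T.Pointed) {x y a : ℝ} (h : T.Mem x y) (ha : 0 ≤ a) (ha1 : a ≤ 1) :
    T.Mem (a * x) (a * y) := by
  simpa using h.combo hT.mem_zero ha (sub_nonneg.2 ha1) (by ring)

/-- The ray from `(cx, cy)` in direction `(ex, ey)` meets the region for parameters in
`[lo, hi]`. -/
def IsClip (T : Wedge) (cx cy ex ey lo hi : ℝ) : Prop :=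
  0 ≤ lo ∧ ∀ t : ℝ, 0 ≤ t → (T.Mem (cx + t * ex) (cy + t * ey) ↔ lo ≤ t ∧ t ≤ hi)

/-- A lattice basis `(a, b), (c, d)` whose cone contains all lattice points of the region that
are candidates for the lowest direction. -/
structure Cone (T : Wedge) (a b c d : ℤ) : Prop where
  ha : 1 ≤ a
  hc : 1 ≤ c
  det : a * d - b * c = 1
  hu : ¬ T.Mem a b
  left : ∀ x y : ℤ, 1 ≤ x → T.Mem x y → 1 ≤ a * y - b * x
  right : ¬ T.Mem c d → ∀ x y : ℤ, 1 ≤ x → T.Mem x y → 1 ≤ x * d - y * c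

/-- No lattice point of the region has a lower direction than `(c, d)`. -/
def Low (T : Wedge) (c d : ℤ) : Prop :=
  ∀ x y : ℤ, 1 ≤ x → T.Mem x y → x * d - y * c ≤ 0

/-- The lattice point in the lowest direction, and the farthest one in that direction. -/
structure Lowest (T : Wedge) (x y : ℤ) : Prop where
  pos : 1 ≤ x
  mem : T.Mem x y
  low : ∀ x' y' : ℤ, 1 ≤ x' → T.Mem x' y' →
    0 ≤ x * y' - y * x' ∧ (x * y' - y * x' = 0 → x' ≤ x)

/-- The column `x = 1` meets the region in the interval from `lam - S` to `mu + R`, and shrinking by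
the factor `1 / x` moves every lattice point of the region into this column. Hence all slopes `y /
x` exceed `d - 1`, and if `(1, d)` is outside, which can only be because it is too high, all slopes
are below `d`. -/
theorem cone_init (hT : T.Pointed) (hM : 1 ≤ T.M) {d : ℤ} (hd : d = ⌈T.lam - T.S⌉) :
    Cone T 1 (d - 1) 1 d ∧ (T.Mem 1 d ↔ d - T.mu ≤ T.R) := by
  have h1 : T.lam - T.S ≤ d := hd ▸ Int.le_ceil _
  have h2 : (d : ℝ) < T.lam - T.S + 1 := hd ▸ Int.ceil_lt_add_one _
  have hmem : T.Mem 1 d ↔ d - T.mu ≤ T.R :=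
    ⟨fun h => by linarith [h.2.2], fun h => ⟨hM, by linarith, by linarith⟩⟩
  have key : ∀ x y : ℤ, 1 ≤ x → T.Mem x y → T.Mem 1 ((y : ℝ) / x) := by
    intro x y hx h
    have hx' : (1 : ℝ) ≤ x := by exact_mod_cast hx
    have := h.scale hT (a := 1 / (x : ℝ)) (by positivity) (by
      rw [div_le_one (by positivity)]; exact hx')
    convert this using 1
    · field_simp
    · field_simp
  refine ⟨⟨le_rfl, le_rfl, by ring, ?_, ?_, ?_⟩, hmem⟩
  · rintro ⟨-, h, -⟩
    push_cast at h
    linarith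
  · intro x y hx h
    have hx' : (0 : ℝ) < x := by exact_mod_cast hx
    have h3 := (key x y hx h).2.1
    have h4 : ((d - 1 : ℤ) : ℝ) < y / x := by push_cast; linarith
    rw [lt_div_iff₀ hx'] at h4
    have : (d - 1) * x < y := by exact_mod_cast h4
    linarith
  · intro hn x y hx h
    have hx' : (0 : ℝ) < x := by exact_mod_cast hx
    have h3 := (key x y hx h).2.2
    have h4 : (y : ℝ) / x < d := by
      by_contra h5
      exact hn (by simpa using hmem.2 (by linarith))
    rw [div_lt_iff₀ hx'] at h4
    have : y < d * x := by exact_mod_cast h4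
    linarith

/-! ### Refining the unimodular basis -/

section Steps
variable {a b c d : ℤ} {lo hi : ℝ}

/-- Cramer's rule for a basis of determinant one: `x * d - y * c` and `a * y - b * x` are the
coordinates with respect to `(a, b)` and `(c, d)`. The first one is positive exactly for the points
in a lower direction than `(c, d)`. Below they are called `i` and `m`, and the basis vectors `u` and
`w`. -/
theorem Cone.coords (h : Cone T a b c d) (x y : ℤ) :
    x = (x * d - y * c) * a + (a * y - b * x) * c ∧
      y = (x * d - y * c) * b + (a * y - b * x) * d := by
  have := h.det
  constructor
  · linear_combination (-x) * this
  · linear_combination (-y) * this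

theorem Cone.coords_real (h : Cone T a b c d) (x y : ℤ) :
    (x : ℝ) = (x * d - y * c : ℤ) * a + (a * y - b * x : ℤ) * c ∧
      (y : ℝ) = (x * d - y * c : ℤ) * b + (a * y - b * x : ℤ) * d := by
  exact_mod_cast h.coords x y

/-- Division by the coordinate `i ≥ 1` takes the point `i u + m w` to `u + (m / i) w`, which is on
the clipped ray and still in the region. -/
theorem Cone.clip_left (hT : T.Pointed) (h : Cone T a b c d) (hc : IsClip T a b c d lo hi)
    {x y : ℤ} (hx : 1 ≤ x) (hm : T.Mem x y) (hpos : 1 ≤ x * d - y * c) :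
    lo * (x * d - y * c : ℤ) ≤ (a * y - b * x : ℤ) ∧
      (a * y - b * x : ℤ) ≤ hi * (x * d - y * c : ℤ) := by
  obtain ⟨e1, e2⟩ := h.coords_real x y
  have hl := h.left x y hx hm
  generalize x * d - y * c = i at *
  generalize a * y - b * x = m at *
  have hi0 : (1 : ℝ) ≤ i := by exact_mod_cast hpos
  have hm0 : (1 : ℝ) ≤ m := by exact_mod_cast hl
  have h1 := hm.scale hT (a := 1 / (i : ℝ)) (by positivity) (by
      rw [div_le_one (by positivity)]; exact hi0)
  rw [e1, e2] at h1
  have h2 := (hc.2 (m / i) (by positivity)).1 (by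
    convert h1 using 1 <;> field_simp)
  rwa [le_div_iff₀ (by positivity), div_le_iff₀ (by positivity)] at h2

/-- The counterpart of `Cone.clip_left`: division by `m ≥ 1` takes the point to `w + (i / m) u`. -/
theorem Cone.clip_right (hT : T.Pointed) (h : Cone T a b c d) (hc : IsClip T c d a b lo hi)
    {x y : ℤ} (hx : 1 ≤ x) (hm : T.Mem x y) (hpos : 1 ≤ x * d - y * c) :
    lo * (a * y - b * x : ℤ) ≤ (x * d - y * c : ℤ) ∧
      (x * d - y * c : ℤ) ≤ hi * (a * y - b * x : ℤ) := by
  obtain ⟨e1, e2⟩ := h.coords_real x y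
  have hl := h.left x y hx hm
  generalize x * d - y * c = i at *
  generalize a * y - b * x = m at *
  have hi0 : (1 : ℝ) ≤ i := by exact_mod_cast hpos
  have hm0 : (1 : ℝ) ≤ m := by exact_mod_cast hl
  have h1 := hm.scale hT (a := 1 / (m : ℝ)) (by positivity) (by
      rw [div_le_one (by positivity)]; exact hm0)
  rw [e1, e2] at h1
  have h2 := (hc.2 (i / m) (by positivity)).1 (by
    convert h1 using 1 <;> (field_simp; ring))
  rwa [le_div_iff₀ (by positivity), div_le_iff₀ (by positivity)] at h2

theorem Cone.low_of_empty (hT : T.Pointed) (h : Cone T a b c d) (hc : IsClip T a b c d lo hi)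
    (he : hi < lo) : Low T c d := by
  intro x y hx hm
  by_contra hpos
  have hpos' : 1 ≤ x * d - y * c := by omega
  have := h.clip_left hT hc hx hm hpos'
  have hi0 : (1 : ℝ) ≤ (x * d - y * c : ℤ) := by exact_mod_cast hpos'
  nlinarith

/-- If `u + t w` lies in the region for no integer `t` and `w` itself lies in it, nothing is lower
than `w`. A lower point `i u + m w` could be averaged with `w` so that the coefficient of `u`
becomes one; the resulting parameter `(m + i - 1) / i` is at most `hi`, yet it is at least the
integer `⌈m / i⌉`, hence at least `⌈lo⌉`. -/
theorem Cone.low_of_gap (hT : T.Pointed) (h : Cone T a b c d) (hc : IsClip T a b c d lo hi)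
    (hw : T.Mem c d) (hg : hi < ⌈lo⌉) : Low T c d := by
  intro x y hx hm
  by_contra hpos
  have hpos' : 1 ≤ x * d - y * c := by omega
  obtain ⟨h1, -⟩ := h.clip_left hT hc hx hm hpos'
  obtain ⟨e1, e2⟩ := h.coords_real x y
  have hl := h.left x y hx hm
  generalize x * d - y * c = i at *
  generalize a * y - b * x = m at *
  have hi0 : (1 : ℝ) ≤ i := by exact_mod_cast hpos'
  have hm0 : (1 : ℝ) ≤ m := by exact_mod_cast hl
  have h2 := hm.combo hw (a := 1 / (i : ℝ)) (b := (i - 1) / i) (by positivity)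
    (div_nonneg (by linarith) (by positivity)) (by field_simp; ring)
  rw [e1, e2] at h2
  have h3 := ((hc.2 ((m + i - 1) / i)
    (div_nonneg (by linarith) (by positivity))).1 (by
      convert h2 using 1 <;> (field_simp; ring))).2
  have h4 : (⌈lo⌉ : ℝ) ≤ (⌈(m : ℝ) / i⌉ : ℤ) := by
    exact_mod_cast Int.ceil_mono ((le_div_iff₀ (by positivity)).2 h1)
  -- Integrality of `m` and `i` turns the strict inequality `⌈m / i⌉ * i < m + i` into this one.
  have h5 : (⌈(m : ℝ) / i⌉ : ℝ) ≤ (m + i - 1) / i := by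
    rw [le_div_iff₀ (by positivity)]
    have h6 : (⌈(m : ℝ) / i⌉ : ℝ) < m / i + 1 := Int.ceil_lt_add_one _
    have h7 : (⌈(m : ℝ) / i⌉ : ℝ) * i < m + i := by
      calc (⌈(m : ℝ) / i⌉ : ℝ) * i < (m / i + 1) * i := by
            exact mul_lt_mul_of_pos_right h6 (by linarith)
        _ = m + i := by field_simp
    have h8 : ⌈(m : ℝ) / i⌉ * i < m + i := by exact_mod_cast h7
    have h9 : ⌈(m : ℝ) / i⌉ * i ≤ m + i - 1 := by omega
    exact_mod_cast h9
  linarith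

/-- Otherwise `lo = 0`, and the parameter `0` would put `(a, b)` into the region. -/
theorem Cone.ceil_pos (h : Cone T a b c d) (hc : IsClip T a b c d lo hi) (hle : lo ≤ hi) :
    1 ≤ ⌈lo⌉ := by
  by_contra hj
  have h0 : lo ≤ 0 := by
    have : ⌈lo⌉ ≤ 0 := by omega
    exact_mod_cast Int.ceil_le.1 this
  have h1 : lo = 0 := le_antisymm h0 hc.1
  exact h.hu (by simpa using (hc.2 0 le_rfl).2 ⟨h0, by linarith⟩)

/-- The new basis is `u + (j - 1) w`, `u + j w`. By `Cone.clip_left` a point below `w` has `m / i ≥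
lo > j - 1`, so it stays above the new first vector. If the new second vector is outside, then `hi <
j`; in this case `hor` says that `w` is outside too, so every point is below `w` and has `m / i ≤ hi
< j`. -/
theorem Cone.step_left (hT : T.Pointed) (h : Cone T a b c d) (hc : IsClip T a b c d lo hi)
    (hle : lo ≤ hi) {j : ℤ} (hj : j = ⌈lo⌉) (hor : (j : ℝ) ≤ hi ∨ ¬ T.Mem c d) :
    Cone T (a + (j - 1) * c) (b + (j - 1) * d) (a + j * c) (b + j * d) ∧
      (T.Mem (a + j * c : ℤ) (b + j * d : ℤ) ↔ (j : ℝ) ≤ hi) := by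
  have hj1 : 1 ≤ j := hj ▸ h.ceil_pos hc hle
  have hj1' : (1 : ℝ) ≤ j := by exact_mod_cast hj1
  have hlo : lo ≤ j := hj ▸ Int.le_ceil _
  have hlo' : (j : ℝ) < lo + 1 := hj ▸ Int.ceil_lt_add_one _
  have hmem : T.Mem (a + j * c : ℤ) (b + j * d : ℤ) ↔ (j : ℝ) ≤ hi := by
    have := hc.2 j (by linarith)
    push_cast
    rw [this]
    exact ⟨fun h => h.2, fun h => ⟨hlo, h⟩⟩
  have hc1 := h.hc
  have ha1 := h.ha
  have hjc : 0 ≤ (j - 1) * c := mul_nonneg (by omega) (by omega)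
  refine ⟨⟨by omega, by nlinarith, by linear_combination h.det, ?_, ?_, ?_⟩, hmem⟩
  · intro hm
    have := (hc.2 (j - 1) (by linarith)).1 (by push_cast at hm; exact hm)
    linarith
  · intro x y hx hm
    have hl := h.left x y hx hm
    have e : (a + (j - 1) * c) * y - (b + (j - 1) * d) * x =
      (a * y - b * x) - (j - 1) * (x * d - y * c) := by ring
    rw [e]
    rcases le_or_gt (x * d - y * c) 0 with h0 | h0
    · nlinarith
    · obtain ⟨h1, -⟩ := h.clip_left hT hc hx hm h0
      have hi0 : (0 : ℝ) < (x * d - y * c : ℤ) := by exact_mod_cast h0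
      have h2 : ((j - 1 : ℤ) : ℝ) * (x * d - y * c : ℤ) < (a * y - b * x : ℤ) := by
        push_cast at *; nlinarith
      have h3 : (j - 1) * (x * d - y * c) < a * y - b * x := by exact_mod_cast h2
      omega
  · intro hn x y hx hm
    have h5 : hi < j := not_le.1 fun h => hn (hmem.2 h)
    have hr := h.right (hor.resolve_left (not_le.2 h5)) x y hx hm
    obtain ⟨-, h1⟩ := h.clip_left hT hc hx hm hr
    have hi0 : (0 : ℝ) < (x * d - y * c : ℤ) := by exact_mod_cast hr
    have h2 : ((a * y - b * x : ℤ) : ℝ) < (j : ℤ) * (x * d - y * c : ℤ) := by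
      push_cast at *; nlinarith
    have h3 : a * y - b * x < j * (x * d - y * c) := by exact_mod_cast h2
    have e : x * (b + j * d) - y * (a + j * c) = j * (x * d - y * c) - (a * y - b * x) := by ring
    omega

/-- The parameter `0` shows that `w` is outside, so every candidate lies strictly inside the cone
and would shrink onto the empty part of the ray. -/
theorem Cone.right_of_empty (hT : T.Pointed) (h : Cone T a b c d) (hc : IsClip T c d a b lo hi)
    (he : hi < lo) : ¬ T.Mem c d ∧ ∀ x y : ℤ, 1 ≤ x → ¬ T.Mem x y := by
  have hw : ¬ T.Mem c d := by
    intro hw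
    have := (hc.2 0 le_rfl).1 (by simpa using hw)
    linarith
  refine ⟨hw, fun x y hx hm => ?_⟩
  have := h.clip_right hT hc hx hm (h.right hw x y hx hm)
  have hi0 : (1 : ℝ) ≤ (a * y - b * x : ℤ) := by exact_mod_cast h.left x y hx hm
  nlinarith

/-- The new basis is `w + (k + 1) u`, `w + k u`. By `Cone.clip_right` a point below `w` has `i / m ≤
hi < k + 1`. If the new second vector is outside, then `k < lo`; so `lo > 0`, which puts `w` outside
as well, and every point has `i / m ≥ lo > k`. -/
theorem Cone.step_right (hT : T.Pointed) (h : Cone T a b c d) (hc : IsClip T c d a b lo hi)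
    (hle : lo ≤ hi) {k : ℤ} (hk : k = ⌊hi⌋) :
    0 ≤ k ∧ Cone T (c + (k + 1) * a) (d + (k + 1) * b) (c + k * a) (d + k * b) ∧
      (T.Mem (c + k * a : ℤ) (d + k * b : ℤ) ↔ lo ≤ k) := by
  have hk0 : 0 ≤ k := hk ▸ Int.floor_nonneg.2 (hc.1.trans hle)
  have hk0' : (0 : ℝ) ≤ k := by exact_mod_cast hk0
  have hhi : (k : ℝ) ≤ hi := hk ▸ Int.floor_le _
  have hhi' : hi < k + 1 := hk ▸ Int.lt_floor_add_one _
  have hmem : T.Mem (c + k * a : ℤ) (d + k * b : ℤ) ↔ lo ≤ k := by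
    have := hc.2 k (by linarith)
    push_cast
    rw [this]
    exact ⟨fun h => h.1, fun h => ⟨h, hhi⟩⟩
  have hc1 := h.hc
  have ha1 := h.ha
  have hka : 0 ≤ k * a := mul_nonneg hk0 (by omega)
  refine ⟨hk0, ⟨by nlinarith, by omega, by linear_combination h.det, ?_, ?_, ?_⟩, hmem⟩
  · intro hm
    have := (hc.2 (k + 1) (by linarith)).1 (by push_cast at hm; exact hm)
    linarith
  · intro x y hx hm
    have hl := h.left x y hx hm
    have e : (c + (k + 1) * a) * y - (d + (k + 1) * b) * x =
      (k + 1) * (a * y - b * x) - (x * d - y * c) := by ring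
    rw [e]
    rcases le_or_gt (x * d - y * c) 0 with h0 | h0
    · nlinarith
    · obtain ⟨-, h1⟩ := h.clip_right hT hc hx hm h0
      have hi0 : (0 : ℝ) < (a * y - b * x : ℤ) := by exact_mod_cast hl
      have h2 : ((x * d - y * c : ℤ) : ℝ) < (k + 1 : ℤ) * (a * y - b * x : ℤ) := by
        push_cast at *; nlinarith
      have h3 : x * d - y * c < (k + 1) * (a * y - b * x) := by exact_mod_cast h2
      omega
  · intro hn x y hx hm
    have h5 : (k : ℝ) < lo := not_le.1 fun h => hn (hmem.2 h)
    have hw : ¬ T.Mem c d := by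
      intro hw
      have := (hc.2 0 le_rfl).1 (by simpa using hw)
      linarith
    have hr := h.right hw x y hx hm
    obtain ⟨h1, -⟩ := h.clip_right hT hc hx hm hr
    have hi0 : (0 : ℝ) < (a * y - b * x : ℤ) := by exact_mod_cast h.left x y hx hm
    have h2 : (k : ℤ) * ((a * y - b * x : ℤ) : ℝ) < (x * d - y * c : ℤ) := by
      push_cast at *; nlinarith
    have h3 : k * (a * y - b * x) < x * d - y * c := by exact_mod_cast h2
    have e : x * (d + k * b) - y * (c + k * a) = (x * d - y * c) - k * (a * y - b * x) := by ring
    omega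

/-- Lattice points in the direction of `w` have first coordinate zero, so they are integer multiples
of `w`; the largest multiple in the region is `⌊hi⌋`. -/
theorem Cone.lowest (h : Cone T a b c d) (hw : T.Mem c d) (hlow : Low T c d)
    (hc : IsClip T 0 0 c d lo hi) : Lowest T (⌊hi⌋ * c) (⌊hi⌋ * d) := by
  have h1 := (hc.2 1 zero_le_one).1 (by simpa using hw)
  have hk : 1 ≤ ⌊hi⌋ := Int.le_floor.2 (by exact_mod_cast h1.2)
  have hk' : (1 : ℝ) ≤ ⌊hi⌋ := by exact_mod_cast hk
  have hc1 := h.hc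
  refine ⟨by nlinarith, ?_, ?_⟩
  · have := (hc.2 ⌊hi⌋ (by linarith)).2 ⟨by linarith [h1.1], Int.floor_le _⟩
    push_cast
    simpa using this
  · intro x y hx hm
    have hl := hlow x y hx hm
    have e : ⌊hi⌋ * c * y - ⌊hi⌋ * d * x = - (⌊hi⌋ * (x * d - y * c)) := by ring
    rw [e]
    refine ⟨by nlinarith, fun h0 => ?_⟩
    have h2 : x * d - y * c = 0 := by
      have : ⌊hi⌋ * (x * d - y * c) = 0 := by linarith
      rcases mul_eq_zero.1 this with h3 | h3
      · omega
      · exact h3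
    obtain ⟨e1, e2⟩ := h.coords_real x y
    have hm1 := h.left x y hx hm
    obtain ⟨e3, -⟩ := h.coords x y
    rw [h2] at e1 e2 e3
    generalize a * y - b * x = m at *
    rw [e1, e2] at hm
    have h3 := ((hc.2 m (by exact_mod_cast (by omega : (0 : ℤ) ≤ m))).1 (by
      simpa using hm)).2
    have h4 : m ≤ ⌊hi⌋ := Int.le_floor.2 h3
    rw [e3]
    nlinarith

end Steps

end Wedge

end DiscreteHull

namespace DiscreteHull

/-! ### A program for the lowest lattice direction

Registers `30, …, 34` hold the region, registers `40, 41, 42` receive the result, and the registers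
from `43` on are scratch: `43, …, 46` hold the lattice basis, `47` tells whether its second vector
lies in the region, `48` tells whether the search goes on, `49` and `50` hold the ends of the clipped
parameter interval. -/

open DiscreteHull.Expr (var)

/-- Intersect the interval given by registers `49, 50` with the solutions `t` of
`0 ≤ reg 55 + t * reg 56`. -/
def cutProg : Program :=
  .branch (0 ≼ var 56)
    (.branch (var 56 ≼ 0)
      (.branch (0 ≼ var 55) .skip (50 ≔ 0 - 1))
      (.branch (var 49 ≼ (0 - var 55) / var 56) (49 ≔ (0 - var 55) / var 56) .skip))
    (.branch ((0 - var 55) / var 56 ≼ var 50) (50 ≔ (0 - var 55) / var 56) .skip)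

/-- Clip the ray with origin in registers `i, j` and direction in registers `k, l`. -/
def clipProg (i j k l : ℕ) : Program :=
  50 ≔ (var 34 - var i) / var k ;;
  49 ≔ 0 ;;
  55 ≔ var 32 + var j - var 30 * var i ;;
  56 ≔ var l - var 30 * var k ;;
  cutProg ;;
  55 ≔ var 33 - var j + var 31 * var i ;;
  56 ≔ var 31 * var k - var l ;;
  cutProg

/-- One round of the search. -/
def roundProg : Program :=
  clipProg 43 44 45 46 ;;
  .branch (var 49 ≼ var 50).not (48 ≔ 0) (
    57 ≔ (var 49).ceil ;;
    .branch ((var 57 ≼ var 50).not.and (1 ≼ var 47)) (48 ≔ 0) (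
      43 ≔ var 43 + (var 57 - 1) * var 45 ;;
      44 ≔ var 44 + (var 57 - 1) * var 46 ;;
      45 ≔ var 43 + var 45 ;;
      46 ≔ var 44 + var 46 ;;
      .branch (var 57 ≼ var 50) (47 ≔ 1) (47 ≔ 0) ;;
      clipProg 45 46 43 44 ;;
      .branch (var 49 ≼ var 50).not (48 ≔ 0) (
        57 ≔ (var 50).floor ;;
        45 ≔ var 45 + var 57 * var 43 ;;
        46 ≔ var 46 + var 57 * var 44 ;;
        43 ≔ var 45 + var 43 ;;
        44 ≔ var 46 + var 44 ;;
        .branch (var 49 ≼ var 57) (47 ≔ 1) (47 ≔ 0))))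

/-- The initial basis. -/
def initProg : Program :=
  43 ≔ 1 ;;
  45 ≔ 1 ;;
  46 ≔ (var 30 - var 32).ceil ;;
  44 ≔ var 46 - 1 ;;
  .branch (var 46 - var 31 ≼ var 33) (47 ≔ 1) (47 ≔ 0) ;;
  48 ≔ 1

/-- The result: the farthest lattice point in the direction found. -/
def finishProg : Program :=
  40 ≔ var 47 ;;
  43 ≔ 0 ;;
  44 ≔ 0 ;;
  clipProg 43 44 45 46 ;;
  57 ≔ (var 50).floor ;;
  41 ≔ var 57 * var 45 ;;
  42 ≔ var 57 * var 46

/-- The search for the lowest lattice direction. -/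
def nextProg : Program :=
  .branch (1 ≼ var 34)
    (initProg ;; .loop (1 ≼ var 48) roundProg ;; finishProg)
    (40 ≔ 0)

/-- The region given by registers `30, …, 34`. -/
noncomputable def wedgeOf (s : Memory) : Wedge :=
  ⟨s.reg 30, s.reg 31, s.reg 32, s.reg 33, s.reg 34⟩

/-- The two memories differ at most in registers from `m` on. -/
def Agree (m : ℕ) (s s' : Memory) : Prop :=
  s'.arr = s.arr ∧ ∀ r < m, s'.reg r = s.reg r

theorem Agree.refl (m : ℕ) (s : Memory) : Agree m s s := ⟨rfl, fun _ _ => rfl⟩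

theorem Agree.trans {m : ℕ} {s s' s'' : Memory} (h : Agree m s s') (h' : Agree m s' s'') :
    Agree m s s'' :=
  ⟨h'.1.trans h.1, fun r hr => (h'.2 r hr).trans (h.2 r hr)⟩

theorem Agree.mono {m m' : ℕ} {s s' : Memory} (h : Agree m s s') (hm : m' ≤ m) :
    Agree m' s s' :=
  ⟨h.1, fun r hr => h.2 r (hr.trans_le hm)⟩

theorem Agree.set {m : ℕ} {s s' : Memory} (h : Agree m s s') {x : ℕ} (hx : m ≤ x) (r : ℝ) :
    Agree m s (s'.set x r) := by
  refine ⟨h.1, fun y hy => ?_⟩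
  rw [Memory.set_reg, if_neg (by omega)]
  exact h.2 y hy

theorem Agree.wedgeOf {m : ℕ} {s s' : Memory} (h : Agree m s s') (hm : 35 ≤ m) :
    wedgeOf s' = wedgeOf s := by
  simp only [DiscreteHull.wedgeOf]
  rw [h.2 30 (by omega), h.2 31 (by omega), h.2 32 (by omega), h.2 33 (by omega),
    h.2 34 (by omega)]

/-- The sign of register `56` decides whether the constraint raises the lower end, lowers the upper
end or does not depend on `t`. In the last case an unsatisfiable constraint is recorded by the upper
end `-1`, which excludes every `t ≥ 0`. -/
theorem cutProg_spec (s : Memory) (h0 : 0 ≤ s.reg 49) :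
    Agree 49 s (exec cutProg s) ∧ 0 ≤ (exec cutProg s).reg 49 ∧
    ∀ t : ℝ, 0 ≤ t → ((exec cutProg s).reg 49 ≤ t ∧ t ≤ (exec cutProg s).reg 50 ↔
      (s.reg 49 ≤ t ∧ t ≤ s.reg 50) ∧ 0 ≤ s.reg 55 + t * s.reg 56) := by
  unfold cutProg
  by_cases h1 : 0 ≤ s.reg 56
  · rw [exec_branch_pos s (by simpa using h1)]
    by_cases h2 : s.reg 56 ≤ 0
    · rw [exec_branch_pos s (by simpa using h2)]
      have h3 : s.reg 56 = 0 := le_antisymm h2 h1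
      by_cases h4 : 0 ≤ s.reg 55
      · rw [exec_branch_pos s (by simpa using h4)]
        exact ⟨.refl _ _, h0, fun t ht => by simp [exec, h3, h4]⟩
      · rw [exec_branch_neg s (by simpa using h4)]
        refine ⟨(Agree.refl _ _).set (by norm_num) _, by simpa [exec] using h0, fun t ht => ?_⟩
        simp only [exec, Memory.set_reg, h3]
        norm_num
        exact ⟨fun h => by linarith, fun _ => by linarith⟩
    · rw [exec_branch_neg s (by simpa using h2)]
      have h3 : 0 < s.reg 56 := not_le.1 h2
      have key : ∀ t : ℝ, 0 ≤ s.reg 55 + t * s.reg 56 ↔ (0 - s.reg 55) / s.reg 56 ≤ t :=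
        fun t => by rw [div_le_iff₀ h3]; constructor <;> intro h <;> linarith
      by_cases h4 : s.reg 49 ≤ (0 - s.reg 55) / s.reg 56
      · rw [exec_branch_pos s (by simpa using h4)]
        refine ⟨(Agree.refl _ _).set (by norm_num) _, ?_, fun t ht => ?_⟩
        · simpa [exec] using h0.trans h4
        · rw [key]
          simp only [exec, Memory.set_reg, eval_div, eval_sub, eval_var, eval_ofNat, if_true,
            Nat.cast_zero, Nat.reduceEqDiff, if_false]
          exact ⟨fun h => ⟨⟨h4.trans h.1, h.2⟩, h.1⟩, fun h => ⟨h.2, h.1.2⟩⟩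
      · rw [exec_branch_neg s (by simpa using h4)]
        refine ⟨.refl _ _, h0, fun t ht => ?_⟩
        rw [key]
        exact ⟨fun h => ⟨h, by simp only [exec] at h; linarith [h.1]⟩, fun h => h.1⟩
  · rw [exec_branch_neg s (by simpa using h1)]
    have h3 : s.reg 56 < 0 := not_le.1 h1
    have key : ∀ t : ℝ, 0 ≤ s.reg 55 + t * s.reg 56 ↔ t ≤ (0 - s.reg 55) / s.reg 56 :=
      fun t => by rw [le_div_iff_of_neg h3]; constructor <;> intro h <;> linarith
    by_cases h4 : (0 - s.reg 55) / s.reg 56 ≤ s.reg 50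
    · rw [exec_branch_pos s (by simpa using h4)]
      refine ⟨(Agree.refl _ _).set (by norm_num) _, by simpa [exec] using h0, fun t ht => ?_⟩
      rw [key]
      simp only [exec, Memory.set_reg, eval_div, eval_sub, eval_var, eval_ofNat, if_true,
        Nat.cast_zero, Nat.reduceEqDiff, if_false]
      exact ⟨fun h => ⟨⟨h.1, h.2.trans h4⟩, h.2⟩, fun h => ⟨h.1.1, h.2⟩⟩
    · rw [exec_branch_neg s (by simpa using h4)]
      refine ⟨.refl _ _, h0, fun t ht => ?_⟩
      rw [key]
      exact ⟨fun h => ⟨h, by simp only [exec] at h; linarith [h.2]⟩, fun h => h.1⟩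

/-- The constraint `x ≤ M` is the initial upper end, which is correct because the direction has
positive abscissa; the two slanted lines are handled by two cuts. -/
theorem clipProg_spec {i j k l : ℕ} (hi : i < 49) (hj : j < 49) (hk : k < 49) (hl : l < 49)
    (s : Memory) (hpos : 0 < s.reg k) :
    Agree 49 s (exec (clipProg i j k l) s) ∧
    (wedgeOf s).IsClip (s.reg i) (s.reg j) (s.reg k) (s.reg l)
      ((exec (clipProg i j k l) s).reg 49) ((exec (clipProg i j k l) s).reg 50) := by
  obtain ⟨i1, i2, j1, j2⟩ : i ≠ 49 ∧ i ≠ 50 ∧ j ≠ 49 ∧ j ≠ 50 := by omega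
  obtain ⟨k1, k2, k3, l1, l2, l3⟩ :
      k ≠ 49 ∧ k ≠ 50 ∧ k ≠ 55 ∧ l ≠ 49 ∧ l ≠ 50 ∧ l ≠ 55 := by omega
  unfold clipProg
  simp only [exec_seq, exec_assign]
  set s₁ := (((s.set 50 _).set 49 _).set 55 _).set 56 _ with hs₁
  have a₁ : Agree 49 s s₁ :=
    ((((Agree.refl _ _).set (by norm_num) _).set (by norm_num) _).set (by norm_num) _).set
      (by norm_num) _
  have e49 : s₁.reg 49 = 0 := by simp [hs₁]
  have e50 : s₁.reg 50 = (s.reg 34 - s.reg i) / s.reg k := by simp [hs₁]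
  have e55 : s₁.reg 55 = s.reg 32 + s.reg j - s.reg 30 * s.reg i := by
    simp [hs₁, i1, i2, j1, j2]
  have e56 : s₁.reg 56 = s.reg l - s.reg 30 * s.reg k := by
    simp [hs₁, k1, k2, k3, l1, l2, l3]
  obtain ⟨a₂, p₂, c₂⟩ := cutProg_spec s₁ e49.ge
  set s₂ := exec cutProg s₁
  set s₃ := (s₂.set 55 _).set 56 _ with hs₃
  have b₂ := a₁.trans a₂
  have a₃ : Agree 49 s s₃ := (b₂.set (by norm_num) _).set (by norm_num) _
  have f49 : s₃.reg 49 = s₂.reg 49 := by simp [hs₃]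
  have f50 : s₃.reg 50 = s₂.reg 50 := by simp [hs₃]
  have f55 : s₃.reg 55 = s.reg 33 - s.reg j + s.reg 31 * s.reg i := by
    simp [hs₃, b₂.2 33, b₂.2 31, b₂.2 i hi, b₂.2 j hj]
  have f56 : s₃.reg 56 = s.reg 31 * s.reg k - s.reg l := by
    simp [hs₃, b₂.2 31, b₂.2 k hk, b₂.2 l hl, k3, l3]
  obtain ⟨a₄, p₄, c₄⟩ := cutProg_spec s₃ (f49 ▸ p₂)
  refine ⟨a₃.trans a₄, p₄, fun t ht => ?_⟩
  rw [c₄ t ht, f49, f50, c₂ t ht, e49, e50, f55, f56, e55, e56, le_div_iff₀ hpos]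
  simp only [Wedge.Mem, wedgeOf]
  constructor
  · rintro ⟨h1, h2, h3⟩
    exact ⟨⟨⟨ht, by linarith⟩, by linarith⟩, by linarith⟩
  · rintro ⟨⟨⟨-, h1⟩, h2⟩, h3⟩
    exact ⟨by linarith, by linarith, by linarith⟩

/-- The registers hold the given basis. -/
structure HoldsBasis (T : Wedge) (s : Memory) (a b c d : ℤ) : Prop where
  ra : s.reg 43 = a
  rb : s.reg 44 = b
  rc : s.reg 45 = c
  rd : s.reg 46 = d
  flag : s.reg 47 = 1 ∧ T.Mem c d ∨ s.reg 47 = 0 ∧ ¬ T.Mem c d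

/-- The basis decides the search. -/
def Decided (T : Wedge) (c d : ℤ) : Prop :=
  (T.Mem c d → T.Low c d) ∧ (¬ T.Mem c d → ∀ x y : ℤ, 1 ≤ x → ¬ T.Mem x y)

theorem Wedge.Cone.decided {T : Wedge} {a b c d : ℤ} (h : T.Cone a b c d) (hl : T.Low c d) :
    Decided T c d :=
  ⟨fun _ => hl, fun hn x y hx hm => by
    have := h.right hn x y hx hm
    have := hl x y hx hm
    omega⟩

/-- The number `r` is the truth value of `p`. -/
theorem flag_branch {b : Test} {s : Memory} {p : Prop} (h : b.Holds s ↔ p) :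
    ∃ r : ℝ, exec (.branch b (47 ≔ 1) (47 ≔ 0)) s = s.set 47 r ∧ (r = 1 ∧ p ∨ r = 0 ∧ ¬ p) := by
  by_cases hb : b.Holds s
  · exact ⟨1, by rw [exec_branch_pos s hb]; simp [exec], .inl ⟨rfl, h.1 hb⟩⟩
  · exact ⟨0, by rw [exec_branch_neg s hb]; simp [exec], .inr ⟨rfl, fun hp => hb (h.2 hp)⟩⟩

/-- The left step yields a basis `u₁`, `u₁ + w` with the abscissa of `u₁` at least that of `u`. The
right step then makes `(u₁ + w) + (k + 1) u₁` the first vector, whose abscissa is at least twice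
that of `u₁`. Every early exit leaves a basis that decides the search. -/
theorem roundProg_spec {T : Wedge} {s : Memory} {a b c d : ℤ} (hs : wedgeOf s = T)
    (hT : T.Pointed) (hcone : T.Cone a b c d) (hb : HoldsBasis T s a b c d) :
    Agree 40 s (exec roundProg s) ∧ ∃ a' b' c' d' : ℤ, T.Cone a' b' c' d' ∧
      HoldsBasis T (exec roundProg s) a' b' c' d' ∧
      (((exec roundProg s).reg 48 = s.reg 48 ∧ 2 * a ≤ a' ∧ (a : ℝ) ≤ T.M) ∨
        ((exec roundProg s).reg 48 = 0 ∧ Decided T c' d')) := by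
  have hc0 : (0 : ℝ) < c := by exact_mod_cast hcone.hc
  have ha1 := hcone.ha
  have hc1 := hcone.hc
  obtain ⟨ag, clip⟩ := clipProg_spec (i := 43) (j := 44) (k := 45) (l := 46) (by norm_num)
    (by norm_num) (by norm_num) (by norm_num) s (by rw [hb.rc]; exact hc0)
  unfold roundProg
  rw [exec_seq]
  set s₁ := exec (clipProg 43 44 45 46) s with hs₁
  rw [hs, hb.ra, hb.rb, hb.rc, hb.rd] at clip
  have hb₁ : HoldsBasis T s₁ a b c d :=
    ⟨by rw [ag.2 43 (by norm_num), hb.ra], by rw [ag.2 44 (by norm_num), hb.rb],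
      by rw [ag.2 45 (by norm_num), hb.rc], by rw [ag.2 46 (by norm_num), hb.rd],
      by rw [ag.2 47 (by norm_num)]; exact hb.flag⟩
  have g48 : s₁.reg 48 = s.reg 48 := ag.2 48 (by norm_num)
  have halt : ∀ (s' : Memory) {a b c d : ℤ}, HoldsBasis T s' a b c d →
      HoldsBasis T (s'.set 48 0) a b c d := fun s' _ _ _ _ h =>
    ⟨by simp [h.ra], by simp [h.rb], by simp [h.rc], by simp [h.rd], by simpa using h.flag⟩
  by_cases h1 : s₁.reg 49 ≤ s₁.reg 50
  swap
  · rw [exec_branch_pos s₁ (by simpa using h1), exec_assign]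
    simp only [eval_ofNat, Nat.cast_zero]
    refine ⟨(ag.mono (by norm_num)).set (by norm_num) _, a, b, c, d, hcone, halt s₁ hb₁,
      .inr ⟨by simp, ?_⟩⟩
    exact hcone.decided (hcone.low_of_empty hT clip (not_le.1 h1))
  rw [exec_branch_neg s₁ (by simpa using h1), exec_seq, exec_assign, eval_ceil, eval_var]
  set s₂ := s₁.set 57 _ with hs₂
  have ag₂ : Agree 49 s s₂ := ag.set (by norm_num) _
  -- The point `u + lo w` lies in the region, and its abscissa is at least `a`.
  have haM : (a : ℝ) ≤ T.M := by
    have h2 := ((clip.2 (s₁.reg 49) clip.1).2 ⟨le_rfl, h1⟩).1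
    have := mul_nonneg clip.1 hc0.le
    linarith
  generalize hj : ⌈s₁.reg 49⌉ = j at *
  have e57 : s₂.reg 57 = j := by simp [hs₂]
  have e50 : s₂.reg 50 = s₁.reg 50 := by simp [hs₂]
  have e47 : s₂.reg 47 = s₁.reg 47 := by simp [hs₂]
  have hb₂ : HoldsBasis T s₂ a b c d :=
    ⟨by simp [hs₂, hb₁.ra], by simp [hs₂, hb₁.rb], by simp [hs₂, hb₁.rc], by simp [hs₂, hb₁.rd],
      by simpa [hs₂] using hb₁.flag⟩
  by_cases h2 : s₁.reg 50 < j ∧ T.Mem c d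
  · have hF : s₂.reg 47 = 1 := by
      rcases hb₂.flag with h | h
      · exact h.1
      · exact absurd h2.2 h.2
    rw [exec_branch_pos s₂ (by simpa [e57, e50, hF] using h2.1), exec_assign]
    simp only [eval_ofNat, Nat.cast_zero]
    refine ⟨(ag₂.mono (by norm_num)).set (by norm_num) _, a, b, c, d, hcone, halt s₂ hb₂,
      .inr ⟨by simp, ?_⟩⟩
    exact hcone.decided (hcone.low_of_gap hT clip h2.2 (by rw [hj]; exact h2.1))
  have hor : (j : ℝ) ≤ s₁.reg 50 ∨ ¬ T.Mem c d := by
    by_contra h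
    push Not at h
    exact h2 h
  rw [exec_branch_neg s₂ (by
    rcases hb₂.flag with h | h
    · have : (j : ℝ) ≤ s₁.reg 50 := hor.resolve_right (not_not.2 h.2)
      simp [e57, e50, this]
    · simp [h.1])]
  obtain ⟨cone₁, mem₁⟩ := hcone.step_left hT clip h1 hj.symm hor
  have hj1 : 1 ≤ j := hj ▸ hcone.ceil_pos clip h1
  simp only [exec_seq, exec_assign]
  set s₃ := (((s₂.set 43 _).set 44 _).set 45 _).set 46 _ with hs₃
  have ag₃ : Agree 40 s s₃ := ((((ag₂.mono (by norm_num)).set (by norm_num) _).set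
    (by norm_num) _).set (by norm_num) _).set (by norm_num) _
  have e57' : s₃.reg 57 = j := by simp [hs₃, e57]
  have e50' : s₃.reg 50 = s₁.reg 50 := by simp [hs₃, e50]
  have e48' : s₃.reg 48 = s.reg 48 := by simp [hs₃, hs₂, g48]
  have e43 : s₃.reg 43 = (a + (j - 1) * c : ℤ) := by simp [hs₃, hb₂.ra, hb₂.rc, e57]
  have e44 : s₃.reg 44 = (b + (j - 1) * d : ℤ) := by simp [hs₃, hb₂.rb, hb₂.rd, e57]
  have e45 : s₃.reg 45 = (a + j * c : ℤ) := by
    simp [hs₃, hb₂.ra, hb₂.rb, hb₂.rc, hb₂.rd, e57]; ring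
  have e46 : s₃.reg 46 = (b + j * d : ℤ) := by
    simp [hs₃, hb₂.ra, hb₂.rb, hb₂.rc, hb₂.rd, e57]; ring
  obtain ⟨r, hr, hflag⟩ := flag_branch (b := var 57 ≼ var 50) (s := s₃) (p := T.Mem
    (a + j * c : ℤ) (b + j * d : ℤ)) (by rw [mem₁]; simp [e57', e50'])
  rw [hr]
  have hdouble : 2 * a ≤ 2 * (a + (j - 1) * c) := by nlinarith
  have ha' := cone₁.ha
  have hc' := cone₁.hc
  generalize a + (j - 1) * c = a₁ at *
  generalize b + (j - 1) * d = b₁ at *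
  -- Since `a₁` has been generalized, its relation to `a + j * c` is recovered from the contents of
  -- the registers: they differ by `c`.
  have hac : a₁ ≤ a + j * c := by
    by_contra hcon
    push Not at hcon
    have e1 : s₃.reg 45 = s₃.reg 43 + c := by simp [hs₃, hb₂.ra, hb₂.rb, hb₂.rc, hb₂.rd, e57]
    rw [e45, e43] at e1
    have : a + j * c = a₁ + c := by exact_mod_cast e1
    omega
  generalize a + j * c = c₁ at *
  generalize b + j * d = d₁ at *
  set s₄ := s₃.set 47 r with hs₄
  have ag₄ : Agree 40 s s₄ := ag₃.set (by norm_num) _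
  have hb₄ : HoldsBasis T s₄ a₁ b₁ c₁ d₁ :=
    ⟨by simp [hs₄, e43], by simp [hs₄, e44], by simp [hs₄, e45], by simp [hs₄, e46],
      by simpa [hs₄] using hflag⟩
  have ha0 : (0 : ℝ) < a₁ := by exact_mod_cast ha'
  obtain ⟨ag₅, clip₅⟩ := clipProg_spec (i := 45) (j := 46) (k := 43) (l := 44) (by norm_num)
    (by norm_num) (by norm_num) (by norm_num) s₄ (by rw [hb₄.ra]; exact ha0)
  rw [ag₄.wedgeOf (by norm_num), hs, hb₄.ra, hb₄.rb, hb₄.rc, hb₄.rd] at clip₅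
  set s₅ := exec (clipProg 45 46 43 44) s₄ with hs₅
  have hb₅ : HoldsBasis T s₅ a₁ b₁ c₁ d₁ :=
    ⟨by rw [ag₅.2 43 (by norm_num), hb₄.ra], by rw [ag₅.2 44 (by norm_num), hb₄.rb],
      by rw [ag₅.2 45 (by norm_num), hb₄.rc], by rw [ag₅.2 46 (by norm_num), hb₄.rd],
      by rw [ag₅.2 47 (by norm_num)]; exact hb₄.flag⟩
  have g48' : s₅.reg 48 = s.reg 48 := by
    rw [ag₅.2 48 (by norm_num)]; simp [hs₄, e48']
  have ag₆ : Agree 40 s s₅ := ag₄.trans (ag₅.mono (by norm_num))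
  by_cases h3 : s₅.reg 49 ≤ s₅.reg 50
  swap
  · rw [exec_branch_pos s₅ (by simpa using h3), exec_assign]
    simp only [eval_ofNat, Nat.cast_zero]
    obtain ⟨hn, hnone⟩ := cone₁.right_of_empty hT clip₅ (not_le.1 h3)
    exact ⟨ag₆.set (by norm_num) _, a₁, b₁, c₁, d₁, cone₁, halt s₅ hb₅,
      .inr ⟨by simp, fun h => absurd h hn, fun _ => hnone⟩⟩
  rw [exec_branch_neg s₅ (by simpa using h3)]
  obtain ⟨hk0, cone₂, mem₂⟩ := cone₁.step_right hT clip₅ h3 rfl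
  simp only [exec_seq, exec_assign]
  set s₆ := ((((s₅.set 57 _).set 45 _).set 46 _).set 43 _).set 44 _ with hs₆
  have ag₇ : Agree 40 s s₆ := ((((ag₆.set (by norm_num) _).set (by norm_num) _).set
    (by norm_num) _).set (by norm_num) _).set (by norm_num) _
  obtain ⟨r', hr', hflag'⟩ := flag_branch (b := var 49 ≼ var 57) (s := s₆) (p := T.Mem
    (c₁ + ⌊s₅.reg 50⌋ * a₁ : ℤ) (d₁ + ⌊s₅.reg 50⌋ * b₁ : ℤ)) (by rw [mem₂]; simp [hs₆])
  rw [hr']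
  refine ⟨ag₇.set (by norm_num) _, _, _, _, _, cone₂, ⟨?_, ?_, ?_, ?_, ?_⟩, .inl ⟨?_, ?_, haM⟩⟩
  · simp [hs₆, hb₅.ra, hb₅.rb, hb₅.rc, hb₅.rd]; ring
  · simp [hs₆, hb₅.ra, hb₅.rb, hb₅.rc, hb₅.rd]; ring
  · simp [hs₆, hb₅.ra, hb₅.rb, hb₅.rc, hb₅.rd]
  · simp [hs₆, hb₅.ra, hb₅.rb, hb₅.rc, hb₅.rd]
  · simpa using hflag'
  · simp [hs₆, g48']
  · nlinarith

/-- The outcome of the search. -/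
def Found (T : Wedge) (s : Memory) : Prop :=
  (s.reg 40 = 1 ∧ ∃ x y : ℤ, s.reg 41 = x ∧ s.reg 42 = y ∧ T.Lowest x y) ∨
    (s.reg 40 = 0 ∧ ∀ x y : ℤ, 1 ≤ x → ¬ T.Mem x y)

theorem initProg_spec {T : Wedge} {s : Memory} (hs : wedgeOf s = T) (hT : T.Pointed)
    (hM : 1 ≤ T.M) : Agree 40 s (exec initProg s) ∧ (exec initProg s).reg 48 = 1 ∧
      ∃ a b c d : ℤ, T.Cone a b c d ∧ HoldsBasis T (exec initProg s) a b c d := by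
  subst hs
  obtain ⟨cone, mem⟩ := Wedge.cone_init hT hM rfl
  unfold initProg
  simp only [exec_seq, exec_assign]
  set s₁ := (((s.set 43 _).set 45 _).set 46 _).set 44 _ with hs₁
  have ag : Agree 40 s s₁ := ((((Agree.refl _ _).set (by norm_num) _).set (by norm_num) _).set
    (by norm_num) _).set (by norm_num) _
  obtain ⟨r, hr, hflag⟩ := flag_branch (b := var 46 - var 31 ≼ var 33) (s := s₁)
    (p := (wedgeOf s).Mem (1 : ℤ) (⌈(wedgeOf s).lam - (wedgeOf s).S⌉ : ℤ)) (by
      rw [Int.cast_one, mem]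
      simp [hs₁, wedgeOf])
  rw [hr]
  refine ⟨(ag.set (by norm_num) _).set (by norm_num) _, by simp, _, _, _, _, cone,
    ⟨?_, ?_, ?_, ?_, ?_⟩⟩
  · simp [hs₁]
  · simp [hs₁, wedgeOf]
  · simp [hs₁]
  · simp [hs₁, wedgeOf]
  · simpa using hflag

theorem finishProg_spec {T : Wedge} {s : Memory} {a b c d : ℤ} (hs : wedgeOf s = T)
    (hcone : T.Cone a b c d) (hb : HoldsBasis T s a b c d)
    (hd : Decided T c d) : Agree 40 s (exec finishProg s) ∧ Found T (exec finishProg s) := by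
  have hc0 : (0 : ℝ) < c := by exact_mod_cast hcone.hc
  unfold finishProg
  simp only [exec_seq, exec_assign]
  set s₁ := ((s.set 40 _).set 43 _).set 44 _ with hs₁
  have ag : Agree 40 s s₁ :=
    (((Agree.refl _ _).set (by norm_num) _).set (by norm_num) _).set (by norm_num) _
  have e43 : s₁.reg 43 = 0 := by simp [hs₁]
  have e44 : s₁.reg 44 = 0 := by simp [hs₁]
  have e45 : s₁.reg 45 = c := by simp [hs₁, hb.rc]
  have e46 : s₁.reg 46 = d := by simp [hs₁, hb.rd]
  have e40 : s₁.reg 40 = s.reg 47 := by simp [hs₁]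
  obtain ⟨ag₂, clip⟩ := clipProg_spec (i := 43) (j := 44) (k := 45) (l := 46) (by norm_num)
    (by norm_num) (by norm_num) (by norm_num) s₁ (by rw [e45]; exact hc0)
  rw [ag.wedgeOf (by norm_num), hs, e43, e44, e45, e46] at clip
  set s₂ := exec (clipProg 43 44 45 46) s₁ with hs₂
  have f40 : s₂.reg 40 = s.reg 47 := by rw [ag₂.2 40 (by norm_num), e40]
  have f45 : s₂.reg 45 = c := by rw [ag₂.2 45 (by norm_num), e45]
  have f46 : s₂.reg 46 = d := by rw [ag₂.2 46 (by norm_num), e46]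
  refine ⟨(((ag.trans (ag₂.mono (by norm_num))).set (by norm_num) _).set (by norm_num) _).set
    (by norm_num) _, ?_⟩
  rcases hb.flag with ⟨h1, h2⟩ | ⟨h1, h2⟩
  · refine .inl ⟨by simp [f40, h1], _, _, ?_, ?_, hcone.lowest h2 (hd.1 h2) clip⟩
    · simp [f45]
    · simp [f46]
  · exact .inr ⟨by simp [f40, h1], hd.2 h2⟩

/-- While the search goes on, `2 ^ k ≤ a` holds after `k` rounds by doubling, and `a ≤ M < 2 ^ m`
whenever another round completes. So `m + 1` rounds suffice. -/
theorem nextProg_spec : ∃ C : ℕ, ∀ (s : Memory) (m : ℕ), (wedgeOf s).Pointed →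
    (wedgeOf s).M < 2 ^ m →
    Ends nextProg s (C * (m + 1)) (fun s' => Agree 40 s s' ∧ Found (wedgeOf s) s') := by
  let C₁ := (Test.cost (1 ≼ var 48) + 1 + timeBound roundProg)
  refine ⟨Test.cost (1 ≼ var 34) + 1 +
    (timeBound initProg + (2 * C₁ + timeBound finishProg)) + timeBound (40 ≔ 0),
    fun s m hT hm => ?_⟩
  have arith : ∀ a b c d e : ℕ, a + 1 + (b + ((m + 2) * c + d)) ≤
      (a + 1 + (b + (2 * c + d)) + e) * (m + 1) ∧
      a + 1 + e ≤ (a + 1 + (b + (2 * c + d)) + e) * (m + 1) := by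
    intro a b c d e
    have h1 := Nat.zero_le (m * (a + 1 + (b + d) + c + e))
    constructor <;> nlinarith
  unfold nextProg
  by_cases hM : 1 ≤ s.reg 34
  · obtain ⟨ag, h48, a, b, c, d, cone, hb⟩ := initProg_spec rfl hT hM
    have hinit : Ends initProg s (timeBound initProg) (fun s₁ => s₁ = exec initProg s) :=
      .of_exec (by rfl) rfl
    refine ((Ends.branch (Q := fun s' => Agree 40 s s' ∧ Found (wedgeOf s) s')
      (B := timeBound initProg + ((m + 2) * C₁ + timeBound finishProg))
      (fun _ => ?_) (fun h => absurd hM (by simpa using h)))).mono ?_ (fun _ h => h)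
    · refine hinit.seq fun s₁ hs₁ => ?_
      subst hs₁
      let I : ℕ → Memory → Prop := fun k s' => Agree 40 s s' ∧ ∃ a b c d : ℤ,
        (wedgeOf s).Cone a b c d ∧ HoldsBasis (wedgeOf s) s' a b c d ∧
        ((s'.reg 48 = 1 ∧ (2 : ℤ) ^ k ≤ a ∧ k ≤ m) ∨ (s'.reg 48 = 0 ∧ Decided (wedgeOf s) c d))
      have hloop := Ends.loop (b := 1 ≼ var 48) (P := roundProg) (s := exec initProg s)
        (K := m + 1) (C := timeBound roundProg) I
        ⟨ag, a, b, c, d, cone, hb, .inl ⟨h48, by simpa using cone.ha, Nat.zero_le _⟩⟩ (by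
        rintro k s' ⟨ag', a, b, c, d, cone, hb, h⟩ hbr
        rcases h with ⟨h48, hk, hkm⟩ | ⟨h48, -⟩
        · refine ⟨by omega, .of_exec (by rfl) ?_⟩
          obtain ⟨ag'', a', b', c', d', cone', hb', h'⟩ :=
            roundProg_spec (ag'.wedgeOf (by norm_num)) hT cone hb
          refine ⟨ag'.trans ag'', a', b', c', d', cone', hb', ?_⟩
          rcases h' with ⟨h1, h2, h3⟩ | h'
          · refine .inl ⟨by rw [h1, h48], by rw [pow_succ]; omega, ?_⟩
            -- Only the old abscissa `a` is known to be at most `M`; this gives `k < m`, which is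
            -- the bound `k + 1 ≤ m` needed for the next state.
            have h4 : (a : ℝ) < 2 ^ m := h3.trans_lt hm
            have h5 : a < 2 ^ m := by exact_mod_cast h4
            exact (pow_lt_pow_iff_right₀ (by norm_num : (1 : ℤ) < 2)).1 (hk.trans_lt h5)
          · exact .inr h'
        · exact absurd hbr (by simp [h48]))
      refine hloop.seq fun s' hs' => .of_exec (by rfl) ?_
      obtain ⟨k, ⟨ag', a, b, c, d, cone, hb, h⟩, hbr⟩ := hs'
      rcases h with ⟨h48, -⟩ | ⟨-, hdec⟩
      · exact absurd (by simp [h48]) hbr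
      · obtain ⟨h1, h2⟩ := finishProg_spec (ag'.wedgeOf (by norm_num)) cone hb hdec
        exact ⟨ag'.trans h1, h2⟩
    · exact (arith _ _ _ _ _).1
  · refine ((Ends.branch (Q := fun s' => Agree 40 s s' ∧ Found (wedgeOf s) s')
      (B := timeBound (40 ≔ 0)) (fun h => absurd (by simpa using h) hM)
      (fun _ => .of_exec (by rfl) ⟨?_, .inr ⟨by simp [exec], fun x y hx hm => ?_⟩⟩))).mono ?_
        (fun _ h => h)
    · exact (Agree.refl _ _).set (by norm_num) _
    · have h1 : (1 : ℝ) ≤ x := by exact_mod_cast hx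
      exact hM (h1.trans hm.1)
    · exact (arith _ _ _ _ _).2

end DiscreteHull

namespace DiscreteHull

/-! ### Chains of lowest directions are short -/

namespace Wedge

/-- The region translated by `-p`. -/
def shift (T : Wedge) (p : ℤ × ℤ) : Wedge where
  lam := T.lam
  mu := T.mu
  S := T.S + p.2 - T.lam * p.1
  R := T.R - p.2 + T.mu * p.1
  M := T.M - p.1

theorem shift_mem {T : Wedge} {p : ℤ × ℤ} {x y : ℝ} :
    (T.shift p).Mem x y ↔ T.Mem (p.1 + x) (p.2 + y) := by
  simp only [Mem, shift]
  constructor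
  · rintro ⟨h1, h2, h3⟩
    exact ⟨by linarith, by linarith, by linarith⟩
  · rintro ⟨h1, h2, h3⟩
    exact ⟨by linarith, by linarith, by linarith⟩

theorem pointed_shift {T : Wedge} {p : ℤ × ℤ} (h : T.Mem p.1 p.2) : (T.shift p).Pointed := by
  obtain ⟨h1, h2, h3⟩ := h
  exact ⟨by simp only [shift]; linarith, by simp only [shift]; linarith,
    by simp only [shift]; linarith⟩

/-- Twice the signed area of the lattice triangle `p q r`. -/
def cross (p q r : ℤ × ℤ) : ℤ :=
  (q.1 - p.1) * (r.2 - p.2) - (q.2 - p.2) * (r.1 - p.1)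

/-- The lattice point `q` follows `p` on the lower hull of the lattice points of the region. -/
structure Succ (T : Wedge) (p q : ℤ × ℤ) : Prop where
  lt : p.1 < q.1
  mem : T.Mem q.1 q.2
  low : ∀ z : ℤ × ℤ, T.Mem z.1 z.2 → p.1 < z.1 →
    0 ≤ cross p q z ∧ (cross p q z = 0 → z.1 ≤ q.1)

theorem Lowest.succ {T : Wedge} {p : ℤ × ℤ} {x y : ℤ} (h : (T.shift p).Lowest x y) :
    T.Succ p (p.1 + x, p.2 + y) := by
  have h0 := h.pos
  refine ⟨by simp only; omega, ?_, fun z hz hpz => ?_⟩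
  · have := shift_mem.1 h.mem
    push_cast
    exact this
  · obtain ⟨h1, h2⟩ := h.low (z.1 - p.1) (z.2 - p.2) (by omega) (shift_mem.2 (by
      push_cast
      simpa using hz))
    have e : cross p (p.1 + x, p.2 + y) z = x * (z.2 - p.2) - y * (z.1 - p.1) := by
      simp only [cross]; ring
    rw [e]
    exact ⟨h1, fun h => by have := h2 h; simp only; omega⟩

/-- A chain of successive points of the lower hull. -/
structure IsChain (T : Wedge) (P : ℕ → ℤ × ℤ) (k : ℕ) : Prop where
  mem_zero : T.Mem (P 0).1 (P 0).2
  succ : ∀ m < k, T.Succ (P m) (P (m + 1))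

/-! ### Convexity and length of successor chains -/

section Chain
variable {T : Wedge} {P : ℕ → ℤ × ℤ} {k : ℕ}

theorem IsChain.mem (h : T.IsChain P k) {m : ℕ} (hm : m ≤ k) : T.Mem (P m).1 (P m).2 := by
  cases m with
  | zero => exact h.mem_zero
  | succ m => exact (h.succ m (by omega)).mem

theorem IsChain.le (h : T.IsChain P k) {i j : ℕ} (hij : i ≤ j) (hj : j ≤ k) :
    (P i).1 + (j - i) ≤ (P j).1 := by
  induction j, hij using Nat.le_induction with
  | base => simp
  | succ j hij ih =>
    have := ih (by omega)
    have := (h.succ j (by omega)).lt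
    push_cast
    omega

/-- Every edge of the chain supports the lattice points to the right of its origin. -/
theorem IsChain.supports (h : T.IsChain P k) {m : ℕ} (hm : m < k) {z : ℤ × ℤ}
    (hz : T.Mem z.1 z.2) (hz0 : (P 0).1 < z.1 ∨ z = P 0) : 0 ≤ cross (P m) (P (m + 1)) z := by
  induction m with
  | zero =>
    rcases hz0 with h0 | rfl
    · exact ((h.succ 0 hm).low z hz h0).1
    · simp [cross]
  | succ m ih =>
    have s₁ := h.succ m (by omega)
    have s₂ := h.succ (m + 1) hm
    rcases lt_or_ge (P (m + 1)).1 z.1 with h1 | h1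
    · exact (s₂.low z hz h1).1
    · have h2 := ih (by omega)
      have h3 := (s₁.low _ s₂.mem (s₁.lt.trans s₂.lt)).1
      have l₁ := s₁.lt
      have l₂ := s₂.lt
      simp only [cross] at *
      -- For a point not to the right of `P (m + 1)`, the side test for the new edge is a
      -- nonnegative combination of the side test for the previous edge and the left turn at `P (m +
      -- 1)`.
      have e : ((P (m + 1)).1 - (P m).1) * (((P (m + 1 + 1)).1 - (P (m + 1)).1) *
          (z.2 - (P (m + 1)).2) - ((P (m + 1 + 1)).2 - (P (m + 1)).2) * (z.1 - (P (m + 1)).1)) =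
          ((P (m + 1 + 1)).1 - (P (m + 1)).1) *
            (((P (m + 1)).1 - (P m).1) * (z.2 - (P m).2) -
              ((P (m + 1)).2 - (P m).2) * (z.1 - (P m).1)) +
          ((P (m + 1)).1 - z.1) * (((P (m + 1)).1 - (P m).1) * ((P (m + 1 + 1)).2 - (P m).2) -
              ((P (m + 1)).2 - (P m).2) * ((P (m + 1 + 1)).1 - (P m).1)) := by ring
      refine nonneg_of_mul_nonneg_right (a := (P (m + 1)).1 - (P m).1) ?_ (by omega)
      rw [e]
      exact add_nonneg (mul_nonneg (by omega) h2) (mul_nonneg (by omega) h3)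

/-- Collinearity is excluded because a successor is the farthest point in its direction. -/
theorem IsChain.cross_pos (h : T.IsChain P k) {m : ℕ} (hm : m + 1 < k) :
    0 < cross (P m) (P (m + 1)) (P (m + 1 + 1)) := by
  have s₁ := h.succ m (by omega)
  have s₂ := h.succ (m + 1) hm
  obtain ⟨h1, h2⟩ := s₁.low _ s₂.mem (s₁.lt.trans s₂.lt)
  have := s₂.lt
  rcases h1.lt_or_eq with h3 | h3
  · exact h3
  · have := h2 h3.symm
    omega

/-- A point below a chord of the region satisfies the upper constraint. -/
theorem upper_of_below_chord {p q z : ℤ × ℤ} (hp : T.Mem p.1 p.2) (hq : T.Mem q.1 q.2)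
    (hpz : p.1 ≤ z.1) (hzq : z.1 ≤ q.1) (hlt : p.1 < q.1) (hc : cross p q z ≤ 0) :
    0 ≤ T.R - z.2 + T.mu * z.1 := by
  have h1 := hp.2.2
  have h2 := hq.2.2
  have a1 : (0 : ℝ) ≤ z.1 - p.1 := by have : (p.1 : ℝ) ≤ z.1 := by exact_mod_cast hpz
                                      linarith
  have a2 : (0 : ℝ) ≤ q.1 - z.1 := by have : (z.1 : ℝ) ≤ q.1 := by exact_mod_cast hzq
                                      linarith
  have a3 : (0 : ℝ) < q.1 - p.1 := by have : (p.1 : ℝ) < q.1 := by exact_mod_cast hlt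
                                      linarith
  have hc' : ((q.1 : ℝ) - p.1) * (z.2 - p.2) - (q.2 - p.2) * (z.1 - p.1) ≤ 0 := by
    simp only [cross] at hc
    exact_mod_cast hc
  refine nonneg_of_mul_nonneg_right (a := (q.1 : ℝ) - p.1) ?_ a3
  nlinarith [mul_nonneg a1 h2, mul_nonneg a2 h1]

/-- The ratio of the distance from the left end to the distance to the right end at least doubles.
Compare the slacks of `P m` and `P (m + 1)` over the lower line. If the slack does not grow, the
reflection of `P (m + 1)` in `P m` satisfies the lower constraint; if it does not shrink, the
reflection of `P m` in `P (m + 1)` does. In either case the reflected point, if it were horizontally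
within the chain, would lie in the region below a chord and contradict the chain. So it falls
outside, which bounds the step from below. -/
theorem IsChain.double (h : T.IsChain P k) {m : ℕ} (h1m : 1 ≤ m) (hm : m + 1 < k) :
    2 * (((P m).1 - (P 0).1) * ((P k).1 - (P (m + 1)).1)) ≤
      ((P (m + 1)).1 - (P 0).1) * ((P k).1 - (P m).1) := by
  have l0 := h.le (Nat.zero_le m) (by omega)
  have l1 := h.le (Nat.le_add_right m 1) (by omega)
  have l2 := h.le (show m + 1 ≤ k by omega) le_rfl
  push_cast at l0 l1 l2
  have k0 := h.mem_zero
  have km := h.mem (show m ≤ k by omega)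
  have km' := h.mem (show m + 1 ≤ k by omega)
  have kk := h.mem le_rfl
  rcases le_total (T.S + (P (m + 1)).2 - T.lam * (P (m + 1)).1)
    (T.S + (P m).2 - T.lam * (P m).1) with hs | hs
  · suffices hq : 2 * (P m).1 - (P (m + 1)).1 ≤ (P 0).1 by
      have e1 : 2 * ((P m).1 - (P 0).1) ≤ (P (m + 1)).1 - (P 0).1 := by omega
      have e2 : (P k).1 - (P (m + 1)).1 ≤ (P k).1 - (P m).1 := by omega
      calc 2 * (((P m).1 - (P 0).1) * ((P k).1 - (P (m + 1)).1))
          = (2 * ((P m).1 - (P 0).1)) * ((P k).1 - (P (m + 1)).1) := by ring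
        _ ≤ _ := mul_le_mul e1 e2 (by omega) (by omega)
    by_contra hq
    push Not at hq
    obtain ⟨i, rfl⟩ : ∃ i, m = i + 1 := ⟨m - 1, by omega⟩
    have c0 := h.supports (show i < k by omega) k0 (.inr rfl)
    have cp := h.cross_pos (m := i) (by omega)
    have li := h.le (show i ≤ i + 1 by omega) (by omega)
    push_cast at li
    set q : ℤ × ℤ := (2 * (P (i + 1)).1 - (P (i + 1 + 1)).1, 2 * (P (i + 1)).2 - (P (i + 1 + 1)).2)
      with hqdef
    have cq : cross (P i) (P (i + 1)) q < 0 := by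
      have e : cross (P i) (P (i + 1)) q = - cross (P i) (P (i + 1)) (P (i + 1 + 1)) := by
        simp only [cross, hqdef]; ring
      omega
    -- The reflected point lies below the edge before `P m`, extended to the left, while `P 0` lies
    -- on or above that line. Hence the point is below the chord from `P 0` to `P m`.
    have hup : 0 ≤ T.R - q.2 + T.mu * q.1 := by
      refine upper_of_below_chord k0 km ?_ ?_ (by omega) ?_
      · simp only [hqdef]; omega
      · simp only [hqdef]; omega
      · have e : ((P (i + 1)).1 - (P i).1) * cross (P 0) (P (i + 1)) q =
            ((P (i + 1)).1 - (P 0).1) * cross (P i) (P (i + 1)) q -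
            ((P (i + 1)).1 - q.1) * cross (P i) (P (i + 1)) (P 0) := by
          simp only [cross]; ring
        refine nonpos_of_mul_nonpos_right (a := (P (i + 1)).1 - (P i).1) ?_ (by omega)
        rw [e]
        have e1 : ((P (i + 1)).1 - (P 0).1) * cross (P i) (P (i + 1)) q ≤ 0 :=
          mul_nonpos_of_nonneg_of_nonpos (by omega) cq.le
        have e2 : 0 ≤ ((P (i + 1)).1 - q.1) * cross (P i) (P (i + 1)) (P 0) :=
          mul_nonneg (by simp only [hqdef]; omega) c0
        omega
    have hmem : T.Mem q.1 q.2 := by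
      refine ⟨?_, ?_, hup⟩
      · have : ((2 * (P (i + 1)).1 - (P (i + 1 + 1)).1 : ℤ) : ℝ) ≤ (P (i + 1)).1 := by
          exact_mod_cast (by omega)
        exact this.trans km.1
      · simp only [hqdef]
        push_cast
        have := km.2.1
        linarith
    have := h.supports (show i < k by omega) hmem (.inl (by simp only [hqdef]; omega))
    omega
  · suffices hq : (P k).1 < 2 * (P (m + 1)).1 - (P m).1 by
      have e1 : (P m).1 - (P 0).1 ≤ (P (m + 1)).1 - (P 0).1 := by omega
      have e2 : 2 * ((P k).1 - (P (m + 1)).1) ≤ (P k).1 - (P m).1 := by omega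
      calc 2 * (((P m).1 - (P 0).1) * ((P k).1 - (P (m + 1)).1))
          = ((P m).1 - (P 0).1) * (2 * ((P k).1 - (P (m + 1)).1)) := by ring
        _ ≤ _ := mul_le_mul e1 e2 (by omega) (by omega)
    by_contra hq
    push Not at hq
    set q : ℤ × ℤ := (2 * (P (m + 1)).1 - (P m).1, 2 * (P (m + 1)).2 - (P m).2) with hqdef
    have sm := h.succ m (by omega)
    have ck := (sm.low (P k) kk (by omega)).1
    -- This reflected point continues the edge beyond `P (m + 1)`, so membership would contradict
    -- that the successor is the farthest point in its direction.
    have cq : cross (P m) (P (m + 1)) q = 0 := by simp only [cross, hqdef]; ring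
    have hup : 0 ≤ T.R - q.2 + T.mu * q.1 := by
      refine upper_of_below_chord km kk ?_ ?_ (by omega) ?_
      · simp only [hqdef]; omega
      · simp only [hqdef]; omega
      · have e : cross (P m) (P k) q = - (2 * cross (P m) (P (m + 1)) (P k)) := by
          simp only [cross, hqdef]; ring
        omega
    have hmem : T.Mem q.1 q.2 := by
      refine ⟨?_, ?_, hup⟩
      · have : ((2 * (P (m + 1)).1 - (P m).1 : ℤ) : ℝ) ≤ (P k).1 := by
          exact_mod_cast hq
        exact this.trans kk.1
      · simp only [hqdef]
        push_cast
        have := km'.2.1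
        linarith
    have := (sm.low q hmem (by simp only [hqdef]; omega)).2 cq
    simp only [hqdef] at this
    omega

/-- With integer abscissae, the ratio of left to right distance starts at no less than `1 / W` and
ends below `W`, where `W < 2 ^ m` is the width. It doubles at each inner edge, so `2 ^ (k - 2) < 2 ^
m * 2 ^ m` when `k ≥ 2`. -/
theorem IsChain.length_le (h : T.IsChain P k) {m : ℕ} (hW : (P k).1 - (P 0).1 < 2 ^ m) :
    k ≤ 2 * m + 1 := by
  by_contra hk
  push Not at hk
  have key : ∀ i, i + 2 ≤ k → (2 : ℤ) ^ i ≤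
      ((P (i + 1)).1 - (P 0).1) * ((P k).1 - (P 0).1) ∧ 2 ^ i * ((P k).1 - (P (i + 1)).1) ≤
      ((P (i + 1)).1 - (P 0).1) * ((P k).1 - (P 0).1) := by
    intro i
    induction i with
    | zero =>
      intro hi
      have l0 := h.le (show 0 ≤ 1 by omega) (by omega)
      have l1 := h.le (show 1 ≤ k by omega) le_rfl
      push_cast at l0 l1
      constructor
      · simp only [pow_zero, zero_add]; nlinarith
      · simp only [pow_zero, zero_add]; nlinarith
    | succ i ih =>
      intro hi
      obtain ⟨-, h2⟩ := ih (by omega)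
      have hd := h.double (m := i + 1) (by omega) (by omega)
      have l0 := h.le (show 0 ≤ i + 1 by omega) (by omega)
      have l1 := h.le (show i + 1 ≤ i + 2 by omega) (by omega)
      have l2 := h.le (show i + 2 ≤ k by omega) le_rfl
      push_cast at l0 l1 l2
      have e : 2 ^ (i + 1) * ((P k).1 - (P (i + 2)).1) ≤
          ((P (i + 2)).1 - (P 0).1) * ((P k).1 - (P 0).1) := by
        have hr : 0 < (P k).1 - (P (i + 1)).1 := by omega
        refine le_of_mul_le_mul_right ?_ hr
        have hp : (0 : ℤ) < 2 ^ i := by positivity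
        have hW0 : 0 ≤ (P k).1 - (P 0).1 := by omega
        calc 2 ^ (i + 1) * ((P k).1 - (P (i + 2)).1) * ((P k).1 - (P (i + 1)).1)
            = 2 * ((P k).1 - (P (i + 2)).1) * (2 ^ i * ((P k).1 - (P (i + 1)).1)) := by ring
          _ ≤ 2 * ((P k).1 - (P (i + 2)).1) *
              (((P (i + 1)).1 - (P 0).1) * ((P k).1 - (P 0).1)) :=
              mul_le_mul_of_nonneg_left h2 (by omega)
          _ = (2 * (((P (i + 1)).1 - (P 0).1) * ((P k).1 - (P (i + 2)).1))) *
              ((P k).1 - (P 0).1) := by ring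
          _ ≤ (((P (i + 2)).1 - (P 0).1) * ((P k).1 - (P (i + 1)).1)) * ((P k).1 - (P 0).1) :=
              mul_le_mul_of_nonneg_right hd hW0
          _ = _ := by ring
      refine ⟨?_, e⟩
      have hp : (0 : ℤ) < 2 ^ (i + 1) := by positivity
      calc (2 : ℤ) ^ (i + 1) = 2 ^ (i + 1) * 1 := by ring
        _ ≤ 2 ^ (i + 1) * ((P k).1 - (P (i + 2)).1) :=
          mul_le_mul_of_nonneg_left (by omega) hp.le
        _ ≤ _ := e
  obtain ⟨i, rfl⟩ : ∃ i, k = i + 2 := ⟨k - 2, by omega⟩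
  have h1 := (key i le_rfl).1
  have l0 := h.le (show 0 ≤ i + 1 by omega) (by omega)
  have l1 := h.le (show i + 1 ≤ i + 2 by omega) le_rfl
  push_cast at l0 l1
  have h2 : ((P (i + 1)).1 - (P 0).1) * ((P (i + 2)).1 - (P 0).1) < 2 ^ m * 2 ^ m :=
    mul_lt_mul'' (by omega) hW (by omega) (by omega)
  rw [← pow_add] at h2
  have h3 := (pow_lt_pow_iff_right₀ (by norm_num : (1 : ℤ) < 2)).1 (h1.trans_lt h2)
  omega

end Chain

end Wedge

end DiscreteHull

namespace DiscreteHull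

open DiscreteHull.Expr (var)

/-! ### Domination by a set of lattice points -/

/-- The lattice point `z` lies on or above the lower hull of `C`. -/
def Cov (C : Set (ℤ × ℤ)) (z : ℤ × ℤ) : Prop :=
  (∃ c ∈ C, c.1 ≤ z.1) ∧ (∃ c ∈ C, z.1 ≤ c.1) ∧
    ∀ κ : ℝ, ∃ c ∈ C, (c.2 : ℝ) - κ * c.1 ≤ z.2 - κ * z.1

/-- Formulated by linear functionals, domination composes without any convex combinations. The two
clauses on abscissae stand for the horizontal functionals, which no finite slope `κ` represents. -/
theorem Cov.trans {C C' : Set (ℤ × ℤ)} {z : ℤ × ℤ} (h : Cov C z) (h' : ∀ c ∈ C, Cov C' c) :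
    Cov C' z := by
  obtain ⟨⟨a, ha, ha'⟩, ⟨b, hb, hb'⟩, h3⟩ := h
  obtain ⟨a', h1, h1'⟩ := (h' a ha).1
  obtain ⟨b', h2, h2'⟩ := (h' b hb).2.1
  refine ⟨⟨a', h1, h1'.trans ha'⟩, ⟨b', h2, hb'.trans h2'⟩, fun κ => ?_⟩
  obtain ⟨c, hc, hc'⟩ := h3 κ
  obtain ⟨d, hd, hd'⟩ := (h' c hc).2.2 κ
  exact ⟨d, hd, hd'.trans hc'⟩

theorem Cov.of_mem {C : Set (ℤ × ℤ)} {c z : ℤ × ℤ} (hc : c ∈ C) (h1 : c.1 = z.1)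
    (h2 : c.2 ≤ z.2) : Cov C z := by
  refine ⟨⟨c, hc, h1.le⟩, ⟨c, hc, h1.ge⟩, fun κ => ⟨c, hc, ?_⟩⟩
  have : (c.2 : ℝ) ≤ z.2 := by exact_mod_cast h2
  rw [h1]
  linarith

theorem Cov.mono {C C' : Set (ℤ × ℤ)} {z : ℤ × ℤ} (h : Cov C z) (hC : C ⊆ C') : Cov C' z :=
  h.trans fun _ hc => .of_mem (hC hc) rfl le_rfl

open Wedge (cross)

/-- A functional larger at both `p` and `q` than at `z` would be larger at the point of the segment
`p q` on the vertical through `z`, and this point is not above `z`. -/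
theorem Cov.of_cross {C : Set (ℤ × ℤ)} {p q z : ℤ × ℤ} (hp : p ∈ C) (hq : q ∈ C)
    (hpz : p.1 ≤ z.1) (hzq : z.1 ≤ q.1) (hpq : p.1 < q.1) (hc : 0 ≤ cross p q z) : Cov C z := by
  refine ⟨⟨p, hp, hpz⟩, ⟨q, hq, hzq⟩, fun κ => ?_⟩
  by_contra h
  push Not at h
  have h1 := h p hp
  have h2 := h q hq
  have a1 : (0 : ℝ) ≤ z.1 - p.1 := sub_nonneg.2 (by exact_mod_cast hpz)
  have a2 : (0 : ℝ) ≤ q.1 - z.1 := sub_nonneg.2 (by exact_mod_cast hzq)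
  have a3 : (0 : ℝ) < q.1 - p.1 := sub_pos.2 (by exact_mod_cast hpq)
  have hc' : 0 ≤ ((q.1 : ℝ) - p.1) * (z.2 - p.2) - (q.2 - p.2) * (z.1 - p.1) := by
    simp only [cross] at hc
    exact_mod_cast hc
  rcases a1.lt_or_eq with a1 | a1
  · nlinarith [mul_lt_mul_of_pos_left h2 a1, mul_le_mul_of_nonneg_left h1.le a2]
  · have a2 : (0 : ℝ) < q.1 - z.1 := by linarith
    nlinarith [mul_lt_mul_of_pos_left h1 a2]

namespace Wedge

theorem IsChain.extend {T : Wedge} {P : ℕ → ℤ × ℤ} {k : ℕ} (h : T.IsChain P k) {q : ℤ × ℤ}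
    (hq : T.Succ (P k) q) : T.IsChain (Function.update P (k + 1) q) (k + 1) := by
  refine ⟨by simpa using h.mem_zero, fun m hm => ?_⟩
  rw [Function.update_of_ne (by omega)]
  rcases eq_or_ne m k with rfl | hne
  · simpa using hq
  · rw [Function.update_of_ne (by omega)]
    exact h.succ m (by omega)

/-- A point between two consecutive abscissae is on or above the edge by the choice of the
successor. Successors say nothing about the starting column, for which `hbot` is needed. -/
theorem IsChain.cov {T : Wedge} {P : ℕ → ℤ × ℤ} {k : ℕ} (h : T.IsChain P k)
    (hbot : ∀ z : ℤ × ℤ, T.Mem z.1 z.2 → z.1 = (P 0).1 → (P 0).2 ≤ z.2) {z : ℤ × ℤ}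
    (hz : T.Mem z.1 z.2) (h0 : (P 0).1 ≤ z.1) (hk : z.1 ≤ (P k).1) :
    Cov (P '' Set.Iic k) z := by
  induction k with
  | zero =>
    have e : z.1 = (P 0).1 := le_antisymm hk h0
    exact .of_mem (c := P 0) ⟨0, by simp, rfl⟩ e.symm (hbot z hz e)
  | succ k ih =>
    rcases le_or_gt z.1 (P k).1 with h1 | h1
    · refine (ih ⟨h.mem_zero, fun m hm => h.succ m (by omega)⟩ h1).mono
        (Set.image_mono fun i hi => ?_)
      simp only [Set.mem_Iic] at *
      omega
    · have hs := h.succ k (by omega)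
      exact .of_cross (p := P k) (q := P (k + 1)) ⟨k, by simp, rfl⟩ ⟨k + 1, by simp, rfl⟩ h1.le hk
        hs.lt (hs.low z hz h1).1

end Wedge

/-! ### Walking along the lower hull

Registers `20, 21` hold the current point and register `22` tells whether the walk goes on. -/

/-- Advance to the next point of the lower hull in the direction given by the sign `τ`. -/
def walkProg (τ : ℤ) (mu R M : Expr) : Program :=
  30 ≔ .const τ * var 12 ;;
  31 ≔ .const τ * mu ;;
  32 ≔ var 21 - (var 12 * var 20 + var 14) ;;
  33 ≔ R ;;
  34 ≔ M ;;
  nextProg ;;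
  .branch (1 ≼ var 40)
    (20 ≔ var 20 + .const τ * var 41 ;; 21 ≔ var 21 + var 42)
    (22 ≔ 0)

@[simp] theorem eval_const (s : Memory) (z : ℤ) : (Expr.const z).eval s = z := rfl

/-- The value of an expression depends only on the registers below `m` and on no array. -/
def UsesBelow (m : ℕ) (e : Expr) : Prop :=
  ∀ s s' : Memory, (∀ r < m, s'.reg r = s.reg r) → e.eval s' = e.eval s

/-- The region `T` lives in coordinates where the walk goes to the right; for `τ = -1` these are
mirrored in the vertical axis. Translating the current point to the origin reduces the successor to
the search for the lowest direction. -/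
theorem walkProg_spec (τ : ℤ) (mu R M : Expr) (hmu : UsesBelow 30 mu) (hR : UsesBelow 30 R)
    (hM : UsesBelow 30 M) :
    ∃ C : ℕ, ∀ (s : Memory) (T : Wedge) (p : ℤ × ℤ) (m : ℕ), T.Mem p.1 p.2 →
      s.reg 20 = τ * p.1 → s.reg 21 = p.2 →
      T.shift p = ⟨τ * s.reg 12, τ * mu.eval s, s.reg 21 - (s.reg 12 * s.reg 20 + s.reg 14),
        R.eval s, M.eval s⟩ →
      T.M - p.1 < 2 ^ m →
      Ends (walkProg τ mu R M) s (C * (m + 1)) (fun s' => Agree 20 s s' ∧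
        ((s'.reg 22 = s.reg 22 ∧ ∃ q : ℤ × ℤ, T.Succ p q ∧ s'.reg 20 = τ * q.1 ∧ s'.reg 21 = q.2) ∨
          (s'.reg 22 = 0 ∧ s'.reg 20 = s.reg 20 ∧ s'.reg 21 = s.reg 21 ∧
            ∀ z : ℤ × ℤ, T.Mem z.1 z.2 → z.1 ≤ p.1))) := by
  obtain ⟨C, hC⟩ := nextProg_spec
  set c₁ := timeBound (30 ≔ .const τ * var 12) + timeBound (31 ≔ .const τ * mu) +
    timeBound (32 ≔ var 21 - (var 12 * var 20 + var 14)) + timeBound (33 ≔ R) +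
    timeBound (34 ≔ M) with hc₁
  set c₂ := timeBound (.branch (1 ≼ var 40)
    (20 ≔ var 20 + .const τ * var 41 ;; 21 ≔ var 21 + var 42) (22 ≔ 0)) with hc₂
  refine ⟨c₁ + C + c₂, fun s T p m hp h20 h21 hT hm => ?_⟩
  unfold walkProg
  have key : ∀ (x : ℕ) (e : Expr) (s' : Memory) (P : Program) (B : ℕ) (Q : Memory → Prop),
      Ends P (s'.set x (e.eval s')) B Q → Ends ((x ≔ e) ;; P) s' (timeBound (x ≔ e) + B) Q :=
    fun x e s' P B Q h => (Ends.of_exec (Q := fun s'' => s'' = s'.set x (e.eval s')) (by rfl)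
      rfl).seq fun s'' hs => hs ▸ h
  refine Ends.mono (B := timeBound (30 ≔ .const τ * var 12) + (timeBound (31 ≔ .const τ * mu) +
    (timeBound (32 ≔ var 21 - (var 12 * var 20 + var 14)) + (timeBound (33 ≔ R) +
    (timeBound (34 ≔ M) + (C * (m + 1) + c₂)))))) (key _ _ _ _ _ _ (key _ _ _ _ _ _
    (key _ _ _ _ _ _ (key _ _ _ _ _ _ (key _ _ _ _ _ _ ?_))))) ?_ (fun _ h => h)
  swap
  · have h1 := Nat.zero_le (m * (c₁ + c₂))
    nlinarith
  rw [hM (s := s), hR (s := s),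
    show ∀ s', (Expr.const τ * mu).eval s' = τ * mu.eval s' from fun _ => rfl, hmu (s := s)]
  rotate_left
  · intro r hr
    have : r ≠ 30 := by omega
    simp [this]
  · intro r hr
    rw [Memory.set_reg, Memory.set_reg, Memory.set_reg, if_neg (by omega), if_neg (by omega),
      if_neg (by omega)]
  · intro r hr
    rw [Memory.set_reg, Memory.set_reg, Memory.set_reg, Memory.set_reg, if_neg (by omega),
      if_neg (by omega), if_neg (by omega), if_neg (by omega)]
  set s₁ := ((((s.set 30 _).set 31 _).set 32 _).set 33 _).set 34 _ with hs₁
  have ag : Agree 30 s s₁ := (((((Agree.refl _ _).set (by norm_num) _).set (by norm_num) _).set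
    (by norm_num) _).set (by norm_num) _).set (by norm_num) _
  have hw : wedgeOf s₁ = T.shift p := by
    rw [hT]
    simp [wedgeOf, hs₁]
  refine (hC s₁ m (hw ▸ Wedge.pointed_shift hp) (by rw [hw]; exact hm)).seq fun s₂ h => ?_
  obtain ⟨ag₂, hf⟩ := h
  rw [hw] at hf
  have ag' := ag.trans (ag₂.mono (by norm_num : 30 ≤ 40))
  refine .of_exec (by rfl) ?_
  rcases hf with ⟨h40, x, y, hx, hy, hl⟩ | ⟨h40, hn⟩
  · rw [exec_branch_pos _ (by simp [h40])]
    simp only [exec_seq, exec_assign]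
    refine ⟨((ag'.mono (by norm_num)).set (by norm_num) _).set (by norm_num) _, .inl ⟨?_, _,
      hl.succ, ?_, ?_⟩⟩
    · simp [ag'.2 22]
    · simp [ag'.2 20, h20, hx]; ring
    · simp [ag'.2 21, h21, hy]
  · rw [exec_branch_neg _ (by simp [h40])]
    simp only [exec_assign]
    refine ⟨(ag'.mono (by norm_num)).set (by norm_num) _, .inr ⟨by simp, ?_, ?_, fun z hz => ?_⟩⟩
    · simp [ag'.2 20]
    · simp [ag'.2 21]
    · by_contra hlt
      refine hn (z.1 - p.1) (z.2 - p.2) (by omega) (Wedge.shift_mem.2 ?_)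
      push_cast
      simpa using hz

theorem Wedge.IsChain.span {T : Wedge} {P : ℕ → ℤ × ℤ} {k m : ℕ} (h : T.IsChain P k)
    (hm : T.M - (P 0).1 < 2 ^ m) : T.M - (P k).1 < 2 ^ m ∧ k ≤ 2 * m + 1 := by
  have h1 := h.le (Nat.zero_le k) le_rfl
  have h2 : (P 0).1 ≤ (P k).1 := by
    push_cast at h1
    omega
  have h2' : ((P 0).1 : ℝ) ≤ (P k).1 := by exact_mod_cast h2
  have h3 := (h.mem le_rfl).1
  refine ⟨by linarith, h.length_le ?_⟩
  have h4 : (((P k).1 - (P 0).1 : ℤ) : ℝ) < 2 ^ m := by push_cast; linarith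
  exact_mod_cast h4

/-- The walk goes on until the condition `g` fails or the last lattice point is reached. -/
theorem walkLoop_spec (τ : ℤ) (mu R M : Expr) (hmu : UsesBelow 30 mu) (hR : UsesBelow 30 R)
    (hM : UsesBelow 30 M) (g : Test) :
    ∃ C : ℕ, ∀ (s : Memory) (T : Wedge) (p : ℤ × ℤ) (m : ℕ) (G : ℤ × ℤ → Prop), T.Mem p.1 p.2 →
      s.reg 20 = τ * p.1 → s.reg 21 = p.2 → s.reg 22 = 1 →
      (∀ (s' : Memory) (q : ℤ × ℤ), Agree 20 s s' → s'.reg 20 = τ * q.1 → s'.reg 21 = q.2 →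
        T.shift q = ⟨τ * s'.reg 12, τ * mu.eval s',
          s'.reg 21 - (s'.reg 12 * s'.reg 20 + s'.reg 14), R.eval s', M.eval s'⟩ ∧
        (g.Holds s' ↔ G q)) →
      T.M - p.1 < 2 ^ m →
      Ends (.loop ((1 ≼ var 22).and g) (walkProg τ mu R M)) s (C * (m + 1) ^ 2) (fun s' =>
        Agree 20 s s' ∧ ∃ (P : ℕ → ℤ × ℤ) (k : ℕ), T.IsChain P k ∧ P 0 = p ∧
          s'.reg 20 = τ * (P k).1 ∧ s'.reg 21 = (P k).2 ∧ (∀ i < k, G (P i)) ∧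
          (¬ G (P k) ∨ ∀ z : ℤ × ℤ, T.Mem z.1 z.2 → z.1 ≤ (P k).1)) := by
  obtain ⟨C, hC⟩ := walkProg_spec τ mu R M hmu hR hM
  refine ⟨3 * (((1 ≼ var 22).and g).cost + 1 + C), fun s T p m G hp h20 h21 h22 hfr hm => ?_⟩
  -- While the flag is set, the number of rounds equals the length of the chain, which is at most `2
  -- * m + 1`. One further round may be spent on clearing the flag.
  let I : ℕ → Memory → Prop := fun k s' => Agree 20 s s' ∧ ∃ (P : ℕ → ℤ × ℤ) (k' : ℕ),
    T.IsChain P k' ∧ P 0 = p ∧ s'.reg 20 = τ * (P k').1 ∧ s'.reg 21 = (P k').2 ∧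
    (∀ i < k', G (P i)) ∧ ((s'.reg 22 = 1 ∧ k' = k) ∨
      (s'.reg 22 = 0 ∧ ∀ z : ℤ × ℤ, T.Mem z.1 z.2 → z.1 ≤ (P k').1))
  have hloop := Ends.loop (b := (1 ≼ var 22).and g) (P := walkProg τ mu R M) (s := s)
    (K := 2 * m + 2) (C := C * (m + 1)) I
    ⟨.refl _ _, fun _ => p, 0, ⟨hp, fun m hm => absurd hm (Nat.not_lt_zero m)⟩, rfl, h20, h21,
      fun i hi => absurd hi (Nat.not_lt_zero i), .inl ⟨h22, rfl⟩⟩ (by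
    rintro k s' ⟨ag, P, k', hch, hP0, e20, e21, hG, h⟩ ⟨hb, hg⟩
    rcases h with ⟨e22, rfl⟩ | ⟨e22, -⟩
    · obtain ⟨hsp, hlen⟩ := hch.span (hP0 ▸ hm)
      obtain ⟨hf, hg'⟩ := hfr s' (P k') ag e20 e21
      refine ⟨by omega, (hC s' T (P k') m (hch.mem le_rfl) e20 e21 hf hsp).mono le_rfl ?_⟩
      rintro s'' ⟨ag', ⟨h1, q, hq, h2, h3⟩ | ⟨h1, h2, h3, h4⟩⟩
      · refine ⟨ag.trans ag', _, k' + 1, hch.extend hq, by simpa using hP0, by simpa using h2,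
          by simpa using h3, fun i hi => ?_, .inl ⟨h1.trans e22, rfl⟩⟩
        rw [Function.update_of_ne (by omega)]
        rcases eq_or_ne i k' with rfl | hne
        · exact hg'.1 hg
        · exact hG i (by omega)
      · exact ⟨ag.trans ag', P, k', hch, hP0, h2.trans e20, h3.trans e21, hG, .inr ⟨h1, h4⟩⟩
    · exact absurd hb (by simp [e22]))
  refine hloop.mono ?_ ?_
  · generalize ((1 ≼ var 22).and g).cost + 1 = c
    nlinarith [Nat.zero_le (m * m * c), Nat.zero_le (m * c), Nat.zero_le (m * C),
      Nat.zero_le (m * m * C), Nat.zero_le C, Nat.zero_le c]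
  · rintro s' ⟨k, ⟨ag, P, k', hch, hP0, e20, e21, hG, h⟩, hb⟩
    refine ⟨ag, P, k', hch, hP0, e20, e21, hG, ?_⟩
    rcases h with ⟨e22, -⟩ | ⟨-, h⟩
    · refine .inl fun hGk => hb ⟨by simp [e22], ((hfr s' _ ag e20 e21).2).2 hGk⟩
    · exact .inr h

/-- Arrays `a` and `b` hold the first `N` points of the sequence `E`. -/
def HoldsSeq (s : Memory) (a b N : ℕ) (E : ℕ → ℤ × ℤ) : Prop :=
  ∀ i < N, s.arr a i = (E i).1 ∧ s.arr b i = (E i).2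

/-- Walk to the right and store all points passed. -/
def emitBody : Program :=
  .store 2 (var 18) (var 20) ;;
  .store 3 (var 18) (var 21) ;;
  18 ≔ var 18 + 1

/-- The two memories differ at most in arrays `2, 3` and in registers from `m` on. -/
def AgreeE (m : ℕ) (s s' : Memory) : Prop :=
  (∀ a, a ≠ 2 → a ≠ 3 → s'.arr a = s.arr a) ∧ ∀ r < m, s'.reg r = s.reg r

theorem AgreeE.trans {m : ℕ} {s s' s'' : Memory} (h : AgreeE m s s') (h' : AgreeE m s' s'') :
    AgreeE m s s'' :=
  ⟨fun a h2 h3 => (h'.1 a h2 h3).trans (h.1 a h2 h3), fun r hr => (h'.2 r hr).trans (h.2 r hr)⟩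

theorem Agree.toE {m m' : ℕ} {s s' : Memory} (h : Agree m s s') (hm : m' ≤ m) : AgreeE m' s s' :=
  ⟨fun a _ _ => by rw [h.1], fun r hr => h.2 r (by omega)⟩

theorem emitBody_spec {s : Memory} {N : ℕ} {E : ℕ → ℤ × ℤ} (hN : s.reg 18 = N)
    (hE : HoldsSeq s 2 3 N E) (h20 : s.reg 20 = (E N).1) (h21 : s.reg 21 = (E N).2) :
    AgreeE 18 s (exec emitBody s) ∧ (exec emitBody s).reg 18 = (N + 1 : ℕ) ∧
      HoldsSeq (exec emitBody s) 2 3 (N + 1) E ∧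
      ∀ r, r ≠ 18 → (exec emitBody s).reg r = s.reg r := by
  simp only [emitBody, exec_seq, exec_assign, exec_store]
  refine ⟨⟨fun a h2 h3 => ?_, fun r hr => ?_⟩, ?_, fun i hi => ?_, fun r hr => ?_⟩
  · ext i
    simp [h2, h3]
  · have : r ≠ 18 := by omega
    simp [this]
  · simp [hN]
  · rcases eq_or_ne i N with rfl | hne
    · simp [hN, h20, h21]
    · have := hE i (by omega)
      simp [hN, hne, this]
  · simp [hr]

/-- Each point is stored before the walk leaves it. The round that finds no successor has already
stored the last point, so a chain with `k` edges yields `k + 1` stored points. -/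
theorem emitLoop_spec :
    ∃ C : ℕ, ∀ (s : Memory) (T : Wedge) (p : ℤ × ℤ) (m N : ℕ) (E : ℕ → ℤ × ℤ), T.Mem p.1 p.2 →
      s.reg 20 = p.1 → s.reg 21 = p.2 → s.reg 22 = 1 → s.reg 18 = N → HoldsSeq s 2 3 N E →
      T = ⟨s.reg 12, s.reg 13, - s.reg 14, s.reg 15, s.reg 16⟩ →
      T.M - p.1 < 2 ^ m →
      Ends (.loop (1 ≼ var 22) (emitBody ;;
        walkProg 1 (var 13) (var 13 * var 20 + var 15 - var 21) (var 16 - var 20))) s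
        (C * (m + 1) ^ 2) (fun s' => AgreeE 18 s s' ∧ ∃ (P : ℕ → ℤ × ℤ) (k : ℕ),
          T.IsChain P k ∧ P 0 = p ∧ (∀ z : ℤ × ℤ, T.Mem z.1 z.2 → z.1 ≤ (P k).1) ∧
          k ≤ 2 * m + 1 ∧ s'.reg 18 = (N + k + 1 : ℕ) ∧
          HoldsSeq s' 2 3 (N + k + 1) (fun i => if i < N then E i else P (i - N))) := by
  obtain ⟨C, hC⟩ := walkProg_spec 1 (var 13) (var 13 * var 20 + var 15 - var 21) (var 16 - var 20)
    (fun s s' h => by simp [h]) (fun s s' h => by simp [h]) (fun s s' h => by simp [h])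
  refine ⟨3 * ((1 ≼ var 22).cost + 1 + (timeBound emitBody + C)),
    fun s T p m N E hp h20 h21 h22 hN hE hT hm => ?_⟩
  let I : ℕ → Memory → Prop := fun k s' => AgreeE 18 s s' ∧ ∃ (P : ℕ → ℤ × ℤ) (k' : ℕ),
    T.IsChain P k' ∧ P 0 = p ∧ s'.reg 20 = (P k').1 ∧ s'.reg 21 = (P k').2 ∧
    ((s'.reg 22 = 1 ∧ k' = k ∧ s'.reg 18 = (N + k' : ℕ) ∧
        HoldsSeq s' 2 3 (N + k') (fun i => if i < N then E i else P (i - N))) ∨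
      (s'.reg 22 = 0 ∧ s'.reg 18 = (N + k' + 1 : ℕ) ∧
        HoldsSeq s' 2 3 (N + k' + 1) (fun i => if i < N then E i else P (i - N)) ∧
        ∀ z : ℤ × ℤ, T.Mem z.1 z.2 → z.1 ≤ (P k').1))
  have hloop := Ends.loop (b := 1 ≼ var 22) (P := emitBody ;;
      walkProg 1 (var 13) (var 13 * var 20 + var 15 - var 21) (var 16 - var 20)) (s := s)
    (K := 2 * m + 2) (C := timeBound emitBody + C * (m + 1)) I
    ⟨(Agree.refl 18 s).toE le_rfl, fun _ => p, 0,
      ⟨hp, fun m hm => absurd hm (Nat.not_lt_zero m)⟩, rfl, h20, h21,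
      .inl ⟨h22, rfl, hN, fun i hi => by
        have hi' : i < N := by simpa using hi
        simpa [hi'] using hE i hi'⟩⟩ (by
    rintro k s' ⟨ag, P, k', hch, hP0, e20, e21, h⟩ hb
    rcases h with ⟨e22, rfl, e18, hseq⟩ | ⟨e22, -⟩
    swap
    · exact absurd hb (by simp [e22])
    obtain ⟨hsp, hlen⟩ := hch.span (hP0 ▸ hm)
    obtain ⟨ag₁, f18, hseq₁, fr⟩ := emitBody_spec e18 hseq (by simpa using e20)
      (by simpa using e21)
    refine ⟨by omega, (Ends.of_exec (Q := fun s₁ => s₁ = exec emitBody s') (by rfl) rfl).seq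
      fun s₁ hs₁ => ?_⟩
    rw [← hs₁] at ag₁ f18 hseq₁ fr
    have ag₂ := ag.trans ag₁
    refine (hC s₁ T (P k') m (hch.mem le_rfl) (by simp [fr 20, e20]) (by simp [fr 21, e21]) ?_
      hsp).mono le_rfl ?_
    · rw [hT]
      simp [Wedge.shift, ag₂.2 12, ag₂.2 13, ag₂.2 14, ag₂.2 15, ag₂.2 16, fr 20, fr 21, e20, e21]
      constructor <;> ring
    · rintro s'' ⟨ag', h⟩
      have hseq₂ : HoldsSeq s'' 2 3 (N + k' + 1) (fun i => if i < N then E i else P (i - N)) := by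
        intro i hi
        rw [ag'.1]
        exact hseq₁ i hi
      have f18' : s''.reg 18 = (N + k' + 1 : ℕ) := (ag'.2 18 (by norm_num)).trans f18
      refine ⟨ag₂.trans (ag'.toE (by norm_num)), ?_⟩
      rcases h with ⟨h1, q, hq, h2, h3⟩ | ⟨h1, h2, h3, h4⟩
      · refine ⟨_, k' + 1, hch.extend hq, by simpa using hP0, by simpa using h2,
          by simpa using h3, .inl ⟨by rw [h1, fr 22 (by norm_num), e22], rfl, f18',
            fun i hi => ?_⟩⟩
        have := hseq₂ i hi
        by_cases hiN : i < N
        · simpa [hiN] using this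
        · simpa [hiN, Function.update_of_ne (show i - N ≠ k' + 1 by omega)] using this
      · exact ⟨P, k', hch, hP0, by rw [h2, fr 20 (by norm_num), e20],
          by rw [h3, fr 21 (by norm_num), e21], .inr ⟨h1, f18', hseq₂, h4⟩⟩)
  refine hloop.mono ?_ ?_
  · generalize (1 ≼ var 22).cost + 1 = c
    generalize timeBound emitBody = d
    nlinarith [Nat.zero_le (m * m * c), Nat.zero_le (m * c), Nat.zero_le (m * C),
      Nat.zero_le (m * m * C), Nat.zero_le C, Nat.zero_le c, Nat.zero_le d, Nat.zero_le (m * d),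
      Nat.zero_le (m * m * d)]
  · rintro s' ⟨k, ⟨ag, P, k', hch, hP0, -, -, h⟩, hb⟩
    rcases h with ⟨e22, -⟩ | ⟨-, h1, h2, h3⟩
    · exact absurd (by simp [e22]) hb
    · exact ⟨ag, P, k', hch, hP0, h3, (hch.span (hP0 ▸ hm)).2, h1, h2⟩

end DiscreteHull

namespace DiscreteHull

open DiscreteHull.Expr (var)

/-! ### The lattice points between two lines -/

/-- Registers `20, 21` are set to the lowest lattice point of column `20` above the lower line. -/
def bottomProg : Program :=
  21 ≔ (var 12 * var 20 + var 14).ceil ;;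
  22 ≔ 1

/-- Store points on the lower hull of the lattice points in the columns from register `5` to
register `16`, above the line of slope `reg 12` with intercept `reg 14` and below the line of
slope `reg 13` with intercept `reg 15`. -/
def slabProg : Program :=
  20 ≔ var 5 ;;
  bottomProg ;;
  .loop ((1 ≼ var 22).and (var 21 ≼ var 13 * var 20 + var 15).not)
    (walkProg 1 (var 12) (var 12 * var 20 + (var 14 + 1) - var 21) (var 16 - var 20)) ;;
  .branch (var 21 ≼ var 13 * var 20 + var 15)
    (22 ≔ 1 ;;
      .loop ((1 ≼ var 22).and (0 ≼ 0))
        (walkProg (-1) (var 13) (var 13 * var 20 + var 15 - var 21) (var 20 - var 5)) ;;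
      bottomProg ;;
      .loop (1 ≼ var 22) (emitBody ;;
        walkProg 1 (var 13) (var 13 * var 20 + var 15 - var 21) (var 16 - var 20)))
    .skip

/-- The lattice points in the columns from `x₀` to `x₁` between two lines. -/
def InSlab (x₀ x₁ : ℤ) (lam mu α β : ℝ) (z : ℤ × ℤ) : Prop :=
  x₀ ≤ z.1 ∧ z.1 ≤ x₁ ∧ lam * z.1 + α ≤ z.2 ∧ (z.2 : ℝ) ≤ mu * z.1 + β

theorem bottomProg_spec (s : Memory) : Agree 20 s (exec bottomProg s) ∧
    (exec bottomProg s).reg 20 = s.reg 20 ∧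
    (exec bottomProg s).reg 21 = (⌈s.reg 12 * s.reg 20 + s.reg 14⌉ : ℤ) ∧
    (exec bottomProg s).reg 22 = 1 := by
  simp only [bottomProg, exec_seq, exec_assign]
  exact ⟨((Agree.refl _ _).set (by norm_num) _).set (by norm_num) _, by simp, by simp, by simp⟩

/-- Three walks are needed because no lattice point of the slab is known in advance. The first
follows the lower hull of the lattice points above the lower line until it meets a point below the
upper line. The second goes left from there to the leftmost column that contains a lattice point of
the slab. The third starts at the lowest admissible point of that column and stores the lower hull
of the slab. -/
theorem slabProg_spec : ∃ C : ℕ, ∀ (s : Memory) (x₀ x₁ : ℤ) (m N : ℕ) (E : ℕ → ℤ × ℤ),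
    s.reg 5 = x₀ → s.reg 16 = x₁ → x₀ ≤ x₁ → x₁ - x₀ < 2 ^ m → s.reg 18 = N →
    HoldsSeq s 2 3 N E →
    Ends slabProg s (C * (m + 1) ^ 2) (fun s' => AgreeE 18 s s' ∧ ∃ (N' : ℕ) (E' : ℕ → ℤ × ℤ),
      N ≤ N' ∧ N' ≤ N + (2 * m + 2) ∧ s'.reg 18 = N' ∧ HoldsSeq s' 2 3 N' E' ∧
      (∀ i < N, E' i = E i) ∧
      (∀ i, N ≤ i → i < N' →
        InSlab x₀ x₁ (s.reg 12) (s.reg 13) (s.reg 14) (s.reg 15) (E' i)) ∧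
      (∀ i, N ≤ i → i + 1 < N' → (E' i).1 < (E' (i + 1)).1) ∧
      ∀ z, InSlab x₀ x₁ (s.reg 12) (s.reg 13) (s.reg 14) (s.reg 15) z →
        Cov (E' '' Set.Ico N N') z) := by
  obtain ⟨C₁, hC₁⟩ := walkLoop_spec 1 (var 12) (var 12 * var 20 + (var 14 + 1) - var 21)
    (var 16 - var 20) (fun s s' h => by simp [h]) (fun s s' h => by simp [h])
    (fun s s' h => by simp [h]) (var 21 ≼ var 13 * var 20 + var 15).not
  obtain ⟨C₂, hC₂⟩ := walkLoop_spec (-1) (var 13) (var 13 * var 20 + var 15 - var 21)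
    (var 20 - var 5) (fun s s' h => by simp [h]) (fun s s' h => by simp [h])
    (fun s s' h => by simp [h]) (0 ≼ 0)
  obtain ⟨C₃, hC₃⟩ := emitLoop_spec
  refine ⟨timeBound (20 ≔ var 5) + timeBound bottomProg + C₁ +
    ((var 21 ≼ var 13 * var 20 + var 15).cost + 1) + timeBound (22 ≔ 1) + C₂ +
    timeBound bottomProg + C₃ + timeBound .skip, fun s x₀ x₁ m N E h5 h16 h01 hm hN hE => ?_⟩
  generalize hlam : s.reg 12 = lam
  generalize hmu : s.reg 13 = mu
  generalize hα : s.reg 14 = α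
  generalize hβ : s.reg 15 = β
  have hm' : (x₁ : ℝ) - x₀ < 2 ^ m := by exact_mod_cast hm
  have h01' : (x₀ : ℝ) ≤ x₁ := by exact_mod_cast h01
  -- A strip of vertical height one contains the lowest lattice point above the line in every
  -- column, so the upper line can be ignored for the first walk.
  set T₁ : Wedge := ⟨lam, lam, -α, α + 1, x₁⟩ with hT₁
  set T : Wedge := ⟨lam, mu, -α, β, x₁⟩ with hT
  set T₂ : Wedge := ⟨-lam, -mu, -α, β, -x₀⟩ with hT₂
  have T₁mem : ∀ z : ℤ × ℤ, T₁.Mem z.1 z.2 ↔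
      z.1 ≤ x₁ ∧ lam * z.1 + α ≤ z.2 ∧ (z.2 : ℝ) ≤ lam * z.1 + α + 1 := by
    intro z
    simp only [Wedge.Mem, hT₁, Int.cast_le]
    constructor
    · rintro ⟨h1, h2, h3⟩; exact ⟨h1, by linarith, by linarith⟩
    · rintro ⟨h1, h2, h3⟩; exact ⟨h1, by linarith, by linarith⟩
  have Tmem : ∀ z : ℤ × ℤ, T.Mem z.1 z.2 ↔
      z.1 ≤ x₁ ∧ lam * z.1 + α ≤ z.2 ∧ (z.2 : ℝ) ≤ mu * z.1 + β := by
    intro z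
    simp only [Wedge.Mem, hT, Int.cast_le]
    constructor
    · rintro ⟨h1, h2, h3⟩; exact ⟨h1, by linarith, by linarith⟩
    · rintro ⟨h1, h2, h3⟩; exact ⟨h1, by linarith, by linarith⟩
  have T₂mem : ∀ z : ℤ × ℤ, T₂.Mem ((-z.1 : ℤ) : ℝ) z.2 ↔
      x₀ ≤ z.1 ∧ lam * z.1 + α ≤ z.2 ∧ (z.2 : ℝ) ≤ mu * z.1 + β := by
    intro z
    simp only [Wedge.Mem, hT₂]
    push_cast
    rw [neg_le_neg_iff, Int.cast_le]
    constructor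
    · rintro ⟨h1, h2, h3⟩; exact ⟨h1, by linarith, by linarith⟩
    · rintro ⟨h1, h2, h3⟩; exact ⟨h1, by linarith, by linarith⟩
  have bot : ∀ x : ℤ, lam * x + α ≤ (⌈lam * x + α⌉ : ℤ) ∧
      ((⌈lam * x + α⌉ : ℤ) : ℝ) ≤ lam * x + α + 1 ∧
      ∀ y : ℤ, lam * x + α ≤ y → ⌈lam * x + α⌉ ≤ y :=
    fun x => ⟨Int.le_ceil _, (Int.ceil_lt_add_one _).le, fun y hy => Int.ceil_le.2 hy⟩
  unfold slabProg
  refine Ends.mono (B := timeBound (20 ≔ var 5) + (timeBound bottomProg + (C₁ * (m + 1) ^ 2 +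
    ((var 21 ≼ var 13 * var 20 + var 15).cost + 1 + (timeBound (22 ≔ 1) + (C₂ * (m + 1) ^ 2 +
    (timeBound bottomProg + (C₃ * (m + 1) ^ 2))) + timeBound .skip))))) ?_ ?_ (fun _ h => h)
  swap
  · generalize timeBound (20 ≔ var 5) = a
    generalize timeBound bottomProg = b
    generalize (var 21 ≼ var 13 * var 20 + var 15).cost = c
    generalize timeBound (22 ≔ 1) = d
    generalize timeBound .skip = e
    have h1 : 1 ≤ (m + 1) ^ 2 := Nat.one_le_pow _ _ (by omega)
    generalize (m + 1) ^ 2 = q at *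
    have := Nat.le_mul_of_pos_right (a + 2 * b + (c + 1) + d + e) h1
    nlinarith
  refine (Ends.of_exec (Q := fun s₁ => s₁ = s.set 20 (s.reg 5)) (by rfl) rfl).seq fun s₁ hs₁ => ?_
  subst hs₁
  obtain ⟨ag₁, e20, e21, e22⟩ := bottomProg_spec (s.set 20 (s.reg 5))
  refine (Ends.of_exec (Q := fun s₁ => s₁ = exec bottomProg (s.set 20 (s.reg 5))) (by rfl)
    rfl).seq fun s₁ hs₁ => ?_
  rw [← hs₁] at ag₁ e20 e21 e22
  clear hs₁
  replace ag₁ : Agree 20 s s₁ := ((Agree.refl _ _).set (by norm_num) _).trans ag₁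
  simp only [Memory.set_reg, if_true, Nat.reduceEqDiff, if_false, hlam, hα, h5] at e20 e21
  set p : ℤ × ℤ := (x₀, ⌈lam * x₀ + α⌉) with hp
  have hpT : T₁.Mem p.1 p.2 := (T₁mem p).2 ⟨h01, (bot x₀).1, (bot x₀).2.1⟩
  have regs : ∀ s', Agree 20 s s' → s'.reg 12 = lam ∧ s'.reg 13 = mu ∧ s'.reg 14 = α ∧
      s'.reg 15 = β ∧ s'.reg 16 = x₁ ∧ s'.reg 5 = x₀ := fun s' h =>
    ⟨(h.2 12 (by norm_num)).trans hlam, (h.2 13 (by norm_num)).trans hmu,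
      (h.2 14 (by norm_num)).trans hα, (h.2 15 (by norm_num)).trans hβ,
      (h.2 16 (by norm_num)).trans h16, (h.2 5 (by norm_num)).trans h5⟩
  refine (hC₁ s₁ T₁ p m (fun q => ¬ (q.2 : ℝ) ≤ mu * q.1 + β) hpT (by simpa using e20) e21 e22
    (fun s' q ag h20 h21 => ?_) hm').seq fun s₂ h => ?_
  · obtain ⟨r12, r13, r14, r15, r16, r5⟩ := regs s' (ag₁.trans ag)
    constructor
    · simp [Wedge.shift, hT₁, r12, r14, r16, h20, h21]
      constructor <;> ring
    · simp [r13, r15, h20, h21]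
  obtain ⟨ag₂, P, k, hch, hP0, f20, f21, hG, hend⟩ := h
  replace ag₂ := ag₁.trans ag₂
  obtain ⟨r12, r13, r14, r15, r16, r5⟩ := regs s₂ ag₂
  simp only [Int.cast_one, one_mul] at f20
  have hPk := (T₁mem _).1 (hch.mem le_rfl)
  have hbot1 : ∀ z : ℤ × ℤ, T₁.Mem z.1 z.2 → z.1 = (P 0).1 → (P 0).2 ≤ z.2 := by
    intro z hz hz0
    rw [hP0] at hz0 ⊢
    have := ((T₁mem z).1 hz).2.1
    rw [hz0] at this
    exact (bot x₀).2.2 _ this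
  refine Ends.branch (Q := _) (B := timeBound (22 ≔ 1) + (C₂ * (m + 1) ^ 2 +
    (timeBound bottomProg + (C₃ * (m + 1) ^ 2))) + timeBound .skip) (fun hb => ?_) (fun hb => ?_)
  swap
  · have hnot : ¬ ((P k).2 : ℝ) ≤ mu * (P k).1 + β := by
      simpa [f20, f21, r13, r15] using hb
    have hfin := hend.resolve_left (not_not.2 hnot)
    refine (Ends.of_exec (Q := fun s' => s' = s₂) (by rfl) rfl).mono (Nat.le_add_left _ _) ?_
    rintro s' rfl
    refine ⟨ag₂.toE (by norm_num), N, E, le_rfl, by omega, (ag₂.2 18 (by norm_num)).trans hN,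
      fun i hi => by rw [ag₂.1]; exact hE i hi, fun _ _ => rfl, fun i h1 h2 => by omega,
      fun i h1 h2 => by omega, fun z hz => ?_⟩
    exfalso
    obtain ⟨z1, z2, z3, z4⟩ := hz
    set b : ℤ × ℤ := (z.1, ⌈lam * z.1 + α⌉) with hb
    have hbT : T₁.Mem b.1 b.2 := (T₁mem b).2 ⟨z2, (bot z.1).1, (bot z.1).2.1⟩
    have hbz : b.2 ≤ z.2 := (bot z.1).2.2 _ z3
    -- Every point of the first chain is strictly above the upper line. Tested with the slope `mu`,
    -- domination carries this over to the lowest point `b` of the column of `z`, and `z` is not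
    -- lower than `b`.
    have hcov := hch.cov hbot1 hbT (by rw [hP0]; exact z1) (hfin b hbT)
    obtain ⟨c, ⟨i, hi, rfl⟩, hc⟩ := hcov.2.2 mu
    have hi' : ¬ ((P i).2 : ℝ) ≤ mu * (P i).1 + β := by
      rcases eq_or_ne i k with rfl | hne
      · exact hnot
      · exact hG i (lt_of_le_of_ne hi hne)
    have : (b.2 : ℝ) ≤ z.2 := by exact_mod_cast hbz
    apply hi'
    simp only [hb] at hc this
    linarith
  · have hyes : ((P k).2 : ℝ) ≤ mu * (P k).1 + β := by
      simpa [f20, f21, r13, r15] using hb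
    have hx0 : x₀ ≤ (P k).1 := by
      have := hch.le (Nat.zero_le k) le_rfl
      rw [hP0] at this
      push_cast at this
      simp only [hp] at this
      omega
    refine Ends.mono ?_ (Nat.le_add_right _ _) (fun _ h => h)
    refine (Ends.of_exec (Q := fun s' => s' = s₂.set 22 1) (by rfl) (by simp [exec])).seq
      fun s₃ hs₃ => ?_
    have ag₃ : Agree 20 s s₃ := hs₃ ▸ ag₂.set (by norm_num) _
    have g20 : s₃.reg 20 = (P k).1 := by simp [hs₃, f20]
    have g21 : s₃.reg 21 = (P k).2 := by simp [hs₃, f21]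
    have g22 : s₃.reg 22 = 1 := by simp [hs₃]
    set p₂ : ℤ × ℤ := (-(P k).1, (P k).2) with hp₂
    have hx0' : (x₀ : ℝ) ≤ (P k).1 := by exact_mod_cast hx0
    have hPx1 : ((P k).1 : ℝ) ≤ x₁ := by exact_mod_cast hPk.1
    refine (hC₂ s₃ T₂ p₂ m (fun _ => True) ((T₂mem (P k)).2 ⟨hx0, hPk.2.1, hyes⟩)
      (by simp [hp₂, g20]) g21 g22 (fun s' q ag h20 h21 => ?_) (by
        simp only [hT₂, hp₂]; push_cast; linarith)).seq fun s₄ h => ?_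
    · obtain ⟨r12, r13, r14, r15, r16, r5⟩ := regs s' (ag₃.trans ag)
      constructor
      · simp [Wedge.shift, hT₂, r12, r13, r14, r15, r5, h20, h21]
        refine ⟨?_, ?_, ?_⟩ <;> ring
      · simp
    obtain ⟨ag₄, P', k', hch', hP0', i20, i21, -, hend'⟩ := h
    replace ag₄ := ag₃.trans ag₄
    replace hend' := hend'.resolve_left (by simp)
    obtain ⟨r12, r13, r14, r15, r16, r5⟩ := regs s₄ ag₄
    set a : ℤ := -(P' k').1 with ha
    have hT₂a : x₀ ≤ a ∧ lam * a + α ≤ ((P' k').2 : ℝ) ∧ ((P' k').2 : ℝ) ≤ mu * a + β := by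
      rw [← T₂mem (a, (P' k').2)]
      simpa [ha] using hch'.mem le_rfl
    have hax : a ≤ x₁ := by
      have := hch'.le (Nat.zero_le k') le_rfl
      rw [hP0'] at this
      push_cast at this
      have h2 := hPk.1
      simp only [hp₂] at this
      omega
    have j20 : s₄.reg 20 = a := by rw [i20]; simp [ha]
    obtain ⟨ag₅, j20', j21, j22⟩ := bottomProg_spec s₄
    refine (Ends.of_exec (Q := fun s' => s' = exec bottomProg s₄) (by rfl) rfl).seq
      fun s₅ hs₅ => ?_
    rw [← hs₅] at ag₅ j20' j21 j22
    rw [j20] at j20'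
    rw [r12, r14, j20] at j21
    replace ag₅ := ag₄.trans ag₅
    have ax0 : (x₀ : ℝ) ≤ a := by exact_mod_cast hT₂a.1
    have hpa : T.Mem ((a, ⌈lam * a + α⌉) : ℤ × ℤ).1 ((a, ⌈lam * a + α⌉) : ℤ × ℤ).2 := by
      refine (Tmem _).2 ⟨hax, (bot a).1, ?_⟩
      have h1 : ((⌈lam * a + α⌉ : ℤ) : ℝ) ≤ (P' k').2 := by
        exact_mod_cast (bot a).2.2 _ hT₂a.2.1
      exact h1.trans hT₂a.2.2
    obtain ⟨q12, q13, q14, q15, q16, q5⟩ := regs s₅ ag₅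
    refine (hC₃ s₅ T (a, ⌈lam * a + α⌉) m N E hpa j20' j21 j22 ((ag₅.2 18 (by norm_num)).trans hN)
      (fun i hi => by rw [ag₅.1]; exact hE i hi) (by rw [q12, q13, q14, q15, q16]) (by
        simp only [hT]; linarith)).mono le_rfl ?_
    rintro s₆ ⟨ag₆, Q, n, hQ, hQ0, hQend, hn, hN', hseq⟩
    have hQa : ∀ i ≤ n, a ≤ (Q i).1 := by
      intro i hi
      have := hQ.le (Nat.zero_le i) hi
      rw [hQ0] at this
      push_cast at this
      omega
    refine ⟨(ag₅.toE (by norm_num)).trans ag₆, N + n + 1, _, by omega, by omega, hN', hseq,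
      fun i hi => if_pos hi, fun i h1 h2 => ?_, fun i h1 h2 => ?_, fun z hz => ?_⟩
    · rw [if_neg (by omega)]
      obtain ⟨t1, t2, t3⟩ := (Tmem _).1 (hQ.mem (show i - N ≤ n by omega))
      exact ⟨hT₂a.1.trans (hQa _ (by omega)), t1, t2, t3⟩
    · rw [if_neg (by omega), if_neg (by omega), show i + 1 - N = i - N + 1 by omega]
      exact (hQ.succ (i - N) (by omega)).lt
    · obtain ⟨z1, z2, z3, z4⟩ := hz
      have hzT : T.Mem z.1 z.2 := (Tmem z).2 ⟨z2, z3, z4⟩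
      -- The second walk stopped for lack of any point farther left, so no point of the slab
      -- precedes column `a`.
      have hza : a ≤ z.1 := by
        have := hend' (-z.1, z.2) ((T₂mem z).2 ⟨z1, z3, z4⟩)
        simp only at this
        omega
      have hbot : ∀ z : ℤ × ℤ, T.Mem z.1 z.2 → z.1 = (Q 0).1 → (Q 0).2 ≤ z.2 := by
        intro z hz hz0
        rw [hQ0] at hz0 ⊢
        have := ((Tmem z).1 hz).2.1
        rw [hz0] at this
        exact (bot a).2.2 _ this
      refine (hQ.cov hbot hzT (by rw [hQ0]; exact hza) (hQend z hzT)).mono ?_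
      rintro _ ⟨i, hi, rfl⟩
      simp only [Set.mem_Iic] at hi
      refine ⟨N + i, ⟨by omega, by omega⟩, ?_⟩
      simp

end DiscreteHull

namespace DiscreteHull

open DiscreteHull.Expr (var)

/-! ### The sweep over the polygon -/

/-- The point of the plane with the given integer coordinates. -/
def pt (z : ℤ × ℤ) : Plane := !₂[(z.1 : ℝ), (z.2 : ℝ)]

@[simp] theorem pt_zero (z : ℤ × ℤ) : pt z 0 = z.1 := by simp [pt]
@[simp] theorem pt_one (z : ℤ × ℤ) : pt z 1 = z.2 := by simp [pt]

/-- `w` runs through the vertices of the convex polygon `K` in counterclockwise order, beginning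
with a leftmost one. -/
structure Cyclic (K : Set Plane) (n : ℕ) (w : ℕ → Plane) : Prop where
  convex : Convex ℝ K
  mem : ∀ t, w t ∈ K
  left : ∀ z ∈ K, ∀ t, 0 ≤ orient (w t) (w (t + 1)) z
  first : ∀ z ∈ K, w 0 0 ≤ z 0
  last : ∀ z ∈ K, ∃ t ≤ n, z 0 ≤ w t 0
  nondeg : ∃ t ≤ n, w 0 0 < w t 0

theorem plane_ext {a b : Plane} (h0 : a 0 = b 0) (h1 : a 1 = b 1) : a = b := by
  ext i
  fin_cases i
  · exact h0
  · exact h1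

theorem mem_of_line {K : Set Plane} (hK : Convex ℝ K) {a b : Plane} (ha : a ∈ K) (hb : b ∈ K)
    {x : ℝ} (hab : a 0 < b 0) (hax : a 0 ≤ x) (hxb : x ≤ b 0) :
    !₂[x, (b 1 - a 1) / (b 0 - a 0) * x + (a 1 - (b 1 - a 1) / (b 0 - a 0) * a 0)] ∈ K := by
  have h : 0 < b 0 - a 0 := sub_pos.2 hab
  have := hK ha hb (a := (b 0 - x) / (b 0 - a 0)) (b := (x - a 0) / (b 0 - a 0))
    (div_nonneg (by linarith) h.le) (div_nonneg (by linarith) h.le) (by field_simp; ring)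
  convert this using 1
  refine plane_ext ?_ ?_
  · simp
    field_simp
    ring
  · simp
    field_simp
    ring

theorem mem_of_vertical {K : Set Plane} (hK : Convex ℝ K) {x y₁ y₂ y : ℝ} (h₁ : !₂[x, y₁] ∈ K)
    (h₂ : !₂[x, y₂] ∈ K) (hy₁ : y₁ ≤ y) (hy₂ : y ≤ y₂) : !₂[x, y] ∈ K := by
  rcases (hy₁.trans hy₂).eq_or_lt with h | h
  · rwa [← le_antisymm hy₁ (h ▸ hy₂)]
  · have h : 0 < y₂ - y₁ := sub_pos.2 h
    have := hK h₁ h₂ (a := (y₂ - y) / (y₂ - y₁)) (b := (y - y₁) / (y₂ - y₁))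
      (div_nonneg (by linarith) h.le) (div_nonneg (by linarith) h.le) (by field_simp; ring)
    convert this using 1
    refine plane_ext ?_ ?_
    · simp
      field_simp
      ring
    · simp
      field_simp
      ring

theorem succ_mod (a n : ℕ) (hn : 0 < n) :
    (a + 1) % n = if a % n + 1 < n then a % n + 1 else 0 := by
  have h1 := Nat.div_add_mod a n
  have h2 := Nat.mod_lt a hn
  split_ifs with h
  · conv_lhs => rw [← h1, add_assoc, Nat.mul_add_mod, Nat.mod_eq_of_lt h]
  · have h3 : a % n + 1 = n := by omega
    conv_lhs => rw [← h1, add_assoc, h3, Nat.mul_add_mod, Nat.mod_self]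

/-- The transformed x-coordinate of the input point whose index is in register `i`. -/
def px (i : ℕ) : Expr := var 1 * .load 0 (var i)

/-- The transformed y-coordinate of the input point whose index is in register `i`. -/
def py (i : ℕ) : Expr := var 1 * .load 1 (var i)

/-- Move to the neighbouring indices. -/
def neighboursProg : Program :=
  .branch (var 0 ≼ var 2 + 1) (7 ≔ 0) (7 ≔ var 2 + 1) ;;
  .branch (1 ≼ var 3) (8 ≔ var 3 - 1) (8 ≔ var 0 - 1) ;;
  .branch (px 7 ≼ px 8) (9 ≔ px 7) (9 ≔ px 8)

/-- Compute the two lines that bound the polygon in the current slab. -/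
def linesProg : Program :=
  12 ≔ (py 7 - py 2) / (px 7 - px 2) ;;
  14 ≔ py 2 - var 12 * px 2 ;;
  13 ≔ (py 8 - py 3) / (px 8 - px 3) ;;
  15 ≔ py 3 - var 13 * px 3

/-- Advance one of the two indices. -/
def advanceProg : Program :=
  .branch (px 7 ≼ px 8) (2 ≔ var 7) (3 ≔ var 8) ;;
  6 ≔ var 6 + 1

/-- One step of the sweep. -/
def sweepBody : Program :=
  neighboursProg ;;
  .branch (var 9 ≼ var 4) .skip
    (16 ≔ (var 9).floor ;;
      .branch (var 5 ≼ var 16) (linesProg ;; slabProg ;; 5 ≔ var 16 + 1) .skip ;;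
      4 ≔ var 9) ;;
  advanceProg

/-- The input, transformed, as seen by the sweep. -/
structure Reads (s : Memory) (n : ℕ) (u : ℕ → Plane) : Prop where
  r0 : s.reg 0 = n
  x : ∀ i < n, s.reg 1 * s.arr 0 i = u i 0
  y : ∀ i < n, s.reg 1 * s.arr 1 i = u i 1

/-- Registers `0, 1, 10, 11` and all arrays but `2, 3` are unchanged. -/
structure Frame (s s' : Memory) : Prop where
  arr : ∀ a, a ≠ 2 → a ≠ 3 → s'.arr a = s.arr a
  r0 : s'.reg 0 = s.reg 0
  r1 : s'.reg 1 = s.reg 1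
  r10 : s'.reg 10 = s.reg 10
  r11 : s'.reg 11 = s.reg 11

theorem Frame.trans {s s' s'' : Memory} (h : Frame s s') (h' : Frame s' s'') : Frame s s'' :=
  ⟨fun a h2 h3 => (h'.arr a h2 h3).trans (h.arr a h2 h3), h'.r0.trans h.r0, h'.r1.trans h.r1,
    h'.r10.trans h.r10, h'.r11.trans h.r11⟩

theorem AgreeE.frame {m : ℕ} {s s' : Memory} (h : AgreeE m s s') (hm : 12 ≤ m) : Frame s s' :=
  ⟨h.1, h.2 0 (by omega), h.2 1 (by omega), h.2 10 (by omega), h.2 11 (by omega)⟩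

theorem Reads.frame {s s' : Memory} {n : ℕ} {u : ℕ → Plane} (h : Reads s n u) (hf : Frame s s') :
    Reads s' n u :=
  ⟨hf.r0.trans h.r0, fun i hi => by rw [hf.r1, hf.arr 0 (by norm_num) (by norm_num), h.x i hi],
    fun i hi => by rw [hf.r1, hf.arr 1 (by norm_num) (by norm_num), h.y i hi]⟩

theorem Reads.px {s : Memory} {n : ℕ} {u : ℕ → Plane} (h : Reads s n u) {r i : ℕ} (hi : i < n)
    (hr : s.reg r = i) : (DiscreteHull.px r).eval s = u i 0 := by
  simp [DiscreteHull.px, hr, h.x i hi]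

theorem neighboursProg_spec {s : Memory} {n : ℕ} {u : ℕ → Plane} (h : Reads s n u) {i j : ℕ}
    (hn : 0 < n) (h2 : s.reg 2 = (i % n : ℕ)) (h3 : s.reg 3 = ((j + 1) % n : ℕ)) :
    (exec neighboursProg s).arr = s.arr ∧
    (∀ r, r ≠ 7 → r ≠ 8 → r ≠ 9 → (exec neighboursProg s).reg r = s.reg r) ∧
    (exec neighboursProg s).reg 7 = ((i + 1) % n : ℕ) ∧
    (exec neighboursProg s).reg 8 = (j % n : ℕ) ∧
    (exec neighboursProg s).reg 9 = min (u ((i + 1) % n) 0) (u (j % n) 0) := by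
  simp only [neighboursProg, exec_seq]
  have key7 : exec (.branch (var 0 ≼ var 2 + 1) (7 ≔ 0) (7 ≔ var 2 + 1)) s =
      s.set 7 ((i + 1) % n : ℕ) := by
    rw [succ_mod i n hn]
    by_cases hlt : i % n + 1 < n
    · rw [exec_branch_neg]
      · rw [if_pos hlt]; simp [exec, h2]
      · simp only [holds_le, eval_var, eval_add, eval_ofNat, h.r0, h2]
        exact_mod_cast not_le.2 hlt
    · rw [exec_branch_pos]
      · rw [if_neg hlt]; simp [exec]
      · simp only [holds_le, eval_var, eval_add, eval_ofNat, h.r0, h2]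
        exact_mod_cast not_lt.1 hlt
  rw [key7]
  set s₁ := s.set 7 ((i + 1) % n : ℕ) with hs₁
  have hjn := Nat.mod_lt j hn
  have hin := Nat.mod_lt (i + 1) hn
  have key8 : exec (.branch (1 ≼ var 3) (8 ≔ var 3 - 1) (8 ≔ var 0 - 1)) s₁ =
      s₁.set 8 (j % n : ℕ) := by
    have hr3 : s₁.reg 3 = ((j + 1) % n : ℕ) := by simp [hs₁, h3]
    have hr0 : s₁.reg 0 = n := by simp [hs₁, h.r0]
    rw [succ_mod j n hn] at hr3
    by_cases hlt : j % n + 1 < n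
    · rw [if_pos hlt] at hr3
      rw [exec_branch_pos]
      · simp [exec, hr3]
      · simp [hr3]
    · rw [if_neg hlt] at hr3
      have : j % n + 1 = n := by omega
      rw [exec_branch_neg]
      · simp only [exec, eval_sub, eval_var, eval_ofNat, hr0]
        congr 1
        rw [show (n : ℝ) = (j % n : ℕ) + 1 by exact_mod_cast this.symm]
        simp
      · simp only [holds_le, eval_var, eval_ofNat, hr3]
        norm_num
  rw [key8]
  set s₂ := s₁.set 8 (j % n : ℕ) with hs₂
  have f : Frame s s₂ := ⟨fun _ _ _ => rfl, by simp [hs₂, hs₁], by simp [hs₂, hs₁],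
    by simp [hs₂, hs₁], by simp [hs₂, hs₁]⟩
  have hR := h.frame f
  have e7 := hR.px hin (r := 7) (by simp [hs₂, hs₁])
  have e8 := hR.px hjn (r := 8) (by simp [hs₂])
  have key9 : exec (.branch (px 7 ≼ px 8) (9 ≔ px 7) (9 ≔ px 8)) s₂ =
      s₂.set 9 (min (u ((i + 1) % n) 0) (u (j % n) 0)) := by
    by_cases hle : u ((i + 1) % n) 0 ≤ u (j % n) 0
    · rw [exec_branch_pos _ (by rw [holds_le, e7, e8]; exact hle), exec_assign, e7, min_eq_left hle]
    · rw [exec_branch_neg _ (by rw [holds_le, e7, e8]; exact hle), exec_assign, e8,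
        min_eq_right (not_le.1 hle).le]
  rw [key9]
  refine ⟨rfl, fun r h7 h8 h9 => by simp [hs₂, hs₁, h7, h8, h9], by simp [hs₂, hs₁],
    by simp [hs₂], by simp⟩

theorem linesProg_spec {s : Memory} {n : ℕ} {u : ℕ → Plane} (h : Reads s n u) {i j i' j' : ℕ}
    (hi : i < n) (hj : j < n) (hi' : i' < n) (hj' : j' < n)
    (h2 : s.reg 2 = i) (h3 : s.reg 3 = j) (h7 : s.reg 7 = i') (h8 : s.reg 8 = j') :
    (exec linesProg s).arr = s.arr ∧
    (∀ r, r ≠ 12 → r ≠ 13 → r ≠ 14 → r ≠ 15 → (exec linesProg s).reg r = s.reg r) ∧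
    (exec linesProg s).reg 12 = (u i' 1 - u i 1) / (u i' 0 - u i 0) ∧
    (exec linesProg s).reg 14 = u i 1 - (u i' 1 - u i 1) / (u i' 0 - u i 0) * u i 0 ∧
    (exec linesProg s).reg 13 = (u j' 1 - u j 1) / (u j' 0 - u j 0) ∧
    (exec linesProg s).reg 15 = u j 1 - (u j' 1 - u j 1) / (u j' 0 - u j 0) * u j 0 := by
  simp only [linesProg, exec_seq, exec_assign]
  refine ⟨rfl, fun r a b c d => by simp [a, b, c, d], ?_, ?_, ?_, ?_⟩ <;>
  simp [DiscreteHull.px, DiscreteHull.py, h2, h3, h7, h8, h.x i hi, h.x j hj, h.x i' hi',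
    h.x j' hj', h.y i hi, h.y j hj, h.y i' hi', h.y j' hj']

/-- The state of the sweep after `p` steps on the lower chain and `q` steps on the upper chain. -/
structure SweepState (K : Set Plane) (n : ℕ) (w : ℕ → Plane) (c p q N : ℕ) (X : ℝ) (XI : ℤ)
    (E : ℕ → ℤ × ℤ) : Prop where
  X_ge : ∀ t ≤ n, t ≤ p ∨ n ≤ t + q → w t 0 ≤ X
  X_le : X ≤ XI
  X_lt : w 0 0 < X → X < XI
  num : N ≤ c
  mem : ∀ i < N, pt (E i) ∈ K ∧ (E i).1 < XI
  mono : ∀ i, i + 1 < N → (E i).1 < (E (i + 1)).1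
  cov : ∀ z, pt z ∈ K → z.1 < XI → Cov (E '' Set.Iio N) z

/-- Both edges span all abscissae from `X` to `b`. They lie in `K`, so by convexity everything
vertically between them does; conversely, `K` lies to the left of each directed edge. Monotonicity
of the two boundary chains is not needed. -/
theorem Cyclic.inSlab_iff {K : Set Plane} {n : ℕ} {w : ℕ → Plane} (hK : Cyclic K n w) {p j : ℕ}
    {X b : ℝ} {XI : ℤ} (hp : w p 0 ≤ X) (hj : w (j + 1) 0 ≤ X) (hX : X ≤ XI) (hXb : X < b)
    (hp' : b ≤ w (p + 1) 0) (hj' : b ≤ w j 0) (z : ℤ × ℤ) :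
    InSlab XI ⌊b⌋ ((w (p + 1) 1 - w p 1) / (w (p + 1) 0 - w p 0))
      ((w j 1 - w (j + 1) 1) / (w j 0 - w (j + 1) 0))
      (w p 1 - (w (p + 1) 1 - w p 1) / (w (p + 1) 0 - w p 0) * w p 0)
      (w (j + 1) 1 - (w j 1 - w (j + 1) 1) / (w j 0 - w (j + 1) 0) * w (j + 1) 0) z ↔
    XI ≤ z.1 ∧ z.1 ≤ ⌊b⌋ ∧ pt z ∈ K := by
  have d1 : 0 < w (p + 1) 0 - w p 0 := by linarith
  have d2 : 0 < w j 0 - w (j + 1) 0 := by linarith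
  unfold InSlab
  refine and_congr_right fun h1 => and_congr_right fun h2 => ?_
  have h1' : (XI : ℝ) ≤ z.1 := by exact_mod_cast h1
  have h2' : (z.1 : ℝ) ≤ b := Int.le_floor.1 h2
  constructor
  · rintro ⟨h3, h4⟩
    exact mem_of_vertical hK.convex
      (mem_of_line hK.convex (hK.mem p) (hK.mem (p + 1)) (by linarith) (by linarith)
        (by linarith))
      (mem_of_line hK.convex (hK.mem (j + 1)) (hK.mem j) (by linarith) (by linarith)
        (by linarith)) h3 h4
  · intro hz
    have o1 := hK.left _ hz p
    have o2 := hK.left _ hz j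
    simp only [orient, pt_zero, pt_one] at o1 o2
    constructor
    · have e : (z.2 : ℝ) - ((w (p + 1) 1 - w p 1) / (w (p + 1) 0 - w p 0) * z.1 +
          (w p 1 - (w (p + 1) 1 - w p 1) / (w (p + 1) 0 - w p 0) * w p 0)) =
          ((w (p + 1) 0 - w p 0) * (z.2 - w p 1) - (w (p + 1) 1 - w p 1) * (z.1 - w p 0)) /
            (w (p + 1) 0 - w p 0) := by
        field_simp
        ring
      have := div_nonneg o1 d1.le
      linarith
    · have e : ((w j 1 - w (j + 1) 1) / (w j 0 - w (j + 1) 0) * z.1 +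
          (w (j + 1) 1 - (w j 1 - w (j + 1) 1) / (w j 0 - w (j + 1) 0) * w (j + 1) 0)) - z.2 =
          ((w (j + 1) 0 - w j 0) * (z.2 - w j 1) - (w (j + 1) 1 - w j 1) * (z.1 - w j 0)) /
            (w j 0 - w (j + 1) 0) := by
        field_simp
        ring
      have := div_nonneg o2 d2.le
      linarith

/-! ### Updates of the sweep invariant -/

namespace SweepState
variable {K : Set Plane} {n c p q N : ℕ} {w : ℕ → Plane} {X b : ℝ} {XI : ℤ} {E : ℕ → ℤ × ℤ}

theorem weaken (h : SweepState K n w c p q N X XI E) {c' : ℕ} (hc : c ≤ c') :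
    SweepState K n w c' p q N X XI E :=
  ⟨h.X_ge, h.X_le, h.X_lt, h.num.trans hc, h.mem, h.mono, h.cov⟩

theorem lower (h : SweepState K n w c p q N X XI E) (hw : w (p + 1) 0 ≤ X) :
    SweepState K n w c (p + 1) q N X XI E := by
  refine ⟨fun t ht h' => ?_, h.X_le, h.X_lt, h.num, h.mem, h.mono, h.cov⟩
  rcases h' with h' | h'
  · rcases Nat.le_succ_iff.1 h' with h1 | rfl
    · exact h.X_ge t ht (.inl h1)
    · exact hw
  · exact h.X_ge t ht (.inr h')

theorem upper (h : SweepState K n w c p q N X XI E) {j : ℕ} (hj : j + 1 + q = n)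
    (hw : w j 0 ≤ X) : SweepState K n w c p (q + 1) N X XI E := by
  refine ⟨fun t ht h' => ?_, h.X_le, h.X_lt, h.num, h.mem, h.mono, h.cov⟩
  rcases h' with h' | h'
  · exact h.X_ge t ht (.inl h')
  · rcases eq_or_ne t j with rfl | hne
    · exact hw
    · exact h.X_ge t ht (.inr (by omega))

/-- No unprocessed integer column lies at or before `b`, so the sweep line moves on without a new
candidate. -/
theorem raise (h : SweepState K n w c p q N X XI E) (hb : X < b) (hf : ⌊b⌋ < XI) :
    SweepState K n w c p q N b XI E := by
  have hlt : b < XI := Int.floor_lt.1 hf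
  exact ⟨fun t ht h' => (h.X_ge t ht h').trans hb.le, hlt.le, fun _ => hlt, h.num, h.mem, h.mono,
    h.cov⟩

/-- Old candidates lie before column `XI` and new ones from it on. Hence the abscissae stay strictly
increasing across the junction, and the two coverings can be joined. -/
theorem slab (h : SweepState K n w c p q N X XI E) {S : ℤ × ℤ → Prop} {N' d : ℕ}
    {E' : ℕ → ℤ × ℤ} (hb : X < b) (hf : XI ≤ ⌊b⌋)
    (hS : ∀ z, S z ↔ XI ≤ z.1 ∧ z.1 ≤ ⌊b⌋ ∧ pt z ∈ K) (hN : N ≤ N') (hN' : N' ≤ N + d)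
    (hE : ∀ i < N, E' i = E i) (hmem : ∀ i, N ≤ i → i < N' → S (E' i))
    (hmono : ∀ i, N ≤ i → i + 1 < N' → (E' i).1 < (E' (i + 1)).1)
    (hcov : ∀ z, S z → Cov (E' '' Set.Ico N N') z) :
    SweepState K n w (c + d) p q N' b (⌊b⌋ + 1) E' := by
  have hlt : b < (⌊b⌋ + 1 : ℤ) := by push_cast; exact Int.lt_floor_add_one b
  refine ⟨fun t ht h' => (h.X_ge t ht h').trans hb.le, hlt.le, fun _ => hlt,
    hN'.trans (Nat.add_le_add_right h.num d), fun i hi => ?_, fun i hi => ?_, fun z hz hzX => ?_⟩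
  · rcases lt_or_ge i N with h1 | h1
    · rw [hE i h1]
      have := h.mem i h1
      exact ⟨this.1, by omega⟩
    · have := (hS _).1 (hmem i h1 hi)
      exact ⟨this.2.2, by omega⟩
  · rcases lt_or_ge i N with h1 | h1
    · rcases lt_or_ge (i + 1) N with h2 | h2
      · rw [hE i h1, hE _ h2]
        exact h.mono i h2
      · have h3 := (h.mem i h1).2
        have h4 := ((hS _).1 (hmem (i + 1) h2 hi)).1
        rw [hE i h1]
        omega
    · exact hmono i h1 hi
  · rcases lt_or_ge z.1 XI with h1 | h1
    · refine (h.cov z hz h1).mono ?_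
      rintro _ ⟨i, hi, rfl⟩
      simp only [Set.mem_Iio] at hi
      exact ⟨i, by simp only [Set.mem_Iio]; omega, hE i hi⟩
    · exact (hcov z ((hS z).2 ⟨h1, by omega, hz⟩)).mono (Set.image_mono fun i hi => hi.2)

end SweepState

/-- The registers during the sweep. -/
structure SweepRegs (n : ℕ) (u : ℕ → Plane) (L p q N k : ℕ) (X : ℝ) (XI : ℤ) (E : ℕ → ℤ × ℤ)
    (s : Memory) : Prop where
  reads : Reads s n u
  r2 : s.reg 2 = ((L + p) % n : ℕ)
  r3 : s.reg 3 = ((L + (n - q)) % n : ℕ)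
  r4 : s.reg 4 = X
  r5 : s.reg 5 = XI
  r6 : s.reg 6 = k
  r18 : s.reg 18 = N
  seq : HoldsSeq s 2 3 N E

theorem advanceProg_spec {s : Memory} {n : ℕ} {u : ℕ → Plane} (h : Reads s n u) {i j : ℕ}
    (hi : i < n) (hj : j < n) (h7 : s.reg 7 = i) (h8 : s.reg 8 = j) :
    (u i 0 ≤ u j 0 ∧ exec advanceProg s = (s.set 2 i).set 6 (s.reg 6 + 1)) ∨
    (u j 0 ≤ u i 0 ∧ exec advanceProg s = (s.set 3 j).set 6 (s.reg 6 + 1)) := by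
  have e7 := h.px hi h7
  have e8 := h.px hj h8
  simp only [advanceProg, exec_seq]
  by_cases hle : u i 0 ≤ u j 0
  · rw [exec_branch_pos _ (by rw [holds_le, e7, e8]; exact hle)]
    exact .inl ⟨hle, by simp [exec, h7]⟩
  · rw [exec_branch_neg _ (by rw [holds_le, e7, e8]; exact hle)]
    exact .inr ⟨(not_le.1 hle).le, by simp [exec, h8]⟩

theorem HoldsSeq.congr {s s' : Memory} {a b N : ℕ} {E : ℕ → ℤ × ℤ} (h : HoldsSeq s a b N E)
    (ha : s'.arr = s.arr) : HoldsSeq s' a b N E := fun i hi => by rw [ha]; exact h i hi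

/-- If `b ≤ X`, as for a vertical edge or behind the rightmost vertex, only an index advances.
Otherwise both current edges lead from abscissae at most `X` to abscissae at least `b`, and the slab
between is processed. Advancing towards the vertex with the smaller abscissa keeps all visited
vertices behind the sweep line. -/
theorem sweepBody_spec : ∃ C : ℕ, ∀ (K : Set Plane) (n : ℕ) (u : ℕ → Plane) (L m : ℕ), 0 < n →
    Cyclic K n (fun t => u ((L + t) % n)) →
    (∀ a ∈ K, ∀ b ∈ K, a 0 - b 0 < 2 ^ m) →
    ∀ (s : Memory) (c p q N k : ℕ) (X : ℝ) (XI : ℤ) (E : ℕ → ℤ × ℤ), p + q = k → k < n →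
      SweepRegs n u L p q N k X XI E s →
      SweepState K n (fun t => u ((L + t) % n)) c p q N X XI E →
      Ends sweepBody s (C * (m + 1) ^ 2) (fun s' => Frame s s' ∧ ∃ (p' q' N' : ℕ) (X' : ℝ) (XI' : ℤ)
        (E' : ℕ → ℤ × ℤ), p' + q' = k + 1 ∧ SweepRegs n u L p' q' N' (k + 1) X' XI' E' s' ∧
        SweepState K n (fun t => u ((L + t) % n)) (c + (2 * m + 2)) p' q' N' X' XI' E') := by
  obtain ⟨C, hC⟩ := slabProg_spec
  refine ⟨timeBound neighboursProg + ((var 9 ≼ var 4).cost + 1 + (timeBound (16 ≔ (var 9).floor) +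
    ((var 5 ≼ var 16).cost + 1 + (timeBound linesProg + (C + timeBound (5 ≔ var 16 + 1)) +
    timeBound .skip) + timeBound (4 ≔ var 9)) + timeBound .skip) + timeBound advanceProg),
    fun K n u L m hn hK hwid s c p q N k X XI E hpq hkn hr hst => ?_⟩
  set w : ℕ → Plane := fun t => u ((L + t) % n) with hw
  -- The upper chain is traversed backwards from index `n`: its current vertex is `w (j + 1)` and
  -- the next one is `w j`.
  obtain ⟨j, hj⟩ : ∃ j, j + 1 + q = n := ⟨n - q - 1, by omega⟩
  have hnq : n - q = j + 1 := by omega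
  have hr3 := hr.r3
  rw [hnq] at hr3
  obtain ⟨na, nr, n7, n8, n9⟩ := neighboursProg_spec (i := L + p) (j := L + j) hr.reads hn hr.r2
    (by rw [hr3, add_assoc])
  unfold sweepBody
  refine Ends.mono (B := timeBound neighboursProg + ((var 9 ≼ var 4).cost + 1 +
    (timeBound (16 ≔ (var 9).floor) + ((var 5 ≼ var 16).cost + 1 + (timeBound linesProg +
    (C * (m + 1) ^ 2 + timeBound (5 ≔ var 16 + 1)) + timeBound .skip) + timeBound (4 ≔ var 9)) +
    timeBound .skip) + timeBound advanceProg)) ?_ ?_ (fun _ h => h)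
  swap
  · generalize timeBound neighboursProg = a₁
    generalize (var 9 ≼ var 4).cost = a₂
    generalize timeBound (16 ≔ (var 9).floor) = a₃
    generalize (var 5 ≼ var 16).cost = a₄
    generalize timeBound linesProg = a₅
    generalize timeBound (5 ≔ var 16 + 1) = a₆
    generalize timeBound .skip = a₇
    generalize timeBound (4 ≔ var 9) = a₈
    generalize timeBound advanceProg = a₉
    have h1 : 1 ≤ (m + 1) ^ 2 := Nat.one_le_pow _ _ (by omega)
    generalize (m + 1) ^ 2 = r at *
    have := Nat.le_mul_of_pos_right (a₁ + a₂ + a₃ + a₄ + a₅ + a₆ + a₇ + a₈ + a₉ + a₇ + 2) h1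
    nlinarith
  refine (Ends.of_exec (Q := fun s' => s' = exec neighboursProg s) (by rfl) rfl).seq
    fun s₁ hs₁ => ?_
  rw [← hs₁] at na nr n7 n8 n9
  clear hs₁
  have f₁ : Frame s s₁ := ⟨fun a _ _ => by rw [na], nr 0 (by norm_num) (by norm_num) (by norm_num),
    nr 1 (by norm_num) (by norm_num) (by norm_num),
    nr 10 (by norm_num) (by norm_num) (by norm_num),
    nr 11 (by norm_num) (by norm_num) (by norm_num)⟩
  have g2 := (nr 2 (by norm_num) (by norm_num) (by norm_num)).trans hr.r2
  have g3 := (nr 3 (by norm_num) (by norm_num) (by norm_num)).trans hr3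
  have g4 := (nr 4 (by norm_num) (by norm_num) (by norm_num)).trans hr.r4
  have g5 := (nr 5 (by norm_num) (by norm_num) (by norm_num)).trans hr.r5
  have g6 := (nr 6 (by norm_num) (by norm_num) (by norm_num)).trans hr.r6
  have g18 := (nr 18 (by norm_num) (by norm_num) (by norm_num)).trans hr.r18
  have gE := hr.seq.congr na
  have hp' := Nat.mod_lt (L + p + 1) hn
  have hj' := Nat.mod_lt (L + j) hn
  set b : ℝ := min (u ((L + p + 1) % n) 0) (u ((L + j) % n) 0) with hb
  have bp : b ≤ w (p + 1) 0 := min_le_left _ _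
  have bj : b ≤ w j 0 := min_le_right _ _
  have hpX : w p 0 ≤ X := hst.X_ge p (by omega) (.inl le_rfl)
  have hjX : w (j + 1) 0 ≤ X := hst.X_ge (j + 1) (by omega) (.inr (by omega))
  -- the slab
  have mid : Ends (.branch (var 9 ≼ var 4) .skip
      (16 ≔ (var 9).floor ;;
        .branch (var 5 ≼ var 16) (linesProg ;; slabProg ;; 5 ≔ var 16 + 1) .skip ;;
        4 ≔ var 9)) s₁ ((var 9 ≼ var 4).cost + 1 +
    (timeBound (16 ≔ (var 9).floor) + ((var 5 ≼ var 16).cost + 1 + (timeBound linesProg +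
    (C * (m + 1) ^ 2 + timeBound (5 ≔ var 16 + 1)) + timeBound .skip) + timeBound (4 ≔ var 9)) +
    timeBound .skip)) (fun s' => Frame s s' ∧
      (∀ r, r = 2 ∨ r = 3 ∨ r = 6 ∨ r = 7 ∨ r = 8 → s'.reg r = s₁.reg r) ∧
      ∃ (N' : ℕ) (X' : ℝ) (XI' : ℤ) (E' : ℕ → ℤ × ℤ), s'.reg 4 = X' ∧ s'.reg 5 = XI' ∧
        s'.reg 18 = N' ∧ HoldsSeq s' 2 3 N' E' ∧ b ≤ X' ∧
        SweepState K n w (c + (2 * m + 2)) p q N' X' XI' E') := by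
    refine Ends.branch (fun h => ?_) (fun h => ?_)
    · have hbX : b ≤ X := by simpa [n9, g4, hb] using h
      refine (Ends.of_exec (Q := fun s' => s' = s₁) (by rfl) rfl).mono (Nat.le_add_left _ _) ?_
      rintro s' rfl
      exact ⟨f₁, fun _ _ => rfl, N, X, XI, E, g4, g5, g18, gE, hbX, hst.weaken (by omega)⟩
    · have hXb : X < b := by simpa [n9, g4, hb] using h
      refine Ends.mono ?_ (Nat.le_add_right _ _) (fun _ h => h)
      refine (Ends.of_exec (Q := fun s' => s' = s₁.set 16 (⌊b⌋ : ℤ)) (by rfl)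
        (by rw [exec_assign, eval_floor, eval_var, n9])).seq fun s₂ hs₂ => ?_
      have f₂ : Frame s s₂ := f₁.trans
        ⟨fun _ _ _ => by rw [hs₂]; rfl, by simp [hs₂], by simp [hs₂], by simp [hs₂], by simp [hs₂]⟩
      have k16 : s₂.reg 16 = (⌊b⌋ : ℤ) := by simp [hs₂]
      have kr : ∀ r, r ≠ 16 → s₂.reg r = s₁.reg r := fun r hr => by simp [hs₂, hr]
      have kE : HoldsSeq s₂ 2 3 N E := gE.congr (by rw [hs₂]; rfl)
      refine Ends.seq (Q := fun s' => Frame s s' ∧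
        (∀ r, r = 2 ∨ r = 3 ∨ r = 6 ∨ r = 7 ∨ r = 8 ∨ r = 9 → s'.reg r = s₁.reg r) ∧
        ∃ (N' : ℕ) (XI' : ℤ) (E' : ℕ → ℤ × ℤ), s'.reg 5 = XI' ∧
          s'.reg 18 = N' ∧ HoldsSeq s' 2 3 N' E' ∧
          SweepState K n w (c + (2 * m + 2)) p q N' b XI' E') ?_ ?_
      · refine Ends.branch (fun h => ?_) (fun h => ?_)
        · have hXI : XI ≤ ⌊b⌋ := by
            rw [holds_le, eval_var, eval_var, k16, kr 5 (by norm_num), g5] at h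
            exact_mod_cast h
          refine Ends.mono ?_ (Nat.le_add_right _ _) (fun _ h => h)
          obtain ⟨la, lr, l12, l14, l13, l15⟩ := linesProg_spec (hr.reads.frame f₂)
            (Nat.mod_lt (L + p) hn) (Nat.mod_lt (L + (j + 1)) hn) hp' hj'
            ((kr 2 (by norm_num)).trans g2) ((kr 3 (by norm_num)).trans g3)
            ((kr 7 (by norm_num)).trans n7) ((kr 8 (by norm_num)).trans n8)
          refine (Ends.of_exec (Q := fun s' => s' = exec linesProg s₂) (by rfl) rfl).seq
            fun s₃ hs₃ => ?_
          rw [← hs₃] at la lr l12 l13 l14 l15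
          have f₃ : Frame s s₃ := f₂.trans ⟨fun _ _ _ => by rw [la],
            lr 0 (by norm_num) (by norm_num) (by norm_num) (by norm_num),
            lr 1 (by norm_num) (by norm_num) (by norm_num) (by norm_num),
            lr 10 (by norm_num) (by norm_num) (by norm_num) (by norm_num),
            lr 11 (by norm_num) (by norm_num) (by norm_num) (by norm_num)⟩
          have o5 : s₃.reg 5 = XI := by
            rw [lr 5 (by norm_num) (by norm_num) (by norm_num) (by norm_num), kr 5 (by norm_num), g5]
          have o16 : s₃.reg 16 = (⌊b⌋ : ℤ) := by
            rw [lr 16 (by norm_num) (by norm_num) (by norm_num) (by norm_num), k16]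
          have o18 : s₃.reg 18 = N := by
            rw [lr 18 (by norm_num) (by norm_num) (by norm_num) (by norm_num), kr 18 (by norm_num),
              g18]
          have hw' : (⌊b⌋ : ℤ) - XI < 2 ^ m := by
            have h1 : (⌊b⌋ : ℝ) ≤ b := Int.floor_le b
            have h2 := hwid _ (hK.mem (p + 1)) _ (hK.mem p)
            have h3 := hst.X_le
            have h4 : ((⌊b⌋ - XI : ℤ) : ℝ) < 2 ^ m := by push_cast; linarith
            exact_mod_cast h4
          refine (hC s₃ XI ⌊b⌋ m N E o5 o16 hXI hw' o18 (kE.congr la)).seq fun s₄ h => ?_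
          obtain ⟨ag, N', E', hN, hN', o18', hE', hEE, hmem, hmono, hcov⟩ := h
          rw [l12, l13, l14, l15] at hmem hcov
          refine .of_exec (by rfl) ?_
          rw [exec_assign]
          refine ⟨f₃.trans ((ag.frame (by norm_num)).trans
            ⟨fun _ _ _ => rfl, by simp, by simp, by simp, by simp⟩), fun r hr => ?_, N', ⌊b⌋ + 1,
            E', ?_, by simpa using o18', hE', hst.slab hXb hXI
              (hK.inSlab_iff hpX hjX hst.X_le hXb bp bj) hN hN' hEE hmem hmono hcov⟩
          · have hr' : r < 18 ∧ r ≠ 12 ∧ r ≠ 13 ∧ r ≠ 14 ∧ r ≠ 15 ∧ r ≠ 16 ∧ r ≠ 5 := by omega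
            obtain ⟨a1, a2, a3, a4, a5, a6, a7⟩ := hr'
            rw [Memory.set_reg, if_neg a7, ag.2 r a1, lr r a2 a3 a4 a5, kr r a6]
          · simp [ag.2 16, o16]
        · have hXI : ⌊b⌋ < XI := by
            rw [holds_le, eval_var, eval_var, k16, kr 5 (by norm_num), g5] at h
            exact_mod_cast not_le.1 h
          refine (Ends.of_exec (Q := fun s' => s' = s₂) (by rfl) rfl).mono
            (Nat.le_add_left _ _) ?_
          rintro s' rfl
          refine ⟨f₂, fun r hr => kr r (by omega), N, XI, E, (kr 5 (by norm_num)).trans g5,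
            (kr 18 (by norm_num)).trans g18, kE, (hst.raise hXb hXI).weaken (by omega)⟩
      · rintro s₃ ⟨f₃, hreg, N', XI', E', h5, h18, hE, hS⟩
        refine .of_exec (by rfl) ?_
        rw [exec_assign]
        refine ⟨f₃.trans ⟨fun _ _ _ => rfl, by simp, by simp, by simp, by simp⟩,
          fun r hr => ?_, N', b, XI', E', ?_, by simpa using h5, by simpa using h18, hE, le_rfl, hS⟩
        · have hr' : r ≠ 4 := by omega
          rw [Memory.set_reg, if_neg hr']
          exact hreg r (by omega)
        · simp [hreg 9, n9, hb]
  refine mid.seq fun s₂ h => ?_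
  obtain ⟨f₂, hreg, N', X', XI', E', h4, h5, h18, hE, hbX, hS⟩ := h
  have hR := hr.reads.frame f₂
  refine .of_exec (by rfl) ?_
  have g7 := (hreg 7 (by omega)).trans n7
  have g8 := (hreg 8 (by omega)).trans n8
  have g2' := (hreg 2 (by omega)).trans g2
  have g3' := (hreg 3 (by omega)).trans g3
  have g6' := (hreg 6 (by omega)).trans g6
  rcases advanceProg_spec hR hp' hj' g7 g8 with ⟨hle, he⟩ | ⟨hle, he⟩
  · have f₃ : Frame s₂ (exec advanceProg s₂) := by
      rw [he]
      exact ⟨fun _ _ _ => rfl, by simp, by simp, by simp, by simp⟩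
    refine ⟨f₂.trans f₃, p + 1, q, N', X', XI', E', by omega, ⟨hR.frame f₃, ?_, ?_, ?_, ?_, ?_, ?_,
      hE.congr (by rw [he]; rfl)⟩, hS.lower ?_⟩
    · simp [he, add_assoc]
    · simp [he, g3', hnq]
    · simp [he, h4]
    · simp [he, h5]
    · simp [he, g6']
    · simp [he, h18]
    · exact (le_of_eq (min_eq_left hle).symm).trans hbX
  · have f₃ : Frame s₂ (exec advanceProg s₂) := by
      rw [he]
      exact ⟨fun _ _ _ => rfl, by simp, by simp, by simp, by simp⟩
    refine ⟨f₂.trans f₃, p, q + 1, N', X', XI', E', by omega, ⟨hR.frame f₃, ?_, ?_, ?_, ?_, ?_, ?_,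
      hE.congr (by rw [he]; rfl)⟩, hS.upper hj ?_⟩
    · simp [he, g2']
    · simp [he, show n - (q + 1) = j by omega]
    · simp [he, h4]
    · simp [he, h5]
    · simp [he, g6']
    · simp [he, h18]
    · exact (le_of_eq (min_eq_right hle).symm).trans hbX

end DiscreteHull

namespace DiscreteHull

open DiscreteHull.Expr (var)

/-! ### All candidates for the lower hull -/

/-- Compare the current input point with the leftmost one so far. -/
def leftBody : Program :=
  .branch (px 2 ≼ px 6) .skip (2 ≔ var 6) ;;
  6 ≔ var 6 + 1

/-- Find a leftmost input point. -/
def leftProg : Program :=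
  2 ≔ 0 ;; 6 ≔ 1 ;; .loop (var 0 ≼ var 6).not leftBody

/-- Prepare the sweep. -/
def sweepInit : Program :=
  3 ≔ var 2 ;; 4 ≔ px 2 ;; 5 ≔ (var 4).ceil ;; 6 ≔ 0 ;; 18 ≔ 0

/-- The whole sweep. -/
def sweepProg : Program :=
  leftProg ;; sweepInit ;; .loop (var 0 ≼ var 6).not sweepBody

theorem leftBody_spec {s : Memory} {n : ℕ} {u : ℕ → Plane} (h : Reads s n u) {l i : ℕ}
    (hl : l < n) (hi : i < n) (h2 : s.reg 2 = l) (h6 : s.reg 6 = i) :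
    ∃ l' < n, u l' 0 ≤ u l 0 ∧ u l' 0 ≤ u i 0 ∧
      exec leftBody s = (s.set 2 l').set 6 ((i + 1 : ℕ) : ℝ) := by
  simp only [leftBody, exec_seq]
  by_cases hle : u l 0 ≤ u i 0
  · refine ⟨l, hl, le_rfl, hle, ?_⟩
    rw [exec_branch_pos _ (by rw [holds_le, h.px hl h2, h.px hi h6]; exact hle), exec_skip,
      exec_assign]
    have : s.set 2 l = s := by
      simp only [Memory.set, ← h2, Function.update_eq_self]
    rw [this]
    simp [h6]
  · refine ⟨i, hi, (not_le.1 hle).le, le_rfl, ?_⟩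
    rw [exec_branch_neg _ (by rw [holds_le, h.px hl h2, h.px hi h6]; exact hle), exec_assign,
      exec_assign]
    simp [h6]

theorem loop_bound {n r a C : ℕ} (hn : 1 ≤ n) (hr : 1 ≤ r) :
    (n + 1) * (a + C * r) ≤ 2 * (a + C) * (n * r) := by
  calc (n + 1) * (a + C * r) ≤ (n + n) * (a * r + C * r) :=
        Nat.mul_le_mul (by omega) (Nat.add_le_add_right (Nat.le_mul_of_pos_right _ hr) _)
    _ = 2 * (a + C) * (n * r) := by ring

theorem leftProg_spec : ∃ C : ℕ, ∀ (s : Memory) (n : ℕ) (u : ℕ → Plane), 1 ≤ n → Reads s n u →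
    Ends leftProg s (C * n) (fun s' => Frame s s' ∧
      ∃ L < n, s'.reg 2 = L ∧ ∀ i < n, u L 0 ≤ u i 0) := by
  refine ⟨timeBound (2 ≔ 0) + timeBound (6 ≔ 1) +
    2 * ((var 0 ≼ var 6).not.cost + 1 + timeBound leftBody + 0), fun s n u hn hs => ?_⟩
  unfold leftProg
  refine Ends.mono (B := timeBound (2 ≔ 0) + (timeBound (6 ≔ 1) +
    (n + 1) * ((var 0 ≼ var 6).not.cost + 1 + timeBound leftBody))) ?_ ?_ (fun _ h => h)
  swap
  · generalize timeBound (2 ≔ 0) = a₁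
    generalize timeBound (6 ≔ 1) = a₂
    generalize (var 0 ≼ var 6).not.cost + 1 + timeBound leftBody = a₃
    have := Nat.le_mul_of_pos_right (a₁ + a₂) hn
    have := loop_bound (a := a₃) (C := 0) hn le_rfl
    nlinarith
  refine (Ends.of_exec (Q := fun s' => s' = s.set 2 0) (by rfl) (by simp [exec])).seq
    fun s₁ hs₁ => ?_
  refine (Ends.of_exec (Q := fun s' => s' = s₁.set 6 1) (by rfl) (by simp [exec])).seq
    fun s₂ hs₂ => ?_
  refine (Ends.loop (K := n) (C := timeBound leftBody) (fun k s' => Frame s s' ∧ k + 1 ≤ n ∧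
    s'.reg 6 = (k + 1 : ℕ) ∧ ∃ L < n, s'.reg 2 = L ∧ ∀ i < k + 1, u L 0 ≤ u i 0) ?_ ?_).mono
    le_rfl ?_
  · subst hs₂ hs₁
    refine ⟨⟨fun _ _ _ => rfl, by simp, by simp, by simp, by simp⟩, hn, by simp, 0, by omega,
      by simp, fun i hi => ?_⟩
    rw [Nat.lt_one_iff.1 hi]
  · rintro k s' ⟨f, hk, h6, L, hL, h2, hmin⟩ hb
    have hlt : k + 1 < n := by
      simp only [holds_not, holds_le, eval_var, f.r0, hs.r0, h6, not_le] at hb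
      exact_mod_cast hb
    obtain ⟨l', hl', h1, h2', he⟩ := leftBody_spec (hs.frame f) hL hlt h2 h6
    refine ⟨by omega, .of_exec (by rfl) ⟨f.trans ?_, hlt, ?_, l', hl', ?_, fun i hi => ?_⟩⟩
    · rw [he]
      exact ⟨fun _ _ _ => rfl, by simp, by simp, by simp, by simp⟩
    · simp [he]
    · simp [he]
    · rcases Nat.lt_succ_iff_lt_or_eq.1 hi with h | rfl
      · exact h1.trans (hmin i h)
      · exact h2'
  · rintro s' ⟨k, ⟨f, hk, h6, L, hL, h2, hmin⟩, hb⟩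
    refine ⟨f, L, hL, h2, fun i hi => hmin i ?_⟩
    simp only [holds_not, holds_le, eval_var, f.r0, hs.r0, h6, not_not] at hb
    have : n ≤ k + 1 := by exact_mod_cast hb
    omega

/-- The points `E 0, …, E (N - 1)` lie in `K`, are ordered by their x-coordinates, and dominate all
lattice points of `K` from below. -/
structure Candidates (K : Set Plane) (N : ℕ) (E : ℕ → ℤ × ℤ) : Prop where
  mem : ∀ i < N, pt (E i) ∈ K
  mono : ∀ i, i + 1 < N → (E i).1 < (E (i + 1)).1
  cov : ∀ z, pt z ∈ K → Cov (E '' Set.Iio N) z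

theorem SweepState.init {K : Set Plane} {n : ℕ} {w : ℕ → Plane} (hK : Cyclic K n w)
    (hw : w n 0 = w 0 0) (E : ℕ → ℤ × ℤ) :
    SweepState K n w 0 0 0 0 (w 0 0) ⌈w 0 0⌉ E := by
  refine ⟨fun t ht h => ?_, Int.le_ceil _, fun h => absurd h (lt_irrefl _), le_rfl,
    fun i hi => absurd hi (Nat.not_lt_zero i), fun i hi => absurd hi (Nat.not_lt_zero _),
    fun z hz hlt => ?_⟩
  · rcases h with h | h
    · rw [Nat.le_zero.1 h]
    · rw [show t = n by omega, hw]
  · have := hK.first _ hz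
    rw [pt_zero, ← Int.ceil_le] at this
    omega

/-- After `n` steps every index is visited from one side or the other, so `X` bounds all abscissae
of `K`. Nondegeneracy gives `w 0 0 < X`, whence `X < XI` and no column is left. -/
theorem SweepState.finish {K : Set Plane} {n c p q N : ℕ} {w : ℕ → Plane} {X : ℝ} {XI : ℤ}
    {E : ℕ → ℤ × ℤ} (hK : Cyclic K n w) (h : SweepState K n w c p q N X XI E) (hpq : p + q = n) :
    Candidates K N E := by
  have hX : ∀ t ≤ n, w t 0 ≤ X := fun t ht => h.X_ge t ht (by omega)
  obtain ⟨t, ht, htX⟩ := hK.nondeg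
  refine ⟨fun i hi => (h.mem i hi).1, h.mono, fun z hz => h.cov z hz ?_⟩
  obtain ⟨t', ht', hz'⟩ := hK.last _ hz
  have h1 := h.X_lt (htX.trans_le (hX t ht))
  have h2 := hX t' ht'
  rw [pt_zero] at hz'
  have : (z.1 : ℝ) < XI := by linarith
  exact_mod_cast this

theorem sweepProg_spec : ∃ C : ℕ, ∀ (K : Set Plane) (n : ℕ) (u : ℕ → Plane) (m : ℕ), 1 ≤ n →
    (∀ L < n, (∀ i < n, u L 0 ≤ u i 0) → Cyclic K n (fun t => u ((L + t) % n))) →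
    (∀ a ∈ K, ∀ b ∈ K, a 0 - b 0 < 2 ^ m) →
    ∀ s : Memory, Reads s n u →
      Ends sweepProg s (C * (n * (m + 1) ^ 2)) (fun s' => Frame s s' ∧ ∃ N E, N ≤ n * (2 * m + 2) ∧
        s'.reg 18 = N ∧ HoldsSeq s' 2 3 N E ∧ Candidates K N E) := by
  obtain ⟨C₁, h₁⟩ := leftProg_spec
  obtain ⟨C₂, h₂⟩ := sweepBody_spec
  refine ⟨C₁ + timeBound sweepInit + 2 * ((var 0 ≼ var 6).not.cost + 1 + C₂),
    fun K n u m hn hK hwid s hs => ?_⟩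
  have hr : 1 ≤ (m + 1) ^ 2 := Nat.one_le_pow _ _ (by omega)
  unfold sweepProg
  refine Ends.mono (B := C₁ * n + (timeBound sweepInit + (n + 1) *
    ((var 0 ≼ var 6).not.cost + 1 + C₂ * (m + 1) ^ 2))) ?_ ?_ (fun _ h => h)
  swap
  · generalize timeBound sweepInit = a₁
    generalize (var 0 ≼ var 6).not.cost + 1 = a₂
    generalize (m + 1) ^ 2 = r at *
    have h1 := loop_bound (a := a₂) (C := C₂) hn hr
    have h2 : 1 ≤ n * r := Nat.mul_pos hn hr
    have h3 := Nat.le_mul_of_pos_right a₁ h2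
    have h4 := Nat.mul_le_mul_left C₁ (Nat.le_mul_of_pos_right n hr)
    nlinarith
  refine (h₁ s n u hn hs).seq fun s₁ h => ?_
  obtain ⟨f₁, L, hL, e2, hmin⟩ := h
  have hC := hK L hL hmin
  have hR := hs.frame f₁
  have hw0 : u ((L + 0) % n) = u L := by rw [add_zero, Nat.mod_eq_of_lt hL]
  have hpx := hR.px hL e2
  refine (Ends.of_exec (Q := fun s' => s' = exec sweepInit s₁) (by rfl) rfl).seq fun s₂ hs₂ => ?_
  have he : exec sweepInit s₁ = ((((s₁.set 3 L).set 4 (u L 0)).set 5 (⌈u L 0⌉ : ℤ)).set 6 0).set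
      18 0 := by
    have : (px 2).eval (s₁.set 3 L) = u L 0 := (hR.frame (s' := s₁.set 3 L)
      ⟨fun _ _ _ => rfl, by simp, by simp, by simp, by simp⟩).px hL (by simp [e2])
    simp [sweepInit, exec, e2, this]
  rw [he] at hs₂
  have f₂ : Frame s s₂ := f₁.trans (by
    rw [hs₂]; exact ⟨fun _ _ _ => rfl, by simp, by simp, by simp, by simp⟩)
  have hinit := SweepState.init hC (by simp) (fun _ => (0, 0))
  simp only [hw0] at hinit
  refine (Ends.loop (K := n) (C := C₂ * (m + 1) ^ 2) (fun k s' => Frame s s' ∧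
    ∃ (p q N : ℕ) (X : ℝ) (XI : ℤ) (E : ℕ → ℤ × ℤ), k ≤ n ∧ p + q = k ∧
      SweepRegs n u L p q N k X XI E s' ∧
      SweepState K n (fun t => u ((L + t) % n)) (k * (2 * m + 2)) p q N X XI E) ?_ ?_).mono
    le_rfl ?_
  · refine ⟨f₂, 0, 0, 0, _, _, _, Nat.zero_le _, rfl, ⟨hs.frame f₂, ?_, ?_, ?_, ?_, ?_, ?_,
      fun i hi => absurd hi (Nat.not_lt_zero i)⟩, by simpa using hinit⟩
    · simp [hs₂, e2, Nat.mod_eq_of_lt hL]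
    · simp [hs₂, Nat.mod_eq_of_lt hL]
    · simp [hs₂]
    · simp [hs₂]
    · simp [hs₂]
    · simp [hs₂]
  · rintro k s' ⟨f, p, q, N, X, XI, E, hk, hpq, hreg, hst⟩ hb
    have hlt : k < n := by
      simp only [holds_not, holds_le, eval_var, f.r0, hs.r0, hreg.r6, not_le] at hb
      exact_mod_cast hb
    refine ⟨hlt, (h₂ K n u L m hn hC hwid s' _ p q N k X XI E hpq hlt hreg hst).mono le_rfl ?_⟩
    rintro s'' ⟨f', p', q', N', X', XI', E', h1, h2, h3⟩
    exact ⟨f.trans f', p', q', N', X', XI', E', hlt, h1, h2, by rwa [add_mul, one_mul]⟩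
  · rintro s' ⟨k, ⟨f, p, q, N, X, XI, E, hk, hpq, hreg, hst⟩, hb⟩
    have hkn : k = n := by
      simp only [holds_not, holds_le, eval_var, f.r0, hs.r0, hreg.r6, not_not] at hb
      exact le_antisymm hk (by exact_mod_cast hb)
    subst hkn
    exact ⟨f, N, E, hst.num, hreg.r18, hreg.seq, hst.finish hC hpq⟩

end DiscreteHull

namespace DiscreteHull

open DiscreteHull.Expr (var)
open Wedge (cross)

/-! ### From the candidates to the lower hull -/

/-- The points `A 0, …, A (h - 1)` are the vertices of the lower hull of the lattice points of `K`,
from left to right. -/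
structure LowerHull (K : Set Plane) (h : ℕ) (A : ℕ → ℤ × ℤ) : Prop where
  mem : ∀ j < h, pt (A j) ∈ K
  mono : ∀ j, j + 1 < h → (A j).1 < (A (j + 1)).1
  turn : ∀ j, j + 2 < h → 0 < cross (A j) (A (j + 1)) (A (j + 2))
  cov : ∀ z, pt z ∈ K → Cov (A '' Set.Iio h) z

/-- The stack `S 0, …, S (h - 1)` of the scan after the candidates `E 0, …, E (i - 1)` have been
pushed and while `E i` waits. -/
structure ScanState (N : ℕ) (E : ℕ → ℤ × ℤ) (i h : ℕ) (S : ℕ → ℤ × ℤ) : Prop where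
  le : i ≤ N
  size : h ≤ i
  mem : ∀ j < h, ∃ l < i, E l = S j
  mono : ∀ j, j + 1 < h → (S j).1 < (S (j + 1)).1
  turn : ∀ j, j + 2 < h → 0 < cross (S j) (S (j + 1)) (S (j + 2))
  cov : ∀ l < i, ∀ C : Set (ℤ × ℤ), (∀ j < h, S j ∈ C) → (i < N → E i ∈ C) → Cov C (E l)

theorem fst_strictMono {N : ℕ} {E : ℕ → ℤ × ℤ} (h : ∀ i, i + 1 < N → (E i).1 < (E (i + 1)).1)
    {i j : ℕ} (hij : i < j) (hj : j < N) : (E i).1 < (E j).1 := by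
  induction j, hij using Nat.le_induction with
  | base => exact h i hj
  | succ j hij ih => exact (ih (by omega)).trans (h j hj)

/-! ### Pushing and popping in the Graham scan -/

namespace ScanState
variable {K : Set Plane} {N i h : ℕ} {E S : ℕ → ℤ × ℤ}

theorem push (hs : ScanState N E i h S) (hE : ∀ i, i + 1 < N → (E i).1 < (E (i + 1)).1)
    (hi : i < N) (ht : ∀ g, g + 2 = h → 0 < cross (S g) (S (g + 1)) (E i)) :
    ScanState N E (i + 1) (h + 1) (Function.update S h (E i)) := by
  have hne : ∀ j < h, Function.update S h (E i) j = S j := fun j hj =>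
    Function.update_of_ne hj.ne _ _
  have hself : Function.update S h (E i) h = E i := Function.update_self _ _ _
  refine ⟨hi, Nat.succ_le_succ hs.size, fun j hj => ?_, fun j hj => ?_, fun j hj => ?_,
    fun l hl C hC _ => ?_⟩
  · rcases Nat.lt_succ_iff_lt_or_eq.1 hj with h' | rfl
    · obtain ⟨l, hl, hl'⟩ := hs.mem j h'
      exact ⟨l, by omega, by rw [hne j h', hl']⟩
    · exact ⟨i, by omega, by rw [hself]⟩
  · rw [hne j (by omega)]
    rcases Nat.lt_succ_iff_lt_or_eq.1 hj with h' | rfl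
    · rw [hne _ h']
      exact hs.mono j h'
    · obtain ⟨l, hl, hl'⟩ := hs.mem j (by omega)
      rw [hself, ← hl']
      exact fst_strictMono hE hl hi
  · rw [hne j (by omega), hne (j + 1) (by omega)]
    rcases Nat.lt_succ_iff_lt_or_eq.1 hj with h' | rfl
    · rw [hne _ h']
      exact hs.turn j h'
    · rw [hself]
      exact ht j rfl
  · have hiC : E i ∈ C := hself ▸ hC h (by omega)
    rcases Nat.lt_succ_iff_lt_or_eq.1 hl with h' | rfl
    · exact hs.cov l h' C (fun j hj => hne j hj ▸ hC j (by omega)) fun _ => hiC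
    · exact .of_mem hiC rfl le_rfl

/-- The popped point lies on or above the segment from the new top to the waiting point, so any set
containing these two covers it; `Cov.trans` then dispenses with it in all earlier coverings. -/
theorem pop (hs : ScanState N E i (h + 2) S) (hE : ∀ i, i + 1 < N → (E i).1 < (E (i + 1)).1)
    (hi : i < N) (ht : cross (S h) (S (h + 1)) (E i) ≤ 0) : ScanState N E i (h + 1) S := by
  refine ⟨hs.le, by have := hs.size; omega, fun j hj => hs.mem j (by omega),
    fun j hj => hs.mono j (by omega), fun j hj => hs.turn j (by omega), fun l hl C hC hC' => ?_⟩
  have h1 := hs.mono h (by omega)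
  obtain ⟨l', hl', he⟩ := hs.mem (h + 1) (by omega)
  have h2 : (S (h + 1)).1 < (E i).1 := he ▸ fst_strictMono hE hl' hi
  have h3 : Cov C (S (h + 1)) := by
    refine Cov.of_cross (hC h (by omega)) (hC' hi) h1.le h2.le (h1.trans h2) ?_
    simp only [cross] at ht ⊢
    linarith
  refine (hs.cov l hl (insert (S (h + 1)) C) (fun j hj => ?_) fun h => .inr (hC' h)).trans ?_
  · rcases Nat.lt_succ_iff_lt_or_eq.1 hj with h' | rfl
    · exact .inr (hC j h')
    · exact .inl rfl
  · rintro c (rfl | hc)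
    · exact h3
    · exact .of_mem hc rfl le_rfl

theorem finish (hs : ScanState N E N h S) (hE : Candidates K N E) : LowerHull K h S := by
  refine ⟨fun j hj => ?_, hs.mono, hs.turn, fun z hz => (hE.cov z hz).trans ?_⟩
  · obtain ⟨l, hl, he⟩ := hs.mem j hj
    exact he ▸ hE.mem l hl
  · rintro _ ⟨l, hl, rfl⟩
    exact hs.cov l hl _ (fun j hj => ⟨j, hj, rfl⟩) fun h => absurd h (lt_irrefl _)

end ScanState

/-- The turn at the top of the stack towards the waiting point. -/
def turnExpr : Expr :=
  (.load 4 (var 10 - 1) - .load 4 (var 10 - 2)) * (var 25 - .load 5 (var 10 - 2)) -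
    (.load 5 (var 10 - 1) - .load 5 (var 10 - 2)) * (var 24 - .load 4 (var 10 - 2))

/-- Read the waiting point. -/
def fetchProg : Program :=
  24 ≔ var 1 * .load 2 (var 22) ;; 25 ≔ var 1 * .load 3 (var 22)

/-- Push the waiting point. -/
def pushProg : Program :=
  .store 4 (var 10) (var 24) ;; .store 5 (var 10) (var 25) ;; 10 ≔ var 10 + 1 ;; 22 ≔ var 22 + 1

/-- Pop one point or push the waiting point. -/
def scanBody : Program :=
  fetchProg ;;
  .branch ((var 11 + 2 ≼ var 10).and (turnExpr ≼ 0)) (10 ≔ var 10 - 1) pushProg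

/-- The scan. -/
def scanProg : Program :=
  22 ≔ 0 ;; .loop (var 18 ≼ var 22).not scanBody

/-- Registers `0, 1, 11, 18`, all arrays but `4, 5`, and the first `B` cells of these are
unchanged. -/
structure ScanFrame (B : ℕ) (s s' : Memory) : Prop where
  arr : ∀ a, a ≠ 4 → a ≠ 5 → s'.arr a = s.arr a
  low : ∀ a, ∀ j < B, s'.arr a j = s.arr a j
  reg : ∀ r, r ≠ 10 → r ≠ 22 → r ≠ 24 → r ≠ 25 → s'.reg r = s.reg r

theorem ScanFrame.trans {B : ℕ} {s s' s'' : Memory} (h : ScanFrame B s s')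
    (h' : ScanFrame B s' s'') : ScanFrame B s s'' :=
  ⟨fun a h4 h5 => (h'.arr a h4 h5).trans (h.arr a h4 h5),
    fun a j hj => (h'.low a j hj).trans (h.low a j hj),
    fun r h1 h2 h3 h4 => (h'.reg r h1 h2 h3 h4).trans (h.reg r h1 h2 h3 h4)⟩

/-- Arrays `4` and `5` hold `h` points of `S` from cell `B` on, multiplied by `σ`. -/
def Stack (s : Memory) (σ : ℝ) (B h : ℕ) (S : ℕ → ℤ × ℤ) : Prop :=
  ∀ j < h, s.arr 4 (B + j) = σ * (S j).1 ∧ s.arr 5 (B + j) = σ * (S j).2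

/-- The potential `2 * i - h` grows by exactly one in each round, whether a point is pushed or
popped. The stack holds points in original coordinates, and the turn test is quadratic, so the sign
`σ` cancels in it. -/
theorem scanBody_spec {s : Memory} {σ : ℝ} (hσ : σ * σ = 1) {B N i h : ℕ} {E S : ℕ → ℤ × ℤ}
    (hE : ∀ i, i + 1 < N → (E i).1 < (E (i + 1)).1) (hN : HoldsSeq s 2 3 N E) (hi : i < N)
    (r1 : s.reg 1 = σ) (r10 : s.reg 10 = (B + h : ℕ)) (r11 : s.reg 11 = B) (r22 : s.reg 22 = i)
    (hS : Stack s σ B h S) (hs : ScanState N E i h S) :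
    ScanFrame B s (exec scanBody s) ∧ ∃ (i' h' : ℕ) (S' : ℕ → ℤ × ℤ), (exec scanBody s).reg 10 = (B + h' : ℕ) ∧
      (exec scanBody s).reg 22 = i' ∧ Stack (exec scanBody s) σ B h' S' ∧ ScanState N E i' h' S' ∧
      2 * i + h' + 1 = 2 * i' + h := by
  simp only [scanBody, exec_seq]
  obtain ⟨e1, e2⟩ := hN i hi
  have hf : exec fetchProg s = (s.set 24 (σ * (E i).1)).set 25 (σ * (E i).2) := by
    simp [fetchProg, exec, r1, r22, e1, e2]
  rw [hf]
  set s₁ := (s.set 24 (σ * (E i).1)).set 25 (σ * (E i).2) with hs₁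
  have k10 : s₁.reg 10 = (B + h : ℕ) := by simp [hs₁, r10]
  have k11 : s₁.reg 11 = B := by simp [hs₁, r11]
  have k22 : s₁.reg 22 = i := by simp [hs₁, r22]
  have k24 : s₁.reg 24 = σ * (E i).1 := by simp [hs₁]
  have k25 : s₁.reg 25 = σ * (E i).2 := by simp [hs₁]
  have kS : Stack s₁ σ B h S := hS
  have f₁ : ScanFrame B s s₁ := ⟨fun _ _ _ => rfl, fun _ _ _ => rfl,
    fun r _ _ h3 h4 => by simp [hs₁, h3, h4]⟩
  have turn : ∀ g, g + 2 = h → turnExpr.eval s₁ = (cross (S g) (S (g + 1)) (E i) : ℤ) := by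
    rintro g rfl
    have i1 : ⌊(var 10 - 1 : Expr).eval s₁⌋₊ = B + (g + 1) := by
      rw [eval_sub, eval_var, eval_ofNat, k10]
      push_cast
      rw [show (B : ℝ) + (g + 2) - 1 = (B + (g + 1) : ℕ) by push_cast; ring, Nat.floor_natCast]
    have i2 : ⌊(var 10 - 2 : Expr).eval s₁⌋₊ = B + g := by
      rw [eval_sub, eval_var, eval_ofNat, k10]
      push_cast
      rw [show (B : ℝ) + (g + 2) - 2 = (B + g : ℕ) by push_cast; ring, Nat.floor_natCast]
    obtain ⟨a1, a2⟩ := kS g (by omega)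
    obtain ⟨b1, b2⟩ := kS (g + 1) (by omega)
    simp only [turnExpr, eval_sub, eval_mul, eval_load, eval_var] at i1 i2 ⊢
    rw [i1, i2, a1, a2, b1, b2, k24, k25]
    simp only [cross]
    push_cast
    linear_combination ((((S (g + 1)).1 : ℝ) - (S g).1) * ((E i).2 - (S g).2) -
      ((S (g + 1)).2 - (S g).2) * ((E i).1 - (S g).1)) * hσ
  have two : (var 11 + 2 ≼ var 10).Holds s₁ ↔ 2 ≤ h := by
    simp only [holds_le, eval_add, eval_var, eval_ofNat, k10, k11]
    push_cast
    rw [add_le_add_iff_left]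
    exact_mod_cast Iff.rfl
  by_cases hb : ((var 11 + 2 ≼ var 10).and (turnExpr ≼ 0)).Holds s₁
  · rw [exec_branch_pos _ hb, exec_assign]
    obtain ⟨h1, h2⟩ := (holds_and _ _ _).1 hb
    obtain ⟨g, rfl⟩ : ∃ g, h = g + 2 := ⟨h - 2, by have := two.1 h1; omega⟩
    rw [holds_le, turn g rfl, eval_ofNat] at h2
    refine ⟨f₁.trans ⟨fun _ _ _ => rfl, fun _ _ _ => rfl, fun r hr _ _ _ => by simp [hr]⟩, i,
      g + 1, S, ?_, by simp [k22], fun j hj => kS j (by omega),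
      hs.pop hE hi (by exact_mod_cast h2), by omega⟩
    simp [k10]
    ring
  · rw [exec_branch_neg _ hb]
    have he : exec pushProg s₁ = (((s₁.put 4 (B + h) (σ * (E i).1)).put 5 (B + h)
        (σ * (E i).2)).set 10 (B + (h + 1) : ℕ)).set 22 (i + 1 : ℕ) := by
      simp only [pushProg, exec_seq, exec_store, exec_assign, eval_var, eval_add, eval_ofNat,
        Memory.put_reg, Memory.set_reg, k10, k24, k25, k22, Nat.floor_natCast]
      simp [add_assoc]
    rw [he]
    refine ⟨f₁.trans ⟨fun a h4 h5 => ?_, fun a j hj => ?_, fun r h1 h2 _ _ => by simp [h1, h2]⟩,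
      i + 1, h + 1, _, by simp, by simp, fun j hj => ?_, hs.push hE hi fun g hg => ?_, by omega⟩
    · ext j
      simp [h4, h5]
    · have : j ≠ B + h := by omega
      simp [this]
    · rcases Nat.lt_succ_iff_lt_or_eq.1 hj with h' | rfl
      · have := kS j h'
        simp [h'.ne, this]
      · simp
    · by_contra hc
      refine hb ⟨two.2 (by omega), ?_⟩
      rw [holds_le, turn g hg, eval_ofNat]
      exact_mod_cast not_lt.1 hc

theorem scanProg_spec : ∃ C : ℕ, ∀ (K : Set Plane) (s : Memory) (σ : ℝ) (B N : ℕ)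
    (E : ℕ → ℤ × ℤ), σ * σ = 1 → Candidates K N E → HoldsSeq s 2 3 N E → s.reg 1 = σ →
    s.reg 10 = B → s.reg 11 = B → s.reg 18 = N →
    Ends scanProg s (C * (N + 1)) (fun s' => ScanFrame B s s' ∧ ∃ (h : ℕ) (A : ℕ → ℤ × ℤ), h ≤ N ∧
      s'.reg 10 = (B + h : ℕ) ∧
      Stack s' σ B h A ∧ LowerHull K h A) := by
  refine ⟨timeBound (22 ≔ 0) + 2 * ((var 18 ≼ var 22).not.cost + 1 + timeBound scanBody),
    fun K s σ B N E hσ hE hN r1 r10 r11 r18 => ?_⟩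
  unfold scanProg
  refine Ends.mono (B := timeBound (22 ≔ 0) + (2 * N + 1) *
    ((var 18 ≼ var 22).not.cost + 1 + timeBound scanBody)) ?_ ?_ (fun _ h => h)
  swap
  · generalize timeBound (22 ≔ 0) = a₁
    generalize (var 18 ≼ var 22).not.cost + 1 + timeBound scanBody = a₂
    nlinarith
  refine (Ends.of_exec (Q := fun s' => s' = s.set 22 0) (by rfl) (by simp [exec])).seq
    fun s₁ hs₁ => ?_
  -- The round counter equals the potential `2 * i - h`, which is below `2 * N` while a point waits.
  refine (Ends.loop (K := 2 * N) (C := timeBound scanBody) (fun k s' => ScanFrame B s s' ∧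
    ∃ (i h : ℕ) (S : ℕ → ℤ × ℤ), s'.reg 10 = (B + h : ℕ) ∧ s'.reg 22 = i ∧ Stack s' σ B h S ∧ ScanState N E i h S ∧
      k + h = 2 * i) ?_ ?_).mono le_rfl ?_
  · subst hs₁
    refine ⟨⟨fun _ _ _ => rfl, fun _ _ _ => rfl, fun r _ h2 _ _ => by simp [h2]⟩, 0, 0,
      fun _ => (0, 0), by simp [r10], by simp, fun j hj => absurd hj (Nat.not_lt_zero j),
      ⟨Nat.zero_le _, le_rfl, ?_, ?_, ?_, ?_⟩, rfl⟩ <;> intro j hj <;> omega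
  · rintro k s' ⟨f, i, h, S, k10, k22, hS, hs, hk⟩ hb
    have k18 := (f.reg 18 (by norm_num) (by norm_num) (by norm_num) (by norm_num)).trans r18
    have k1 := (f.reg 1 (by norm_num) (by norm_num) (by norm_num) (by norm_num)).trans r1
    have k11 := (f.reg 11 (by norm_num) (by norm_num) (by norm_num) (by norm_num)).trans r11
    have hi : i < N := by
      simp only [holds_not, holds_le, eval_var, k18, k22, not_le] at hb
      exact_mod_cast hb
    have hN' : HoldsSeq s' 2 3 N E := fun j hj => by
      rw [f.arr 2 (by norm_num) (by norm_num), f.arr 3 (by norm_num) (by norm_num)]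
      exact hN j hj
    obtain ⟨f', i', h', S', c1, c2, c3, c4, c5⟩ :=
      scanBody_spec hσ hE.mono hN' hi k1 k10 k11 k22 hS hs
    exact ⟨by omega, .of_exec (by rfl) ⟨f.trans f', i', h', S', c1, c2, c3, c4, by omega⟩⟩
  · rintro s' ⟨k, ⟨f, i, h, S, k10, k22, hS, hs, hk⟩, hb⟩
    have k18 := (f.reg 18 (by norm_num) (by norm_num) (by norm_num) (by norm_num)).trans r18
    have hi : i = N := by
      simp only [holds_not, holds_le, eval_var, k18, k22, not_not] at hb
      exact le_antisymm hs.le (by exact_mod_cast hb)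
    subst hi
    exact ⟨f, h, S, hs.size, k10, hS, hs.finish hE⟩

end DiscreteHull

namespace DiscreteHull

open DiscreteHull.Expr (var)

/-! ### Writing the output -/

/-- Copy one point. -/
def copyBody : Program :=
  .store 0 (var 23) (.load 4 (var 22)) ;; .store 1 (var 23) (.load 5 (var 22)) ;;
  22 ≔ var 22 + 1 ;; 23 ≔ var 23 + 1

/-- Copy points from arrays `4, 5` to arrays `0, 1`. -/
def copyProg : Program :=
  .loop (var 24 ≼ var 22).not copyBody

/-- The state after copying `l` points from position `a` to position `d`. -/
structure Copied (a d l : ℕ) (s s' : Memory) : Prop where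
  arr : ∀ b, b ≠ 0 → b ≠ 1 → s'.arr b = s.arr b
  low : ∀ b, ∀ j < d, s'.arr b j = s.arr b j
  new : ∀ i < l, s'.arr 0 (d + i) = s.arr 4 (a + i) ∧ s'.arr 1 (d + i) = s.arr 5 (a + i)
  r22 : s'.reg 22 = (a + l : ℕ)
  r23 : s'.reg 23 = (d + l : ℕ)
  reg : ∀ r, r ≠ 22 → r ≠ 23 → s'.reg r = s.reg r

theorem Copied.step {a d l : ℕ} {s s' : Memory} (h : Copied a d l s s') :
    Copied a d (l + 1) s (exec copyBody s') := by
  have he : exec copyBody s' = (((s'.put 0 (d + l) (s.arr 4 (a + l))).put 1 (d + l)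
      (s.arr 5 (a + l))).set 22 (a + (l + 1) : ℕ)).set 23 (d + (l + 1) : ℕ) := by
    simp only [copyBody, exec_seq, exec_store, exec_assign, eval_var, eval_add, eval_ofNat,
      eval_load, Memory.put_reg, Memory.set_reg, h.r22, h.r23, Nat.floor_natCast,
      h.arr 4 (by norm_num) (by norm_num)]
    have h5 : (s'.put 0 (d + l) (s.arr 4 (a + l))).arr 5 (a + l) = s.arr 5 (a + l) := by
      rw [Memory.put_arr, if_neg (by simp), h.arr 5 (by norm_num) (by norm_num)]
    rw [h5]
    simp [add_assoc]
  rw [he]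
  refine ⟨fun b h0 h1 => ?_, fun b j hj => ?_, fun i hi => ?_, by simp, by simp,
    fun r h1 h2 => by simp [h1, h2, h.reg]⟩
  · ext j
    simp [h0, h1, h.arr]
  · have : j ≠ d + l := by omega
    simp [this, h.low b j hj]
  · rcases Nat.lt_succ_iff_lt_or_eq.1 hi with h' | rfl
    · have := h.new i h'
      simp [h'.ne, this]
    · simp

theorem copyProg_spec : ∃ C : ℕ, ∀ (s : Memory) (a d l : ℕ), s.reg 22 = a → s.reg 23 = d →
    s.reg 24 = (a + l : ℕ) → Ends copyProg s (C * (l + 1)) (Copied a d l s) := by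
  refine ⟨(var 24 ≼ var 22).not.cost + 1 + timeBound copyBody, fun s a d l r22 r23 r24 => ?_⟩
  unfold copyProg
  refine (Ends.loop (K := l) (C := timeBound copyBody)
    (fun k s' => k ≤ l ∧ Copied a d k s s') ?_ ?_).mono (le_of_eq (mul_comm _ _)) ?_
  · exact ⟨Nat.zero_le _, fun _ _ _ => rfl, fun _ _ _ => rfl, fun i hi => absurd hi
      (Nat.not_lt_zero i), r22, r23, fun _ _ _ => rfl⟩
  · rintro k s' ⟨hk, h⟩ hb
    have hlt : k < l := by
      simp only [holds_not, holds_le, eval_var, h.reg 24 (by norm_num) (by norm_num), r24, h.r22,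
        Nat.cast_le, not_le] at hb
      omega
    exact ⟨hlt, .of_exec (by rfl) ⟨hlt, h.step⟩⟩
  · rintro s' ⟨k, ⟨hk, h⟩, hb⟩
    have hkl : k = l := by
      simp only [holds_not, holds_le, eval_var, h.reg 24 (by norm_num) (by norm_num), r24, h.r22,
        Nat.cast_le, not_not] at hb
      omega
    exact hkl ▸ h

/-- The stack holds the same point in cells `i` and `j`. -/
def sameTest (i j : Expr) : Test :=
  ((Test.le (.load 4 i) (.load 4 j)).and (.le (.load 4 j) (.load 4 i))).and
    ((Test.le (.load 5 i) (.load 5 j)).and (.le (.load 5 j) (.load 5 i)))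

theorem sameTest_holds {s : Memory} {Z : ℕ} {W : ℕ → ℤ × ℤ} (h : HoldsSeq s 4 5 Z W) {e f : Expr}
    {i j : ℕ} (he : e.eval s = i) (hf : f.eval s = j) (hi : i < Z) (hj : j < Z) :
    (sameTest e f).Holds s ↔ W i = W j := by
  obtain ⟨a1, a2⟩ := h i hi
  obtain ⟨b1, b2⟩ := h j hj
  simp only [sameTest, holds_and, holds_le, eval_load, he, hf, Nat.floor_natCast, a1, a2, b1, b2,
    Int.cast_le, ← le_antisymm_iff]
  exact Prod.ext_iff.symm

/-- Remove the last point from the stack if it equals the first one. -/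
def dropProg : Program :=
  .branch ((2 ≼ var 10).and (sameTest (var 10 - 1) 0)) (10 ≔ var 10 - 1) .skip ;;
  22 ≔ 0 ;; 23 ≔ 0 ;; 24 ≔ var 11

/-- Skip the first point of the upper hull if it equals the last one of the lower hull. -/
def skipProg : Program :=
  .branch ((var 11 + 1 ≼ var 10).and (sameTest (var 11) (var 11 - 1))) (22 ≔ var 22 + 1) .skip ;;
  24 ≔ var 10

/-- Write the output. -/
def outputProg : Program :=
  dropProg ;; copyProg ;; skipProg ;; copyProg ;; 0 ≔ var 23

theorem dropProg_spec {s : Memory} {h g : ℕ} {W : ℕ → ℤ × ℤ} (hs : HoldsSeq s 4 5 (h + g) W)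
    (hhg : h = 0 ↔ g = 0) (r10 : s.reg 10 = (h + g : ℕ)) (r11 : s.reg 11 = h) :
    ∃ g', g' = (if W (h + g - 1) = W 0 then g - 1 else g) ∧
    exec dropProg s = (((s.set 10 (h + g' : ℕ)).set 22 0).set 23 0).set 24 h := by
  simp only [dropProg, exec_seq, exec_assign]
  have key : exec (.branch ((2 ≼ var 10).and (sameTest (var 10 - 1) 0)) (10 ≔ var 10 - 1) .skip) s =
      s.set 10 (h + (if W (h + g - 1) = W 0 then g - 1 else g) : ℕ) := by
    have hid : s.set 10 (h + g : ℕ) = s := by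
      simp only [Memory.set, ← r10, Function.update_eq_self]
    -- For `g = 0` also `h = 0`; then truncated subtraction makes both branches of the conditional
    -- equal to `0`, in agreement with the failing test.
    rcases Nat.eq_zero_or_pos g with rfl | hg
    · have hh := hhg.2 rfl
      subst hh
      rw [exec_branch_neg]
      · simpa [exec] using hid.symm
      · simp [r10]
    · have hh : 0 < h := Nat.pos_of_ne_zero fun h0 => hg.ne' (hhg.1 h0)
      have h1 : (var 10 - 1 : Expr).eval s = (h + g - 1 : ℕ) := by
        rw [eval_sub, eval_var, eval_ofNat, r10, Nat.cast_sub (by omega)]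
      have h2 := sameTest_holds hs (e := var 10 - 1) (f := 0) h1 (j := 0) (by simp) (by omega)
        (by omega)
      have h3 : (2 ≼ var 10).Holds s := by
        simp only [holds_le, eval_ofNat, eval_var, r10]
        exact_mod_cast (by omega : 2 ≤ h + g)
      by_cases he : W (h + g - 1) = W 0
      · rw [exec_branch_pos _ ((holds_and _ _ _).2 ⟨h3, h2.2 he⟩), if_pos he, exec_assign, h1,
          Nat.add_sub_assoc (by omega)]
      · rw [exec_branch_neg _ fun hb => he (h2.1 ((holds_and _ _ _).1 hb).2), if_neg he, exec_skip, hid]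
  refine ⟨_, rfl, ?_⟩
  rw [key]
  simp [r11]

theorem skipProg_spec {s : Memory} {h g : ℕ} {W : ℕ → ℤ × ℤ} (hs : HoldsSeq s 4 5 (h + g) W)
    (hhg : h = 0 → g = 0) (r10 : s.reg 10 = (h + g : ℕ)) (r11 : s.reg 11 = h)
    (r22 : s.reg 22 = h) :
    ∃ o, o = (if 1 ≤ g ∧ W h = W (h - 1) then 1 else 0) ∧
    exec skipProg s = (s.set 22 (h + o : ℕ)).set 24 (h + g : ℕ) := by
  simp only [skipProg, exec_seq, exec_assign]
  have key : exec (.branch ((var 11 + 1 ≼ var 10).and (sameTest (var 11) (var 11 - 1)))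
      (22 ≔ var 22 + 1) .skip) s =
      s.set 22 (h + (if 1 ≤ g ∧ W h = W (h - 1) then 1 else 0) : ℕ) := by
    have hid : s.set 22 (h + 0 : ℕ) = s := by
      rw [add_zero]
      simp only [Memory.set, ← r22, Function.update_eq_self]
    have h3 : (var 11 + 1 ≼ var 10).Holds s ↔ 1 ≤ g := by
      simp only [holds_le, eval_ofNat, eval_var, eval_add, r10, r11]
      push_cast
      rw [add_le_add_iff_left]
      exact_mod_cast Iff.rfl
    by_cases hg : 1 ≤ g
    · have hh : 0 < h := Nat.pos_of_ne_zero fun h0 => by have := hhg h0; omega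
      have h1 : (var 11 - 1 : Expr).eval s = (h - 1 : ℕ) := by
        rw [eval_sub, eval_var, eval_ofNat, r11, Nat.cast_sub (by omega)]
      have h2 := sameTest_holds hs (e := var 11) (f := var 11 - 1) (i := h) (by simp [r11]) h1
        (by omega) (by omega)
      by_cases he : W h = W (h - 1)
      · rw [exec_branch_pos _ ((holds_and _ _ _).2 ⟨h3.2 hg, h2.2 he⟩), if_pos ⟨hg, he⟩, exec_assign]
        simp [r22]
      · rw [exec_branch_neg _ fun hb => he (h2.1 ((holds_and _ _ _).1 hb).2), if_neg fun h => he h.2, exec_skip, hid]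
    · rw [exec_branch_neg _ fun hb => hg (h3.1 ((holds_and _ _ _).1 hb).1), if_neg fun h => hg h.1, exec_skip, hid]
  refine ⟨_, rfl, ?_⟩
  rw [key]
  simp [r10]

theorem outputProg_spec : ∃ C : ℕ, ∀ (s : Memory) (h g : ℕ) (W : ℕ → ℤ × ℤ),
    HoldsSeq s 4 5 (h + g) W → (h = 0 ↔ g = 0) → s.reg 10 = (h + g : ℕ) → s.reg 11 = h →
    Ends outputProg s (C * (h + g + 1)) (fun s' => ∃ g' o,
      g' = (if W (h + g - 1) = W 0 then g - 1 else g) ∧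
      o = (if 1 ≤ g' ∧ W h = W (h - 1) then 1 else 0) ∧ s'.reg 0 = (h + (g' - o) : ℕ) ∧
      HoldsSeq s' 0 1 (h + (g' - o)) (fun j => W (if j < h then j else j + o))) := by
  obtain ⟨C, hC⟩ := copyProg_spec
  refine ⟨timeBound dropProg + C + timeBound skipProg + C + timeBound (0 ≔ var 23),
    fun s h g W hs hhg r10 r11 => ?_⟩
  obtain ⟨g', hg', he⟩ := dropProg_spec hs hhg r10 r11
  have hgg : g' ≤ g := by rw [hg']; split_ifs <;> omega
  unfold outputProg
  refine (Ends.of_exec (Q := fun s' => s' = exec dropProg s) (by rfl) rfl).seq (B' :=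
    C * (h + 1) + (timeBound skipProg + (C * (g + 1) + timeBound (0 ≔ var 23))))
    (fun s₁ hs₁ => ?_) |>.mono ?_ (fun _ h => h)
  swap
  · generalize timeBound dropProg = a₁
    generalize timeBound skipProg = a₂
    generalize timeBound (0 ≔ var 23) = a₃
    nlinarith [Nat.zero_le (a₁ * (h + g)), Nat.zero_le (a₂ * (h + g)), Nat.zero_le (a₃ * (h + g)),
      Nat.zero_le (C * (h + g))]
  rw [he] at hs₁
  have c1 : s₁.arr = s.arr := by rw [hs₁]; rfl
  refine (hC s₁ 0 0 h (by simp [hs₁]) (by simp [hs₁]) (by simp [hs₁])).seq fun s₂ h₂ => ?_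
  have d10 : s₂.reg 10 = (h + g' : ℕ) := by
    rw [h₂.reg 10 (by norm_num) (by norm_num)]; simp [hs₁]
  have d11 : s₂.reg 11 = h := by
    rw [h₂.reg 11 (by norm_num) (by norm_num)]; simp [hs₁, r11]
  have dW : HoldsSeq s₂ 4 5 (h + g') W := fun i hi => by
    rw [h₂.arr 4 (by norm_num) (by norm_num), h₂.arr 5 (by norm_num) (by norm_num), c1]
    exact hs i (by omega)
  obtain ⟨o, ho, he'⟩ := skipProg_spec dW (fun h0 => by have := hhg.1 h0; omega) d10 d11
    (by rw [h₂.r22, zero_add])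
  have hog : o ≤ g' := by rw [ho]; split_ifs <;> omega
  refine (Ends.of_exec (Q := fun s' => s' = exec skipProg s₂) (by rfl) rfl).seq fun s₃ hs₃ => ?_
  rw [he'] at hs₃
  have e3 : s₃.arr = s₂.arr := by rw [hs₃]; rfl
  refine ((hC s₃ (h + o) h (g' - o) (by simp [hs₃]) ?_ ?_).mono (Nat.mul_le_mul_left _ (by omega))
    (fun _ h => h)).seq fun s₄ h₄ => ?_
  · rw [hs₃]
    simp [h₂.r23]
  · rw [show h + o + (g' - o) = h + g' by omega]
    simp [hs₃]
  refine .of_exec (by rfl) ⟨g', o, hg', ho, ?_, fun j hj => ?_⟩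
  · simp [exec, h₄.r23]
  · change s₄.arr 0 j = _ ∧ s₄.arr 1 j = _
    by_cases hjh : j < h
    · have := h₂.new j hjh
      rw [h₄.low 0 j hjh, h₄.low 1 j hjh, e3]
      simp only [zero_add, c1] at this
      rw [this.1, this.2]
      simp only [if_pos hjh]
      exact hs j (by omega)
    · obtain ⟨i, rfl⟩ := Nat.exists_eq_add_of_le (not_lt.1 hjh)
      have := h₄.new i (by omega)
      rw [this.1, this.2, e3]
      simp only [if_neg hjh, show h + i + o = h + o + i by omega]
      exact dW _ (by omega)

end DiscreteHull

namespace DiscreteHull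

open Wedge (cross)

/-! ### The two hulls give the vertex list -/

theorem pt_neg (z : ℤ × ℤ) : pt (-z) = -pt z := plane_ext (by simp) (by simp)

theorem pt_injective : Function.Injective pt := fun a b h => by
  have h0 : pt a 0 = pt b 0 := by rw [h]
  have h1 : pt a 1 = pt b 1 := by rw [h]
  simp only [pt_zero, pt_one, Int.cast_inj] at h0 h1
  exact Prod.ext h0 h1

theorem mem_lattice_iff {p : Plane} : p ∈ lattice ↔ ∃ z, pt z = p := by
  constructor
  · intro h
    obtain ⟨x, hx⟩ := h 0
    obtain ⟨y, hy⟩ := h 1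
    exact ⟨(x, y), plane_ext (by simp [hx]) (by simp [hy])⟩
  · rintro ⟨z, rfl⟩ i
    fin_cases i
    · exact ⟨z.1, pt_zero z⟩
    · exact ⟨z.2, pt_one z⟩

theorem orient_pt (p q r : ℤ × ℤ) : orient (pt p) (pt q) (pt r) = (cross p q r : ℤ) := by
  simp [orient, cross]

theorem cross_neg (p q r : ℤ × ℤ) : cross (-p) (-q) (-r) = cross p q r := by
  simp only [cross, Prod.fst_neg, Prod.snd_neg]
  ring

theorem cross_rotate (p q r : ℤ × ℤ) : cross p q r = cross q r p := by
  simp only [cross]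
  ring

/-- The reflection of a set in the origin. -/
def reflect (K : Set Plane) : Set Plane := {z | -z ∈ K}

theorem reflect_reflect (K : Set Plane) : reflect (reflect K) = K := by
  ext z
  simp [reflect]

theorem pt_neg_mem_reflect {K : Set Plane} {z : ℤ × ℤ} : pt (-z) ∈ reflect K ↔ pt z ∈ K := by
  simp [reflect, pt_neg]

/-- The lattice point `a` of `K` is strictly lower than all others for some slope. -/
def Low (K : Set Plane) (a : ℤ × ℤ) : Prop :=
  pt a ∈ K ∧ ∃ κ : ℝ, ∀ z, pt z ∈ K → z ≠ a → (a.2 : ℝ) - κ * a.1 < z.2 - κ * z.1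

/-- If `r` is to the right of `q`, the functional minimized at `q` puts `q` strictly below the
segment `p r`; left of `p` the roles are exchanged. In between, `r` is the strict maximum of a
functional and so lies strictly above the segment `p q`. -/
theorem Low.cross_pos {K : Set Plane} {p q r : ℤ × ℤ} (hp : Low K p) (hq : Low K q)
    (hpq : p.1 < q.1) (hr : pt r ∈ K) (hrp : r ≠ p) (hrq : r ≠ q)
    (h : q.1 < r.1 ∨ r.1 < p.1 ∨ Low (reflect K) (-r)) : 0 < cross p q r := by
  have hpq' : (0 : ℝ) < q.1 - p.1 := sub_pos.2 (by exact_mod_cast hpq)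
  have right : q.1 < r.1 → 0 < cross p q r := by
    intro h
    have h' : (0 : ℝ) < r.1 - q.1 := sub_pos.2 (by exact_mod_cast h)
    obtain ⟨hqK, κ, hκ⟩ := hq
    have h1 := hκ p hp.1 (fun h => by rw [h] at hpq; exact lt_irrefl _ hpq)
    have h2 := hκ r hr hrq
    have : (0 : ℝ) < (cross p q r : ℤ) := by
      simp only [cross]
      push_cast
      nlinarith [mul_pos hpq' (sub_pos.2 h2), mul_pos h' (sub_pos.2 h1)]
    exact_mod_cast this
  have left : r.1 < p.1 → 0 < cross p q r := by
    intro h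
    have h' : (0 : ℝ) < p.1 - r.1 := sub_pos.2 (by exact_mod_cast h)
    obtain ⟨hpK, κ, hκ⟩ := hp
    have h1 := hκ q hq.1 (fun h => by rw [h] at hpq; exact lt_irrefl _ hpq)
    have h2 := hκ r hr hrp
    have : (0 : ℝ) < (cross p q r : ℤ) := by
      simp only [cross]
      push_cast
      nlinarith [mul_pos hpq' (sub_pos.2 h2), mul_pos h' (sub_pos.2 h1)]
    exact_mod_cast this
  rcases h with h | h | h
  · exact right h
  · exact left h
  rcases lt_or_ge q.1 r.1 with h1 | h1
  · exact right h1
  rcases lt_or_ge r.1 p.1 with h2 | h2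
  · exact left h2
  obtain ⟨-, κ, hκ⟩ := h
  have e1 := hκ (-p) (pt_neg_mem_reflect.2 hp.1) fun h => hrp (neg_injective h).symm
  have e2 := hκ (-q) (pt_neg_mem_reflect.2 hq.1) fun h => hrq (neg_injective h).symm
  simp only [Prod.fst_neg, Prod.snd_neg, Int.cast_neg] at e1 e2
  have a1 : (0 : ℝ) ≤ q.1 - r.1 := sub_nonneg.2 (by exact_mod_cast h1)
  have a2 : (0 : ℝ) ≤ r.1 - p.1 := sub_nonneg.2 (by exact_mod_cast h2)
  have : (0 : ℝ) < (cross p q r : ℤ) := by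
    simp only [cross]
    push_cast
    rcases a1.lt_or_eq with a1 | a1
    · nlinarith [mul_pos a1 (sub_pos.2 e1), mul_nonneg a2 (sub_nonneg.2 e2.le)]
    · have a2 : (0 : ℝ) < r.1 - p.1 := by linarith
      nlinarith [mul_pos a2 (sub_pos.2 e2)]
  exact_mod_cast this

/-! ### Hull vertices as strict minimizers -/

namespace LowerHull
variable {K : Set Plane} {h : ℕ} {A : ℕ → ℤ × ℤ}

/-- Left turns make the edge slopes strictly increasing, so the slopes of the two edges at `A j`
serve. Where an edge is missing, a slope shifted by one replaces it. -/
theorem exists_slopes (hA : LowerHull K h A) {j : ℕ} (hj : j < h) :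
    ∃ κ₁ κ₂ : ℝ, κ₁ < κ₂ ∧
      (∀ l < j, ((A (l + 1)).2 : ℝ) - (A l).2 ≤ κ₁ * ((A (l + 1)).1 - (A l).1)) ∧
      ∀ l, j ≤ l → l + 1 < h → κ₂ * ((A (l + 1)).1 - (A l).1) ≤ (A (l + 1)).2 - (A l).2 := by
  set m : ℕ → ℝ := fun l => (((A (l + 1)).2 : ℝ) - (A l).2) / ((A (l + 1)).1 - (A l).1) with hm
  have pos : ∀ l, l + 1 < h → (0 : ℝ) < (A (l + 1)).1 - (A l).1 := fun l hl =>
    sub_pos.2 (by exact_mod_cast hA.mono l hl)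
  have step : ∀ l, l + 2 < h → m l < m (l + 1) := by
    intro l hl
    have h1 := pos l (by omega)
    have h2 := pos (l + 1) hl
    have h3 : (0 : ℝ) < (cross (A l) (A (l + 1)) (A (l + 2)) : ℤ) := by exact_mod_cast hA.turn l hl
    simp only [hm, div_lt_div_iff₀ h1 h2]
    simp only [cross] at h3
    push_cast at h3
    rw [show l + 1 + 1 = l + 2 from rfl]
    nlinarith
  have mono : ∀ l l', l ≤ l' → l' + 1 < h → m l ≤ m l' := by
    intro l l' hll
    induction l', hll using Nat.le_induction with
    | base => exact fun _ => le_rfl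
    | succ l' hl ih => exact fun hl' => (ih (by omega)).trans (step l' hl').le
  suffices H : ∃ κ₁ κ₂ : ℝ, κ₁ < κ₂ ∧ (∀ l < j, m l ≤ κ₁) ∧
      ∀ l, j ≤ l → l + 1 < h → κ₂ ≤ m l by
    obtain ⟨κ₁, κ₂, h1, h2, h3⟩ := H
    exact ⟨κ₁, κ₂, h1, fun l hl => (div_le_iff₀ (pos l (by omega))).1 (h2 l hl),
      fun l hl hl' => (le_div_iff₀ (pos l hl')).1 (h3 l hl hl')⟩
  rcases Nat.eq_zero_or_pos j with rfl | hj0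
  · exact ⟨m 0 - 1, m 0, by linarith, fun l hl => absurd hl (Nat.not_lt_zero l),
      fun l hl hl' => mono 0 l hl hl'⟩
  · obtain ⟨i, rfl⟩ : ∃ i, j = i + 1 := ⟨j - 1, by omega⟩
    by_cases h1 : i + 2 < h
    · exact ⟨m i, m (i + 1), step i h1, fun l hl => mono l i (by omega) hj,
        fun l hl hl' => mono _ l hl hl'⟩
    · exact ⟨m i, m i + 1, by linarith, fun l hl => mono l i (by omega) hj,
        fun l hl hl' => by omega⟩

/-- For each slope between `κ₁` and `κ₂` the minimum over the chain, hence over all lattice points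
of `K`, is attained at `A j`. For fixed `z` the excess over this minimum is affine in the slope; if
it vanishes at the midpoint it vanishes at both ends, which forces `z = A j`. -/
theorem low (hA : LowerHull K h A) {j : ℕ} (hj : j < h) : Low K (A j) := by
  obtain ⟨κ₁, κ₂, hκ, hl, hr⟩ := hA.exists_slopes hj
  have pos : ∀ l, l + 1 < h → (0 : ℝ) < (A (l + 1)).1 - (A l).1 := fun l hl =>
    sub_pos.2 (by exact_mod_cast hA.mono l hl)
  have weak : ∀ κ, κ₁ ≤ κ → κ ≤ κ₂ → ∀ l < h,
      ((A j).2 : ℝ) - κ * (A j).1 ≤ (A l).2 - κ * (A l).1 := by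
    intro κ h1 h2 l hlh
    rcases le_total j l with hjl | hjl
    · induction l, hjl using Nat.le_induction with
      | base => exact le_rfl
      | succ l hjl ih =>
        have := hr l hjl hlh
        have := mul_le_mul_of_nonneg_right h2 (pos l hlh).le
        have := ih (by omega)
        nlinarith
    · obtain ⟨d, hd⟩ := Nat.exists_eq_add_of_le hjl
      clear hjl
      induction d generalizing l with
      | zero => rw [hd, add_zero]
      | succ d ih =>
        have := hl l (by omega)
        have := mul_le_mul_of_nonneg_right h1 (pos l (by omega)).le
        have := ih (l + 1) (by omega) (by omega)
        nlinarith
  have weak' : ∀ κ, κ₁ ≤ κ → κ ≤ κ₂ → ∀ z, pt z ∈ K →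
      ((A j).2 : ℝ) - κ * (A j).1 ≤ z.2 - κ * z.1 := by
    intro κ h1 h2 z hz
    obtain ⟨_, ⟨l, hl, rfl⟩, hc⟩ := (hA.cov z hz).2.2 κ
    exact (weak κ h1 h2 l hl).trans hc
  refine ⟨hA.mem j hj, (κ₁ + κ₂) / 2, fun z hz hne => ?_⟩
  by_contra hcon
  have h1 := weak' κ₁ le_rfl hκ.le z hz
  have h2 := weak' κ₂ hκ.le le_rfl z hz
  have e1 : (κ₂ - κ₁) * ((z.1 : ℝ) - (A j).1) = 0 := by nlinarith
  have e2 : (z.1 : ℝ) = (A j).1 :=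
    sub_eq_zero.1 ((mul_eq_zero.1 e1).resolve_left (sub_pos.2 hκ).ne')
  rw [e2] at hcon h1
  exact hne (Prod.ext (by exact_mod_cast e2)
    (by exact_mod_cast (by linarith : (z.2 : ℝ) = (A j).2)))

theorem lt_of_lt (hA : LowerHull K h A) {i j : ℕ} (hij : i < j) (hj : j < h) :
    (A i).1 < (A j).1 := fst_strictMono hA.mono hij hj

theorem eq_of_fst_eq (hA : LowerHull K h A) {i j : ℕ} (hi : i < h) (hj : j < h)
    (he : (A i).1 = (A j).1) : i = j := by
  rcases lt_trichotomy i j with h1 | h1 | h1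
  · exact absurd he (hA.lt_of_lt h1 hj).ne
  · exact h1
  · exact absurd he (hA.lt_of_lt h1 hi).ne'

theorem first_le (hA : LowerHull K h A) {z : ℤ × ℤ} (hz : pt z ∈ K) : (A 0).1 ≤ z.1 := by
  obtain ⟨_, ⟨l, hl, rfl⟩, hc⟩ := (hA.cov z hz).1
  rcases Nat.eq_zero_or_pos l with rfl | h0
  · exact hc
  · exact (hA.lt_of_lt h0 hl).le.trans hc

theorem le_last (hA : LowerHull K h A) {z : ℤ × ℤ} (hz : pt z ∈ K) : z.1 ≤ (A (h - 1)).1 := by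
  obtain ⟨_, ⟨l, hl, rfl⟩, hc⟩ := (hA.cov z hz).2.1
  simp only [Set.mem_Iio] at hl
  rcases (Nat.le_sub_one_of_lt hl).eq_or_lt with rfl | h0
  · exact hc
  · exact hc.trans (hA.lt_of_lt h0 (by omega)).le

theorem size_pos (hA : LowerHull K h A) {z : ℤ × ℤ} (hz : pt z ∈ K) : 0 < h := by
  obtain ⟨_, ⟨l, hl, -⟩, -⟩ := (hA.cov z hz).1
  exact (Nat.zero_le l).trans_lt hl

variable {g : ℕ} {B : ℕ → ℤ × ℤ}

theorem eq_zero_iff (hA : LowerHull K h A) (hB : LowerHull (reflect K) g B) : h = 0 ↔ g = 0 := by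
  constructor <;> intro h0 <;> by_contra h1
  · have := hA.size_pos (z := -B 0) (by simpa [reflect, pt_neg] using hB.mem 0 (by omega))
    omega
  · have := hB.size_pos (pt_neg_mem_reflect.2 (hA.mem 0 (by omega)))
    omega

/-- A point common to both hulls is an end of each of them. -/
theorem common (hA : LowerHull K h A) (hB : LowerHull (reflect K) g B) {j l : ℕ} (hj : j < h)
    (hl : l < g) (he : A j = -B l) : j = 0 ∧ l = g - 1 ∨ j = h - 1 ∧ l = 0 := by
  have he' : B l = -A j := by rw [he, neg_neg]
  have hm : ∀ i < g, pt (-B i) ∈ K := fun i hi => by simpa [reflect, pt_neg] using hB.mem i hi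
  by_cases h0 : j = 0
  · subst h0
    refine .inl ⟨rfl, hB.eq_of_fst_eq hl (by omega) (le_antisymm ?_ ?_)⟩
    · exact hB.le_last (hB.mem l hl)
    · have := hA.first_le (hm (g - 1) (by omega))
      rw [he] at this
      simpa using this
  by_cases h1 : j = h - 1
  · refine .inr ⟨h1, hB.eq_of_fst_eq hl (by omega) (le_antisymm ?_ ?_)⟩
    · have := hA.le_last (hm 0 (by omega))
      rw [← h1, he] at this
      simpa using this
    · exact hB.first_le (hB.mem l hl)
  have a1 := hA.lt_of_lt (i := 0) (j := j) (by omega) hj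
  have a2 := hA.lt_of_lt (i := j) (j := h - 1) (by omega) (by omega)
  have n1 : A j ≠ A 0 := fun h => by rw [h] at a1; exact lt_irrefl _ a1
  have n2 : A j ≠ A (h - 1) := fun h => by rw [← h] at a2; exact lt_irrefl _ a2
  have n3 : A (h - 1) ≠ A 0 := fun h => by rw [h] at a2; exact lt_asymm a1 a2
  -- An inner point on both hulls would lie strictly above and strictly below the chord from `A 0`
  -- to `A (h - 1)`.
  have c1 := (hA.low (j := 0) (by omega)).cross_pos (hA.low (j := h - 1) (by omega))
    (a1.trans a2) (hA.mem j hj) n1 n2 (.inr (.inr (he' ▸ hB.low hl)))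
  have c2 := (hA.low (j := 0) (by omega)).cross_pos (hA.low hj) a1 (hA.mem (h - 1) (by omega)) n3
    n2.symm (.inl a2)
  simp only [cross] at c1 c2
  linarith

end LowerHull

/-- A unique minimizer over `D` of a linear functional remains its unique minimizer over the convex
hull, so it is interior to no segment of the hull. -/
theorem mem_extremePoints_of_lt {D : Set Plane} {a : Plane} (ha : a ∈ D) (p q : ℝ)
    (h : ∀ z ∈ D, z ≠ a → p * a 0 + q * a 1 < p * z 0 + q * z 1) :
    a ∈ (convexHull ℝ D).extremePoints ℝ := by
  have hsub : ∀ z ∈ convexHull ℝ D, z = a ∨ p * a 0 + q * a 1 < p * z 0 + q * z 1 := by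
    refine fun z hz => convexHull_min (t := {z | z = a ∨ p * a 0 + q * a 1 < p * z 0 + q * z 1})
      (fun z hz => ?_) ?_ hz
    · by_cases hza : z = a
      · exact .inl hza
      · exact .inr (h z hz hza)
    · intro x hx y hy s t hs ht hst
      have e : p * (s • x + t • y) 0 + q * (s • x + t • y) 1 = (p * a 0 + q * a 1) +
          s * ((p * x 0 + q * x 1) - (p * a 0 + q * a 1)) +
          t * ((p * y 0 + q * y 1) - (p * a 0 + q * a 1)) := by
        simp only [PiLp.add_apply, PiLp.smul_apply, smul_eq_mul]
        linear_combination (p * a 0 + q * a 1) * hst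
      rcases hs.eq_or_lt with rfl | hs'
      · rwa [zero_smul, zero_add, show t = 1 by linarith, one_smul]
      rcases ht.eq_or_lt with rfl | ht'
      · rwa [zero_smul, add_zero, show s = 1 by linarith, one_smul]
      rcases hx with hx | hx <;> rcases hy with hy | hy
      · exact .inl (by rw [hx, hy, ← add_smul, hst, one_smul])
      · right
        rw [hx, sub_self, mul_zero] at e
        have := mul_pos ht' (sub_pos.2 hy)
        rw [hx]
        linarith
      · right
        rw [hy, sub_self, mul_zero] at e
        have := mul_pos hs' (sub_pos.2 hx)
        rw [hy]
        linarith
      · right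
        have := mul_pos hs' (sub_pos.2 hx)
        have := mul_pos ht' (sub_pos.2 hy)
        linarith
  have key : ∀ x ∈ convexHull ℝ D, ∀ y ∈ convexHull ℝ D, a ∈ openSegment ℝ x y → x = a := by
    rintro x hx y hy ⟨s, t, hs, ht, hst, he⟩
    have e0 : s * x 0 + t * y 0 = a 0 := by rw [← he]; simp
    have e1 : s * x 1 + t * y 1 = a 1 := by rw [← he]; simp
    rcases hsub x hx with h1 | h1
    · exact h1
    · exfalso
      have e : s * ((p * x 0 + q * x 1) - (p * a 0 + q * a 1)) +
          t * ((p * y 0 + q * y 1) - (p * a 0 + q * a 1)) = 0 := by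
        linear_combination p * e0 + q * e1 - (p * a 0 + q * a 1) * hst
      have h3 := mul_pos hs (sub_pos.2 h1)
      rcases hsub y hy with h2 | h2
      · rw [h2, sub_self, mul_zero] at e
        linarith
      · have := mul_pos ht (sub_pos.2 h2)
        linarith
  exact ⟨subset_convexHull ℝ D ha, fun x hx y hy hxy => key x hx y hy hxy⟩

/-- A lattice point outside the convex hull could be separated from `S` by a functional `p x + q y`.
For `q > 0` the lower hull and for `q < 0` the upper hull has a point with a value no larger, tested
with slope `-p / q`; for `q = 0` the clauses of `Cov` on abscissae provide one. -/
theorem LowerHull.subset_convexHull {K : Set Plane} {h g : ℕ} {A B : ℕ → ℤ × ℤ} {S : Set Plane}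
    (hA : LowerHull K h A) (hB : LowerHull (reflect K) g B) (hS : S.Finite)
    (hAS : ∀ j < h, pt (A j) ∈ S) (hBS : ∀ l < g, pt (-B l) ∈ S) :
    K ∩ lattice ⊆ convexHull ℝ S := by
  rintro _ ⟨hzK, hz⟩
  obtain ⟨z, rfl⟩ := mem_lattice_iff.1 hz
  by_contra hcon
  obtain ⟨f, u, hu, hb⟩ := geometric_hahn_banach_point_closed (convex_convexHull ℝ S)
    (hS.isClosed_convexHull ℝ) hcon
  set p := f !₂[1, 0]
  set q := f !₂[0, 1]
  have hf : ∀ w : Plane, f w = p * w 0 + q * w 1 := by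
    intro w
    have : w = w 0 • !₂[(1 : ℝ), 0] + w 1 • !₂[(0 : ℝ), 1] := plane_ext (by simp) (by simp)
    conv_lhs => rw [this]
    rw [map_add, map_smul, map_smul, smul_eq_mul, smul_eq_mul, mul_comm, mul_comm (w 1)]
  have lowA : ∀ j < h, p * z.1 + q * z.2 < p * (A j).1 + q * (A j).2 := by
    intro j hj
    have := hu.trans (hb _ (_root_.subset_convexHull ℝ S (hAS j hj)))
    simpa only [hf, pt_zero, pt_one] using this
  have lowB : ∀ l < g, p * z.1 + q * z.2 < p * (-(B l).1) + q * (-(B l).2) := by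
    intro l hl
    have := hu.trans (hb _ (_root_.subset_convexHull ℝ S (hBS l hl)))
    simpa only [hf, pt_zero, pt_one, Prod.fst_neg, Prod.snd_neg, Int.cast_neg] using this
  rcases lt_trichotomy q 0 with hq | hq | hq
  · obtain ⟨_, ⟨l, hl, rfl⟩, hc⟩ := (hB.cov _ (pt_neg_mem_reflect.2 hzK)).2.2 (-p / q)
    have h1 := lowB l hl
    have h2 := mul_le_mul_of_nonneg_left hc (neg_pos.2 hq).le
    have e : ∀ x y : ℝ, -q * (y - -p / q * x) = -(p * x + q * y) := fun x y => by
      have := hq.ne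
      field_simp
      ring
    rw [e, e] at h2
    simp only [Prod.fst_neg, Prod.snd_neg, Int.cast_neg] at h2
    linarith
  · rcases le_total 0 p with hp | hp
    · obtain ⟨_, ⟨l, hl, rfl⟩, hc⟩ := (hA.cov _ hzK).1
      have h1 := lowA l hl
      have : ((A l).1 : ℝ) ≤ z.1 := by exact_mod_cast hc
      rw [hq] at h1
      nlinarith
    · obtain ⟨_, ⟨l, hl, rfl⟩, hc⟩ := (hA.cov _ hzK).2.1
      have h1 := lowA l hl
      have : (z.1 : ℝ) ≤ (A l).1 := by exact_mod_cast hc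
      rw [hq] at h1
      nlinarith
  · obtain ⟨_, ⟨l, hl, rfl⟩, hc⟩ := (hA.cov _ hzK).2.2 (-p / q)
    have h1 := lowA l hl
    have h2 := mul_le_mul_of_nonneg_left hc hq.le
    have e : ∀ x y : ℝ, q * (y - -p / q * x) = p * x + q * y := fun x y => by
      have := hq.ne'
      field_simp
      ring
    rw [e, e] at h2
    linarith

/-- The lower hull from left to right, followed by the upper hull from right to left. -/
def around (h : ℕ) (A B : ℕ → ℤ × ℤ) (j : ℕ) : ℤ × ℤ :=
  if j < h then A j else -B (j - h)

/-- The numbers `g'` and `o` remove exactly the duplicates allowed by `LowerHull.common`. The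
remaining points are strict minimizers, which gives extremality and, through `Low.cross_pos`, all
left turns; they span the discrete hull, so no extreme point is missing. -/
theorem isVertexList {K : Set Plane} {h g g' o : ℕ} {A B : ℕ → ℤ × ℤ} (hA : LowerHull K h A)
    (hB : LowerHull (reflect K) g B)
    (hg' : g' = if around h A B (h + g - 1) = around h A B 0 then g - 1 else g)
    (ho : o = if 1 ≤ g' ∧ around h A B h = around h A B (h - 1) then 1 else 0) :
    IsVertexList (discreteHull K)
      (fun i : Fin (h + (g' - o)) => pt (around h A B (if i.1 < h then i.1 else i.1 + o))) := by
  set V : ℕ → ℤ × ℤ := fun i => around h A B (if i < h then i else i + o) with hV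
  have hgg : g' ≤ g := by rw [hg']; split_ifs <;> omega
  have hog : o ≤ g' := by rw [ho]; split_ifs <;> omega
  have VA : ∀ i < h, V i = A i := fun i hi => by simp [hV, around, hi]
  have VB : ∀ i, h ≤ i → V i = -B (i - h + o) := fun i hi => by
    have h1 : ¬ i < h := not_lt.2 hi
    have h2 : ¬ i + o < h := by omega
    simp only [hV, around, if_neg h1, if_neg h2, show i + o - h = i - h + o by omega]
  have hz := hA.eq_zero_iff hB
  have memB : ∀ l < g, pt (-B l) ∈ K := fun i hi => by
    simpa [reflect, pt_neg] using hB.mem i hi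
  have lowB : ∀ l < g, Low (reflect K) (-(-B l)) := fun l hl => by
    rw [neg_neg]
    exact hB.low hl
  -- no retained point of the upper hull is on the lower hull
  have disj : ∀ j < h, ∀ l, o ≤ l → l < g' → A j ≠ -B l := by
    intro j hj l hl hl' he
    rcases hA.common hB hj (by omega) he with ⟨rfl, h2⟩ | ⟨h1, rfl⟩
    · have hcond : around h A B (h + g - 1) = around h A B 0 := by
        have h3 : ¬ h + g - 1 < h := by omega
        simp only [around, if_neg h3, if_pos hj, show h + g - 1 - h = l by omega, he]
      rw [if_pos hcond] at hg'
      omega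
    · have hcond : around h A B h = around h A B (h - 1) := by
        have h3 : h - 1 < h := by omega
        simp only [around, lt_irrefl, if_false, if_pos h3, Nat.sub_self]
        rw [← h1, he]
      rw [if_pos ⟨by omega, hcond⟩] at ho
      omega
  have cr : ∀ i j k, i < j → j < k → k < h + (g' - o) → 0 < cross (V i) (V j) (V k) := by
    intro i j k hij hjk hk
    rcases lt_or_ge j h with hj | hj
    · have hx := hA.lt_of_lt hij hj
      have hi : i < h := hij.trans hj
      rw [VA i hi, VA j hj]
      rcases lt_or_ge k h with hk' | hk'
      · have hx' := hA.lt_of_lt hjk hk'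
        rw [VA k hk']
        exact (hA.low hi).cross_pos (hA.low hj) hx (hA.mem k hk')
          (fun h => by rw [h] at hx'; exact lt_asymm hx hx')
          (fun h => by rw [h] at hx'; exact lt_irrefl _ hx') (.inl hx')
      · rw [VB k hk']
        exact (hA.low hi).cross_pos (hA.low hj) hx (memB _ (by omega))
          (disj i hi _ (by omega) (by omega)).symm (disj j hj _ (by omega) (by omega)).symm
          (.inr (.inr (lowB _ (by omega))))
    · have hx := hB.lt_of_lt (i := j - h + o) (j := k - h + o) (by omega) (by omega)
      -- Two points on the upper hull: rotating the triple and reflecting it in the origin makes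
      -- them the points `p`, `q` on a lower hull.
      rw [VB j hj, VB k (by omega), cross_rotate, ← cross_neg, neg_neg, neg_neg]
      rcases lt_or_ge i h with hi | hi
      · rw [VA i hi]
        refine (hB.low (by omega)).cross_pos (hB.low (by omega)) hx
          (pt_neg_mem_reflect.2 (hA.mem i hi)) (fun h => ?_) (fun h => ?_) (.inr (.inr ?_))
        · exact disj i hi _ (by omega) (by omega) (neg_eq_iff_eq_neg.1 h)
        · exact disj i hi _ (by omega) (by omega) (neg_eq_iff_eq_neg.1 h)
        · rw [neg_neg, reflect_reflect]
          exact hA.low hi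
      · have hx' := hB.lt_of_lt (i := i - h + o) (j := j - h + o) (by omega) (by omega)
        rw [VB i hi, neg_neg]
        exact (hB.low (by omega)).cross_pos (hB.low (by omega)) hx (hB.mem _ (by omega))
          (fun h => by rw [h] at hx'; exact lt_irrefl _ hx')
          (fun h => by rw [h] at hx'; exact lt_asymm hx hx') (.inr (.inl hx'))
  have ne : ∀ i j, i < j → j < h + (g' - o) → V i ≠ V j := by
    intro i j hij hj he
    rcases lt_or_ge j h with hj' | hj'
    · rw [VA i (by omega), VA j hj'] at he
      exact (hA.lt_of_lt hij hj').ne (congrArg Prod.fst he)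
    · rcases lt_or_ge i h with hi | hi
      · rw [VA i hi, VB j hj'] at he
        exact disj i hi _ (by omega) (by omega) he
      · rw [VB i hi, VB j hj'] at he
        exact (hB.lt_of_lt (i := i - h + o) (j := j - h + o) (by omega) (by omega)).ne
          (congrArg Prod.fst (neg_injective he))
  have hasA : ∀ j < h, ∃ i < h + (g' - o), V i = A j := fun j hj => ⟨j, by omega, VA j hj⟩
  -- A removed point of the upper hull is still listed, as the last or the first point of the lower
  -- hull.
  have hasB : ∀ l < g, ∃ i < h + (g' - o), V i = -B l := by
    intro l hl
    by_cases h1 : l < o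
    · have hcond : 1 ≤ g' ∧ around h A B h = around h A B (h - 1) := by
        by_contra hcon
        rw [if_neg hcon] at ho
        omega
      rw [if_pos hcond] at ho
      have h3 : h - 1 < h := by omega
      have e := hcond.2
      simp only [around, lt_irrefl, if_false, if_pos h3, Nat.sub_self] at e
      exact ⟨h - 1, by omega, by rw [VA _ h3, show l = 0 by omega, e]⟩
    by_cases h2 : l < g'
    · exact ⟨h + (l - o), by omega, by rw [VB _ (by omega), show h + (l - o) - h + o = l by omega]⟩
    · have hcond : around h A B (h + g - 1) = around h A B 0 := by
        by_contra hcon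
        rw [if_neg hcon] at hg'
        omega
      rw [if_pos hcond] at hg'
      have h3 : ¬ h + g - 1 < h := by omega
      have h4 : 0 < h := by omega
      simp only [around, if_neg h3, if_pos h4, show h + g - 1 - h = l by omega] at hcond
      exact ⟨0, by omega, by rw [VA _ h4, hcond]⟩
  refine ⟨subset_antisymm ?_ ?_, fun i j he => ?_, fun i j k hij hjk => ?_⟩
  · rintro _ ⟨i, rfl⟩
    change pt (V i) ∈ _
    rcases lt_or_ge i.1 h with hi | hi
    · rw [VA _ hi]
      obtain ⟨hK, κ, hκ⟩ := hA.low hi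
      refine mem_extremePoints_of_lt ⟨hK, mem_lattice_iff.2 ⟨_, rfl⟩⟩ (-κ) 1 ?_
      rintro _ ⟨hzK, hz⟩ hne
      obtain ⟨z, rfl⟩ := mem_lattice_iff.1 hz
      have := hκ z hzK fun h => hne (by rw [h])
      simp only [pt_zero, pt_one]
      linarith
    · rw [VB _ hi]
      have hl : i.1 - h + o < g := by omega
      obtain ⟨hK, κ, hκ⟩ := hB.low hl
      refine mem_extremePoints_of_lt ⟨memB _ hl, mem_lattice_iff.2 ⟨_, rfl⟩⟩ κ (-1) ?_
      rintro _ ⟨hzK, hz⟩ hne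
      obtain ⟨z, rfl⟩ := mem_lattice_iff.1 hz
      have := hκ (-z) (pt_neg_mem_reflect.2 hzK) fun h => hne (by rw [← h, neg_neg])
      simp only [pt_zero, pt_one, Prod.fst_neg, Prod.snd_neg, Int.cast_neg] at this ⊢
      linarith
  · set S := Set.range fun i : Fin (h + (g' - o)) => pt (V i) with hS
    have hsub : K ∩ lattice ⊆ convexHull ℝ S := by
      refine hA.subset_convexHull hB (Set.finite_range _) (fun j hj => ?_) (fun l hl => ?_)
      · obtain ⟨i, hi, he⟩ := hasA j hj
        exact ⟨⟨i, hi⟩, by rw [← he]⟩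
      · obtain ⟨i, hi, he⟩ := hasB l hl
        exact ⟨⟨i, hi⟩, by rw [← he]⟩
    have hSK : S ⊆ K ∩ lattice := by
      rintro _ ⟨i, rfl⟩
      refine ⟨?_, mem_lattice_iff.2 ⟨_, rfl⟩⟩
      rcases lt_or_ge i.1 h with hi | hi
      · simp only [VA _ hi]
        exact hA.mem _ hi
      · simp only [VB _ hi]
        exact memB _ (by omega)
    have : discreteHull K = convexHull ℝ S :=
      subset_antisymm (convexHull_min hsub (convex_convexHull ℝ S)) (convexHull_mono hSK)
    rw [this]
    exact extremePoints_convexHull_subset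
  · have he' : V i = V j := pt_injective he
    rcases lt_trichotomy i j with h1 | h1 | h1
    · exact absurd he' (ne i j h1 j.2)
    · exact h1
    · exact absurd he'.symm (ne j i h1 i.2)
  · change 0 < orient (pt (V i)) (pt (V j)) (pt (V k))
    rw [orient_pt]
    exact_mod_cast cr i j k hij hjk k.2

end DiscreteHull

namespace DiscreteHull

open DiscreteHull.Expr (var)

/-! ### Convex polygons -/

theorem orient_rotate (p q r : Plane) : orient p q r = orient q r p := by
  simp only [orient]
  ring

theorem orient_neg (p q r : Plane) : orient (-p) (-q) (-r) = orient p q r := by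
  simp only [orient, PiLp.neg_apply]
  ring

theorem orient_self_left (p q : Plane) : orient p q p = 0 := by
  simp [orient]

theorem orient_self_right (p q : Plane) : orient p q q = 0 := by
  simp only [orient]
  ring

theorem convex_coord_le (c : ℝ) : Convex ℝ {z : Plane | c ≤ z 0} := by
  intro x hx y hy s t hs ht hst
  simp only [Set.mem_ofPred_eq, PiLp.add_apply, PiLp.smul_apply, smul_eq_mul] at *
  have e : c = s * c + t * c := by rw [← add_mul, hst, one_mul]
  linarith [mul_le_mul_of_nonneg_left hx hs, mul_le_mul_of_nonneg_left hy ht]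

theorem convex_coord_ge (c : ℝ) : Convex ℝ {z : Plane | z 0 ≤ c} := by
  intro x hx y hy s t hs ht hst
  simp only [Set.mem_ofPred_eq, PiLp.add_apply, PiLp.smul_apply, smul_eq_mul] at *
  have e : c = s * c + t * c := by rw [← add_mul, hst, one_mul]
  linarith [mul_le_mul_of_nonneg_left hx hs, mul_le_mul_of_nonneg_left hy ht]

theorem convex_orient_nonneg (p q : Plane) : Convex ℝ {z : Plane | 0 ≤ orient p q z} := by
  intro x hx y hy s t hs ht hst
  simp only [Set.mem_ofPred_eq, orient, PiLp.add_apply, PiLp.smul_apply, smul_eq_mul] at *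
  have ht' : t = 1 - s := by linarith
  subst ht'
  nlinarith [mul_nonneg hs hx, mul_nonneg ht hy]

/-- Side tests and bounds on abscissae define half-planes, so they need checking at vertices only.
There the turn condition on increasing triples applies after a cyclic rotation, with equality at the
ends of the edge. Nondegeneracy holds because three vertices on a vertical line cannot make a strict
turn. -/
theorem cyclic_of_convex {n : ℕ} (hn : 3 ≤ n) {u : ℕ → Plane}
    (hu : ∀ i j k, i < j → j < k → k < n → 0 < orient (u i) (u j) (u k)) {L : ℕ} (hL : L < n)
    (hmin : ∀ i < n, u L 0 ≤ u i 0) :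
    Cyclic (convexHull ℝ (u '' Set.Iio n)) n (fun t => u ((L + t) % n)) := by
  have hn0 : 0 < n := by omega
  have idx : ∀ i < n, ∃ t ≤ n, (L + t) % n = i := by
    intro i hi
    rcases le_total L i with h | h
    · exact ⟨i - L, by omega, by rw [Nat.add_sub_cancel' h, Nat.mod_eq_of_lt hi]⟩
    · refine ⟨i + n - L, by omega, ?_⟩
      rw [show L + (i + n - L) = i + n by omega, Nat.add_mod_right, Nat.mod_eq_of_lt hi]
  have L0 : (L + 0) % n = L := by rw [add_zero, Nat.mod_eq_of_lt hL]
  refine ⟨convex_convexHull ℝ _, fun t => subset_convexHull ℝ _ ⟨_, Nat.mod_lt _ hn0, rfl⟩,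
    fun z hz t => ?_, fun z hz => ?_, fun z hz => ?_, ?_⟩
  · refine convexHull_min ?_ (convex_orient_nonneg _ _) hz
    rintro _ ⟨k, hk, rfl⟩
    simp only [Set.mem_Iio] at hk
    have hi := Nat.mod_lt (L + t) hn0
    rw [Set.mem_ofPred_eq, ← add_assoc, succ_mod _ _ hn0]
    generalize (L + t) % n = i at hi
    split_ifs with h
    · rcases lt_trichotomy k i with h1 | rfl | h1
      · rw [← orient_rotate]
        exact (hu k i (i + 1) h1 (by omega) h).le
      · rw [orient_self_left]
      · rcases (Nat.succ_le_of_lt h1).eq_or_lt with h2 | h2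
        · rw [← h2, orient_self_right]
        · exact (hu i (i + 1) k (by omega) h2 hk).le
    · rcases Nat.eq_zero_or_pos k with rfl | h1
      · rw [orient_self_right]
      · rcases (show k ≤ i by omega).eq_or_lt with rfl | h2
        · rw [orient_self_left]
        · rw [orient_rotate]
          exact (hu 0 k i h1 h2 hi).le
  · rw [L0]
    refine convexHull_min ?_ (convex_coord_le _) hz
    rintro _ ⟨k, hk, rfl⟩
    exact hmin k hk
  · obtain ⟨M, hM, hmax⟩ := Finset.exists_max_image (Finset.range n) (fun i => u i 0)
      ⟨0, Finset.mem_range.2 hn0⟩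
    obtain ⟨t, ht, he⟩ := idx M (Finset.mem_range.1 hM)
    refine ⟨t, ht, ?_⟩
    rw [he]
    refine convexHull_min ?_ (convex_coord_ge _) hz
    rintro _ ⟨k, hk, rfl⟩
    exact hmax k (Finset.mem_range.2 hk)
  · by_contra hcon
    push Not at hcon
    have heq : ∀ i < n, u i 0 = u L 0 := by
      intro i hi
      obtain ⟨t, ht, he⟩ := idx i hi
      have := hcon t ht
      rw [he, L0] at this
      exact le_antisymm this (hmin i hi)
    have := hu 0 1 2 (by norm_num) (by norm_num) (by omega)
    simp only [orient, heq 0 (by omega), heq 1 (by omega), heq 2 (by omega)] at this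
    simp at this

/-- The vertices as a sequence indexed by the natural numbers. -/
noncomputable def vertexSeq {n : ℕ} (v : Fin n → Plane) (i : ℕ) : Plane :=
  if h : i < n then v ⟨i, h⟩ else 0

theorem image_vertexSeq {n : ℕ} (v : Fin n → Plane) :
    vertexSeq v '' Set.Iio n = Set.range v := by
  ext z
  constructor
  · rintro ⟨i, hi, rfl⟩
    have hi' : i < n := hi
    exact ⟨⟨i, hi'⟩, by simp [vertexSeq, hi']⟩
  · rintro ⟨i, rfl⟩
    exact ⟨i, i.2, dif_pos i.2⟩

theorem image_neg_vertexSeq {n : ℕ} (v : Fin n → Plane) :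
    convexHull ℝ ((fun i => -vertexSeq v i) '' Set.Iio n) = reflect (polygon v) := by
  have : (fun i => -vertexSeq v i) '' Set.Iio n = -(Set.range v) := by
    rw [← image_vertexSeq, ← Set.image_neg_eq_neg, Set.image_image]
  rw [this, convexHull_neg]
  rfl

theorem orient_vertexSeq_pos {n : ℕ} {v : Fin n → Plane} (hv : IsConvexCCW v) (i j k : ℕ)
    (hij : i < j) (hjk : j < k) (hk : k < n) :
    0 < orient (vertexSeq v i) (vertexSeq v j) (vertexSeq v k) := by
  have hj : j < n := hjk.trans hk
  have hi : i < n := hij.trans hj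
  simp only [vertexSeq, dif_pos hi, dif_pos hj, dif_pos hk]
  exact hv.2 ⟨i, hi⟩ ⟨j, hj⟩ ⟨k, hk⟩ hij hjk

theorem coord_sub_le_diam {n : ℕ} (v : Fin n → Plane) {a b : Plane} (ha : a ∈ polygon v)
    (hb : b ∈ polygon v) : a 0 - b 0 ≤ Metric.diam (polygon v) := by
  have hbd : Bornology.IsBounded (polygon v) :=
    isBounded_convexHull.2 (Set.finite_range v).isBounded
  calc a 0 - b 0 ≤ ‖(a - b) 0‖ := le_abs_self _
    _ ≤ ‖a - b‖ := PiLp.norm_apply_le _ _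
    _ = dist a b := (dist_eq_norm a b).symm
    _ ≤ _ := Metric.dist_le_diam_of_mem hbd ha hb

/-! ### The program -/

/-- One pass computes the lower hull of the input multiplied by register `1`. -/
def passProg : Program := sweepProg ;; scanProg

/-- The whole program. -/
def hullProg : Program :=
  1 ≔ 1 ;; passProg ;; 1 ≔ 0 - 1 ;; 11 ≔ var 10 ;; passProg ;; outputProg

theorem passProg_spec : ∃ C : ℕ, ∀ (K : Set Plane) (n : ℕ) (u : ℕ → Plane) (m : ℕ), 1 ≤ n →
    (∀ L < n, (∀ i < n, u L 0 ≤ u i 0) → Cyclic K n (fun t => u ((L + t) % n))) →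
    (∀ a ∈ K, ∀ b ∈ K, a 0 - b 0 < 2 ^ m) →
    ∀ (s : Memory) (σ : ℝ) (B : ℕ), σ * σ = 1 → Reads s n u → s.reg 1 = σ → s.reg 10 = B →
      s.reg 11 = B →
      Ends passProg s (C * (n * (m + 1) ^ 2)) (fun s' =>
        (∀ a, a ≠ 2 → a ≠ 3 → a ≠ 4 → a ≠ 5 → s'.arr a = s.arr a) ∧
        (∀ j < B, s'.arr 4 j = s.arr 4 j ∧ s'.arr 5 j = s.arr 5 j) ∧
        s'.reg 0 = s.reg 0 ∧ s'.reg 11 = s.reg 11 ∧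
        ∃ (h : ℕ) (A : ℕ → ℤ × ℤ), h ≤ n * (2 * m + 2) ∧ s'.reg 10 = (B + h : ℕ) ∧
          Stack s' σ B h A ∧ LowerHull K h A) := by
  obtain ⟨C₁, h₁⟩ := sweepProg_spec
  obtain ⟨C₂, h₂⟩ := scanProg_spec
  refine ⟨C₁ + 3 * C₂, fun K n u m hn hK hw s σ B hσ hR r1 r10 r11 => ?_⟩
  unfold passProg
  refine ((h₁ K n u m hn hK hw s hR).seq (B' := C₂ * (n * (2 * m + 2) + 1)) ?_).mono ?_
    (fun _ h => h)
  · rintro s₁ ⟨f, N, E, hN, r18, hE, hc⟩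
    refine (h₂ K s₁ σ B N E hσ hc hE (f.r1.trans r1) (f.r10.trans r10) (f.r11.trans r11)
      r18).mono (Nat.mul_le_mul_left _ (by omega)) ?_
    rintro s₂ ⟨f', h, A, hh, k10, hS, hA⟩
    refine ⟨fun a h2 h3 h4 h5 => (f'.arr a h4 h5).trans (f.arr a h2 h3), fun j hj => ⟨?_, ?_⟩,
      ?_, ?_, h, A, hh.trans hN, k10, hS, hA⟩
    · rw [f'.low 4 j hj, f.arr 4 (by norm_num) (by norm_num)]
    · rw [f'.low 5 j hj, f.arr 5 (by norm_num) (by norm_num)]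
    · rw [f'.reg 0 (by norm_num) (by norm_num) (by norm_num) (by norm_num), f.r0]
    · rw [f'.reg 11 (by norm_num) (by norm_num) (by norm_num) (by norm_num), f.r11]
  · have : n * (2 * m + 2) + 1 ≤ 3 * (n * (m + 1) ^ 2) := by
      nlinarith [Nat.mul_le_mul_left n (Nat.le_self_pow two_ne_zero (m + 1)),
        Nat.mul_le_mul hn (Nat.one_le_pow 2 (m + 1) (by omega))]
    nlinarith [Nat.mul_le_mul_left C₂ this]

/-- Reflection in the origin preserves orientation and lattice, so the same pass with sign `-1` in
register `1` finds the upper hull. Its stack begins at cell `h`, behind the lower hull, which it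
leaves intact. -/
theorem hullProg_spec : ∃ C : ℕ, ∀ (n : ℕ), 3 ≤ n → ∀ v : Fin n → Plane, IsConvexCCW v →
    ∀ m : ℕ, Metric.diam (polygon v) < 2 ^ m →
    Ends hullProg (inputMemory v) (C * (n * (m + 1) ^ 2)) (fun s' => ∃ (M : ℕ) (w : Fin M → Plane),
      HasOutput s' w ∧ IsVertexList (discreteHull (polygon v)) w) := by
  obtain ⟨C₁, h₁⟩ := passProg_spec
  obtain ⟨C₂, h₂⟩ := outputProg_spec
  refine ⟨timeBound (1 ≔ 1) + C₁ + timeBound (1 ≔ 0 - 1) + timeBound (11 ≔ var 10) + C₁ + 5 * C₂,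
    fun n hn v hv m hm => ?_⟩
  have hu := orient_vertexSeq_pos hv
  have hw₁ : ∀ a ∈ polygon v, ∀ b ∈ polygon v, a 0 - b 0 < 2 ^ m := fun a ha b hb =>
    (coord_sub_le_diam v ha hb).trans_lt hm
  have hw₂ : ∀ a ∈ reflect (polygon v), ∀ b ∈ reflect (polygon v), a 0 - b 0 < 2 ^ m :=
    fun a ha b hb => by
      have := hw₁ _ hb _ ha
      simp only [PiLp.neg_apply] at this
      linarith
  have hK₁ : ∀ L < n, (∀ i < n, vertexSeq v L 0 ≤ vertexSeq v i 0) →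
      Cyclic (polygon v) n (fun t => vertexSeq v ((L + t) % n)) := fun L hL hmin => by
    have := cyclic_of_convex hn hu hL hmin
    rwa [image_vertexSeq] at this
  have hK₂ : ∀ L < n, (∀ i < n, (-vertexSeq v L) 0 ≤ (-vertexSeq v i) 0) →
      Cyclic (reflect (polygon v)) n (fun t => -vertexSeq v ((L + t) % n)) := fun L hL hmin => by
    rw [← image_neg_vertexSeq]
    exact cyclic_of_convex hn (u := fun i => -vertexSeq v i)
      (fun i j k hij hjk hk => by rw [orient_neg]; exact hu i j k hij hjk hk) hL hmin
  have hx : ∀ i < n, (inputMemory v).arr 0 i = vertexSeq v i 0 := fun i hi => by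
    simp [inputMemory, vertexSeq, hi]
  have hy : ∀ i < n, (inputMemory v).arr 1 i = vertexSeq v i 1 := fun i hi => by
    simp [inputMemory, vertexSeq, hi]
  have h0 : (inputMemory v).reg 0 = n := by simp [inputMemory]
  unfold hullProg
  refine ((Ends.of_exec (Q := fun s' => s' = (inputMemory v).set 1 1) (by rfl)
    (by simp [exec])).seq (B' := C₁ * (n * (m + 1) ^ 2) + (timeBound (1 ≔ 0 - 1) +
    (timeBound (11 ≔ var 10) + (C₁ * (n * (m + 1) ^ 2) + C₂ *
    (n * (2 * m + 2) + n * (2 * m + 2) + 1))))) fun s₁ e₁ => ?_).mono ?_ (fun _ h => h)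
  swap
  · have h3 : n * (2 * m + 2) + n * (2 * m + 2) + 1 ≤ 5 * (n * (m + 1) ^ 2) := by
      nlinarith [Nat.mul_le_mul_left n (Nat.le_self_pow two_ne_zero (m + 1)),
        Nat.mul_le_mul (by omega : 1 ≤ n) (Nat.one_le_pow 2 (m + 1) (by omega))]
    have h4 : 1 ≤ n * (m + 1) ^ 2 := Nat.mul_pos (by omega) (Nat.pow_pos m.succ_pos)
    have h5 := Nat.mul_le_mul_left C₂ h3
    generalize timeBound (1 ≔ 1) = a₁
    generalize timeBound (1 ≔ 0 - 1) = a₂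
    generalize timeBound (11 ≔ var 10) = a₃
    generalize n * (m + 1) ^ 2 = r at *
    have := Nat.le_mul_of_pos_right (a₁ + a₂ + a₃) h4
    nlinarith
  refine (h₁ _ n _ m (by omega) hK₁ hw₁ s₁ 1 0 (by norm_num) ⟨?_, ?_, ?_⟩ ?_ ?_ ?_).seq ?_
  · simp [e₁, h0]
  · intro i hi
    simp [e₁, hx i hi]
  · intro i hi
    simp [e₁, hy i hi]
  · simp [e₁]
  · simp [e₁, inputMemory]
  · simp [e₁, inputMemory]
  rintro s₂ ⟨fa, -, f0, -, h, A, hh, r10, hS, hA⟩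
  refine (Ends.of_exec (Q := fun s' => s' = s₂.set 1 (-1)) (by rfl) (by simp [exec])).seq
    fun s₃ e₃ => ?_
  refine (Ends.of_exec (Q := fun s' => s' = s₃.set 11 h) (by rfl)
    (by simp [exec, e₃, r10])).seq fun s₄ e₄ => ?_
  have a₄ : s₄.arr = s₂.arr := by rw [e₄, e₃]; rfl
  refine (h₁ _ n _ m (by omega) hK₂ hw₂ s₄ (-1) h (by norm_num) ⟨?_, ?_, ?_⟩ ?_ ?_ ?_).seq ?_
  · simp [e₄, e₃, f0, e₁, h0]
  · intro i hi
    rw [a₄, fa 0 (by norm_num) (by norm_num) (by norm_num) (by norm_num)]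
    simp [e₄, e₃, e₁, hx i hi]
  · intro i hi
    rw [a₄, fa 1 (by norm_num) (by norm_num) (by norm_num) (by norm_num)]
    simp [e₄, e₃, e₁, hy i hi]
  · simp [e₄, e₃]
  · simp [e₄, e₃, r10]
  · simp [e₄]
  rintro s₅ ⟨-, flow, -, f11, g, B, hg, q10, hS', hB⟩
  have hW : HoldsSeq s₅ 4 5 (h + g) (around h A B) := by
    intro j hj
    by_cases hjh : j < h
    · obtain ⟨l1, l2⟩ := flow j hjh
      obtain ⟨t1, t2⟩ := hS j hjh
      rw [zero_add] at t1 t2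
      simp [around, hjh, l1, l2, a₄, t1, t2]
    · obtain ⟨i, rfl⟩ := Nat.exists_eq_add_of_le (not_lt.1 hjh)
      obtain ⟨t1, t2⟩ := hS' i (by omega)
      simp [around, t1, t2]
  refine (h₂ s₅ h g _ hW (hA.eq_zero_iff hB) q10 (f11.trans (by simp [e₄]))).mono
    (Nat.mul_le_mul_left _ (by omega)) ?_
  rintro s₆ ⟨g', o, hg', ho, k0, hout⟩
  refine ⟨_, _, ⟨k0, fun i => ?_⟩, isVertexList hA hB hg' ho⟩
  have := hout i i.2
  simpa only [pt_zero, pt_one] using this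

/-- With `f = ⌊log₂ (2 + δ)⌋` the exponent is `f + 1`. From `log 2 ≥ 1 / 2` follow `f ≤ 2 log (2 +
δ)` and `2 ≤ 4 log (2 + δ)`, which add up to the constant `6`. -/
theorem exists_exponent {δ : ℝ} (hδ : 0 ≤ δ) :
    ∃ m : ℕ, δ < 2 ^ m ∧ (m + 1 : ℝ) ≤ 6 * Real.log (2 + δ) := by
  have h2 : 0 < Real.log 2 := Real.log_pos one_lt_two
  have hle : Real.log 2 ≤ Real.log (2 + δ) := Real.log_le_log two_pos (by linarith)
  have hpos : (0 : ℝ) ≤ Real.log (2 + δ) / Real.log 2 :=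
    div_nonneg (h2.le.trans hle) h2.le
  refine ⟨⌊Real.log (2 + δ) / Real.log 2⌋₊ + 1, ?_, ?_⟩
  · have h := Nat.lt_floor_add_one (Real.log (2 + δ) / Real.log 2)
    rw [div_lt_iff₀ h2] at h
    have h' : Real.log (2 + δ) < Real.log (2 ^ (⌊Real.log (2 + δ) / Real.log 2⌋₊ + 1)) := by
      rw [Real.log_pow]
      push_cast
      exact h
    have := (Real.log_lt_log_iff (by linarith) (by positivity)).1 h'
    linarith
  · have h := Nat.floor_le hpos
    rw [le_div_iff₀ h2] at h
    have h3 : (1 / 2 : ℝ) ≤ Real.log 2 := by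
      have := Real.log_two_gt_d9
      linarith
    push_cast
    set f : ℝ := (⌊Real.log (2 + δ) / Real.log 2⌋₊ : ℝ)
    have hf : 0 ≤ f := Nat.cast_nonneg _
    nlinarith

end DiscreteHull
-- The time bound in terms of the diameter
theorem mainTheorem9 :
    ∃ (A : DiscreteHull.Program) (c : ℝ),
      ∀ (n : ℕ), 3 ≤ n →
        ∀ v : Fin n → DiscreteHull.Plane, DiscreteHull.IsConvexCCW v →
          ∃ (s : DiscreteHull.Memory) (t m : ℕ) (w : Fin m → DiscreteHull.Plane),
            DiscreteHull.Runs A (DiscreteHull.inputMemory v) s t ∧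
            DiscreteHull.HasOutput s w ∧
            DiscreteHull.IsVertexList
              (DiscreteHull.discreteHull (DiscreteHull.polygon v)) w ∧
            (t : ℝ) ≤ c * ((n : ℝ) * Real.log n *
              Real.log (2 + Metric.diam (DiscreteHull.polygon v)) ^ 2) := by
  obtain ⟨C, hC⟩ := DiscreteHull.hullProg_spec
  refine ⟨DiscreteHull.hullProg, 36 * C, fun n hn v hv => ?_⟩
  obtain ⟨e, he, hle⟩ := DiscreteHull.exists_exponent
    (Metric.diam_nonneg (s := DiscreteHull.polygon v))
  obtain ⟨s, t, hr, ht, m, w, hout, hw⟩ := hC n hn v hv e he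
  refine ⟨s, t, m, w, hr, hout, hw, ?_⟩
  set l := Real.log (2 + Metric.diam (DiscreteHull.polygon v))
  have hn' : (3 : ℝ) ≤ n := by exact_mod_cast hn
  -- Since `n ≥ 3 > e`, the factor `log n` may be inserted for free; the constant `36` is the square
  -- of the `6` from `exists_exponent`.
  have hlog : 1 ≤ Real.log n := by
    rw [Real.le_log_iff_exp_le (by linarith)]
    linarith [Real.exp_one_lt_d9]
  have h1 : (e + 1 : ℝ) ^ 2 ≤ (6 * l) ^ 2 := pow_le_pow_left₀ (by positivity) hle 2
  calc (t : ℝ) ≤ (C * (n * (e + 1) ^ 2) : ℕ) := by exact_mod_cast ht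
    _ = C * (n * (e + 1 : ℝ) ^ 2) := by push_cast; ring
    _ ≤ C * ((n * Real.log n) * (6 * l) ^ 2) := by
      gcongr
      exact le_mul_of_one_le_right (by linarith) hlog
    _ = 36 * C * (n * Real.log n * l ^ 2) := by ring
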